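/- **Conventions.** Let $q\in\mathbb C$, $q\neq 0$. For $n\in\mathbb Z$ let $[n]=\frac{q^n-q^{-n}}{q-q^{-1}}$ (at $q=\pm1$: the limit $nq^{n-1}$), and $[n]!=[1]\cdots[n]$, $[0]!=1$. If $q^2$ is a primitive $r$-th root of unity for some $r>1$ (e.g. $q=e^{i\pi/r}$), call $q$ *of level $r$*; otherwise $q$ is *generic*. All labels (twice-spins) are nonnegative integers. A triple $(a,b,c)$ is *admissible* if $a\le b+c$, $b\le c+a$, $c\le a+b$, $a+b+c$ is even and, when $q$ has level $r$, $a,b,c\le r-2$ and $a+b+c\le 2r-4$. The spin networks involved are evaluated in the Kauffman–Lins normalization: * bubble: $\Delta_j=(-1)^j[j+1]$, and $\Delta_j=0$ if $q$ has level $r$ and $j>r-2$; * $\theta(a,b,c)=\dfrac{(-1)^s[s+1]!\,[s-a]!\,[s-b]!\,[s-c]!}{[a]!\,[b]!\,[c]!}$ with $s=\frac{a+b+c}2$ if $(a,b,c)$ is admissible, and $0$ otherwise; * if $(a,b,l),(c,d,l),(a,d,j),(c,b,j)$ are all admissible, $$\operatorname{Tet}(a,b,c,d;j,l)=\frac{\prod_{i,k}[b_k-a_i]!}{[a]![b]![c]![d]![j]![l]!}\sum_{S=\max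 a_i}^{\min b_k}\frac{(-1)^S[S+1]!}{\prod_i[S-a_i]!\prod_k[b_k-S]!},$$ with $a_1=\frac{a+d+j}2$, $a_2=\frac{b+c+j}2$, $a_3=\frac{a+b+l}2$, $a_4=\frac{c+d+l}2$, $b_1=\frac{b+d+j+l}2$, $b_2=\frac{a+c+j+l}2$, $b_3=\frac{a+b+c+d}2$; otherwise $\operatorname{Tet}(a,b,c,d;j,l)=0$. Fix twice-spins $(a,b,c,d)$. Let $J$ be the finite set of $j$ with $(a,d,j),(c,b,j)$ admissible and $\Lambda$ the finite set of $l$ with $(a,b,l),(c,d,l)$ admissible. Let $V$ be the complex vector space with basis $|\bar j\rangle$, $j\in J$ (the 4-valent networks), with the bilinear form $$\langle\bar j|\bar j'\rangle=\delta_{jj'}\,N_j,\qquad N_j=\frac{\theta(b,c,j)\,\theta(a,d,j)}{\Delta_j},$$ and, with the Kauffman–Lins $6j$-symbol as coefficients, put $$|l\rangle=\sum_{j\in J}\frac{\operatorname{Tet}(a,b,c,d;j,l)\,\Delta_j}{\theta(a,d,j)\,\theta(b,c,j)}\,|\bar j\rangle .$$ Let $L$ be the linear operator on $V$ with matrix elements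 $$\langle\bar j|L|\bar j'\rangle=\bar L_{jj'}=\frac{[a][b]}{\theta(j,j',2)}\operatorname{Tet}(a,a,j,j';d,2)\operatorname{Tet}(b,b,j,j';c,2),$$ understood as $0$ if $(j,j',2)$ is not admissible; put also $\bar L_{jj'}=0$ if $j\notin J$ or $j'\notin J$. Finally let $$\lambda(a,b,l)=\frac{\left[\frac{a-b+l}2\right]\left[\frac{-a+b+l}2\right]-\left[\frac{a+b-l}2\right]\left[\frac{a+b+l}2+2\right]}{[2]},$$ where for $[2]=0$ (i.e. $r=2$, when all admissible labels are $0$ and the numerator vanishes) $\lambda:=0$. **Theorem.** 1. The form is symmetric and nondegenerate. The vectors $|l\rangle$, $l\in\Lambda$, form a basis of $V$, $\langle l|l'\rangle=\delta_{ll'}\,\theta(a,b,l)\theta(c,d,l)/\Delta_l$ with $\langle l|l\rangle\ne0$, and $\langle\bar j|l\rangle=\operatorname{Tet}(a,b,c,d;j,l)$. 2. $L$ is symmetric for the form, and for $l,l'\in\Lambda$ $$\langle l|L|l'\rangle=\frac{[a][b]}{\Delta_l}\,\theta(c,d,l)\operatorname{Tet}(a,a,b,b;l,2)\,\delta_{ll'}=\lambda(a,b,l)\,\langle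 l|l'\rangle ;$$ each $|l\rangle$ is an eigenvector of $L$, with eigenvalue $\lambda(a,b,l)$. 3. $\bar L$ is symmetric and tridiagonal: $\bar L_{jj'}=\bar L_{j'j}$, and $\bar L_{jj'}=0$ unless $j'\in\{j-2,j,j+2\}$. For $j\in J$, $$\bar L_{jj}=-\langle\bar j|\bar j\rangle\frac{[2]\,\lambda(a,j,d)\,\lambda(b,j,c)}{[j][j+2]}\quad\text{if } j\ne0 \text{ and } [j+2]\neq0,$$ while $\bar L_{jj}=0$ if $j=0$ or $[j+2]=0$ (the latter happens only for $j=r-2$); and if $j,j+2\in J$, $$\bar L_{j,j+2}=\langle\overline{j+2}|\overline{j+2}\rangle\left[\tfrac{a+d-j}2\right]\left[\tfrac{b+c-j}2\right].$$ 4. For arbitrary labels $x,y,l,j$: if $x,y>0$ and $(x,y,l)$ is admissible, $\operatorname{Tet}(x,x,y,y;l,2)=\frac{\theta(x,y,l)}{[x][y]}\lambda(x,y,l)$; if $x>0$ and $(x,y,j)$ is admissible, $\operatorname{Tet}(x,x,j,j+2;y,2)=\operatorname{Tet}(x,x,j+2,j;y,2)=\frac1{[x]}\left[\frac{x+y-j}2\right]\theta(x,y,j+2)$;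 moreover $\theta(j,j,2)=-\frac{[j+2]}{[2][j]}\Delta_j$ for $j>0$ with $[2][j]\ne0$, and $\theta(j,j+2,2)=\Delta_{j+2}$ for $j\ge 0$. 5. For each $l\in\Lambda$, with $\lambda_l=\lambda(a,b,l)$, the transition coefficients satisfy for every $j\in J$ $$\sum_{j'\in J}\left(\bar L_{jj'}-\lambda_l\langle\bar j'|\bar j'\rangle\delta_{jj'}\right)\frac{\langle\bar j'|l\rangle}{\langle\bar j'|\bar j'\rangle}=0,$$ that is, the three-term recurrence $$\frac{\bar L_{j,j-2}}{\langle\overline{j-2}|\overline{j-2}\rangle}\langle\overline{j-2}|l\rangle+\left(\frac{\bar L_{jj}}{\langle\bar j|\bar j\rangle}-\lambda_l\right)\langle\bar j|l\rangle+\frac{\bar L_{j,j+2}}{\langle\overline{j+2}|\overline{j+2}\rangle}\langle\overline{j+2}|l\rangle=0$$ (terms whose index lies outside $J$ are $0$), together with the normalization $$\sum_{j\in J}\frac{\langle l|\bar j\rangle\langle\bar j|l\rangle}{\langle\bar j|\bar j\rangle}=\langle l|l\rangle .$$ Conversely, any complex $(x_j)_{j\in J}$ satisfying the same recurrence and $\sum_{j\in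 J}x_j^2/\langle\bar j|\bar j\rangle=\langle l|l\rangle$ equals $(\langle\bar j|l\rangle)_{j\in J}$ up to a global sign. -/

import Mathlib

/-!  Recoupling theory of twice-spins in the Kauffman-Lins normalization.
All labels (twice-spins) are natural numbers, `q` is a nonzero complex number. -/

namespace TetNet

noncomputable section

/-- The quantum integer `[n]`.  At `q = 1` and `q = -1` it is the limit of the generic expression. -/
def qint (q : ℂ) (n : ℤ) : ℂ :=
  if q ^ 2 = 1 then (n : ℂ) * q ^ (n - 1) else (q ^ n - q ^ (-n)) / (q - q⁻¹)

/-- The quantum factorial `[n]! = [1][2]⋯[n]`. -/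
def qfact (q : ℂ) (n : ℕ) : ℂ :=
  ∏ k ∈ Finset.range n, qint q ((k : ℤ) + 1)

/-- Admissible triples of twice-spins.  The last clause is `r`-boundedness; it is only present when
`q ^ 2` is a primitive `r`-th root of unity for some `r > 1`, e.g. when `q = exp (i π / r)`. -/
def Admissible (q : ℂ) (a b c : ℕ) : Prop :=
  (a ≤ b + c ∧ b ≤ c + a ∧ c ≤ a + b) ∧ Even (a + b + c) ∧
    ∀ r : ℕ, 1 < r → IsPrimitiveRoot (q ^ 2) r →
      (a + 2 ≤ r ∧ b + 2 ≤ r ∧ c + 2 ≤ r) ∧ a + b + c + 4 ≤ 2 * r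

open Classical in
/-- The bubble network with label `j`. -/
def bubble (q : ℂ) (j : ℕ) : ℂ :=
  if ∀ r : ℕ, 1 < r → IsPrimitiveRoot (q ^ 2) r → j + 2 ≤ r then
    (-1) ^ j * qint q ((j : ℤ) + 1)
  else 0

open Classical in
/-- The `θ`-network. -/
def theta (q : ℂ) (a b c : ℕ) : ℂ :=
  if Admissible q a b c then
    let s := (a + b + c) / 2
    (-1) ^ s * qfact q (s + 1) * qfact q (s - a) * qfact q (s - b) * qfact q (s - c) /
      (qfact q a * qfact q b * qfact q c)
  else 0

/-- The four vertex half-sums `a₁, …, a₄` of a tetrahedron. -/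
def vtx (a b c d j l : ℕ) : Fin 4 → ℕ :=
  ![(a + d + j) / 2, (b + c + j) / 2, (a + b + l) / 2, (c + d + l) / 2]

/-- The three quadrilateral half-sums `b₁, b₂, b₃` of a tetrahedron. -/
def quad (a b c d j l : ℕ) : Fin 3 → ℕ :=
  ![(b + d + j + l) / 2, (a + c + j + l) / 2, (a + b + c + d) / 2]

open Classical in
/-- The `Tet`-network `Tet(a,b,c,d;j,l)`.  The sum runs over `max aᵢ ≤ S ≤ min bₖ`. -/
def tet (q : ℂ) (a b c d j l : ℕ) : ℂ :=
  if Admissible q a b l ∧ Admissible q c d l ∧ Admissible q a d j ∧ Admissible q c b j then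
    (∏ i, ∏ k, qfact q (quad a b c d j l k - vtx a b c d j l i)) /
      (qfact q a * qfact q b * qfact q c * qfact q d * qfact q j * qfact q l) *
    ∑ S ∈ Finset.Icc (Finset.univ.sup' Finset.univ_nonempty (vtx a b c d j l))
        (Finset.univ.inf' Finset.univ_nonempty (quad a b c d j l)),
      (-1) ^ S * qfact q (S + 1) /
        ((∏ i, qfact q (S - vtx a b c d j l i)) * ∏ k, qfact q (quad a b c d j l k - S))
  else 0

open Classical in
/-- The admissible labels `j` of the horizontal basis of 4-valent networks. -/
def jSet (q : ℂ) (a b c d : ℕ) : Finset ℕ :=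
  (Finset.range (a + d + 1)).filter fun j => Admissible q a d j ∧ Admissible q c b j

open Classical in
/-- The admissible labels `l` of the vertical basis of 4-valent networks. -/
def lSet (q : ℂ) (a b c d : ℕ) : Finset ℕ :=
  (Finset.range (a + b + 1)).filter fun l => Admissible q a b l ∧ Admissible q c d l

/-- The truncation to a finite range in `jSet` loses nothing. -/
theorem mem_jSet {q : ℂ} {a b c d j : ℕ} :
    j ∈ jSet q a b c d ↔ Admissible q a d j ∧ Admissible q c b j := by
  simp only [jSet, Finset.mem_filter, Finset.mem_range, and_iff_right_iff_imp]
  intro h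
  have := h.1.1.2.2
  omega

/-- The truncation to a finite range in `lSet` loses nothing. -/
theorem mem_lSet {q : ℂ} {a b c d l : ℕ} :
    l ∈ lSet q a b c d ↔ Admissible q a b l ∧ Admissible q c d l := by
  simp only [lSet, Finset.mem_filter, Finset.mem_range, and_iff_right_iff_imp]
  intro h
  have := h.1.1.2.2
  omega

/-- The normalization `⟨j̄|j̄⟩` of the horizontal basis. -/
def normH (q : ℂ) (a b c d j : ℕ) : ℂ :=
  theta q b c j * theta q a d j / bubble q j

/-- The normalization `⟨l|l⟩` of the vertical basis. -/
def normV (q : ℂ) (a b c d l : ℕ) : ℂ :=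
  theta q a b l * theta q c d l / bubble q l

/-- The Kauffman-Lins `6j`-symbol `{a b j; c d l}`. -/
def sixj (q : ℂ) (a b c d j l : ℕ) : ℂ :=
  tet q a b c d j l / (theta q a d j * theta q b c j) * bubble q j

/-- The space of 4-valent networks with free edges `a, b, c, d`, in coordinates with respect to the
horizontal basis. -/
abbrev Net (q : ℂ) (a b c d : ℕ) : Type := (jSet q a b c d) → ℂ

/-- The bilinear (not sesquilinear) form on 4-valent networks. -/
def braket (q : ℂ) (a b c d : ℕ) : LinearMap.BilinForm ℂ (Net q a b c d) :=
  Matrix.toBilin' (Matrix.diagonal fun j : jSet q a b c d => normH q a b c d j)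

/-- The horizontal basis vector `|j̄⟩`. -/
def ketH (q : ℂ) (a b c d : ℕ) (j : jSet q a b c d) : Net q a b c d :=
  Pi.single j 1

/-- The vertical vector `|l⟩ = ∑ⱼ {a b j; c d l} |j̄⟩`. -/
def ketV (q : ℂ) (a b c d l : ℕ) : Net q a b c d :=
  ∑ j : jSet q a b c d, sixj q a b c d j l • ketH q a b c d j

/-- The number `λ(a,b,l)`. -/
def lam (q : ℂ) (a b l : ℕ) : ℂ :=
  (qint q (((a : ℤ) - b + l) / 2) * qint q ((-(a : ℤ) + b + l) / 2)
    - qint q (((a : ℤ) + b - l) / 2) * qint q (((a : ℤ) + b + l) / 2 + 2)) / qint q 2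

open Classical in
/-- The matrix element `⟨j̄| L |j̄'⟩`: the legs `a` and `b` are joined by an edge of twice-spin `2`
through vertices weighted by `[a]` and `[b]`.  It vanishes outside the admissible range, and when
the central vertex `(j, j', 2)` is not admissible. -/
def Lbar (q : ℂ) (a b c d j j' : ℕ) : ℂ :=
  if j ∈ jSet q a b c d ∧ j' ∈ jSet q a b c d ∧ Admissible q j j' 2 then
    qint q a * qint q b / theta q j j' 2 * tet q a a j j' d 2 * tet q b b j j' c 2
  else 0

/-- The operator `L` on 4-valent networks, `L |j̄'⟩ = ∑ⱼ (⟨j̄| L |j̄'⟩ / ⟨j̄|j̄⟩) |j̄⟩`. -/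
def opL (q : ℂ) (a b c d : ℕ) : Net q a b c d →ₗ[ℂ] Net q a b c d :=
  Matrix.toLin' (Matrix.of fun j j' : jSet q a b c d =>
    Lbar q a b c d j j' / normH q a b c d j)

/-- The three-term recurrence in `j` for a sequence `x`, with `l` fixed. -/
def ThreeTerm (q : ℂ) (a b c d l : ℕ) (x : ℕ → ℂ) : Prop :=
  ∀ j ∈ jSet q a b c d,
    (if 2 ≤ j then Lbar q a b c d j (j - 2) / normH q a b c d (j - 2) * x (j - 2) else 0)
      + (Lbar q a b c d j j / normH q a b c d j - lam q a b l) * x j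
      + Lbar q a b c d j (j + 2) / normH q a b c d (j + 2) * x (j + 2) = 0

end

end TetNet

open TetNet

/-!
The operator `L` is symmetric for the bilinear form and tridiagonal in the horizontal basis, and the
vertical vectors are its eigenvectors; everything else follows from its spectrum being simple.

*Eigenvectors.* In coordinates, `L |l⟩ = λ_l |l⟩` is the three-term recurrence in `j` for the
tetrahedra `Tet(a,b,c,d;j,l)` (`threeTerm_tet`).  A tetrahedron is, up to a product of quantum
factorials, the alternating sum `racahSum`.  For that sum the recurrence comes from creative
telescoping: the summands satisfy it up to a difference `G(S+1) - G(S)`, by an identity of Laurent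
polynomials (`laurent_certificate`).  This argument divides by quantum integers, so it is first made
away from the roots of unity; both sides being continuous in `q`, the recurrence then holds for every
`q` at which no denominator vanishes (`racahSum_recurrence`).  Two cases need a separate treatment:
`j = 0` (`threeTerm_zero`) and `[j + 2] = 0`, where a vanishing common factor has to be divided out
before passing to the limit (`racahSum_recurrence_top`).

*Roots of unity.* The level enters through one fact only: a triple with half-sum `s` that satisfies
the triangle and parity conditions is admissible exactly if `[s + 1]! ≠ 0` (`admissible_iff`).  So
truncation at level `r` is the vanishing of factorials in the closed formulas.

*Orthogonality.* From `λ_{l+2m} - λ_l = [l+m+1][m]` the eigenvalues are distinct (`lam_injOn`), so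
different columns of the matrix `T` of tetrahedra are orthogonal.  The symmetry exchanging the two
pairings of the free edges (`tet_dual`) exchanges rows and columns, so different rows are orthogonal
as well.  Let `D_l`, `E_j` be the actual norms of columns and rows, `M_l`, `N_j` their asserted
values, namely `⟨l|l⟩` and `⟨j̄|j̄⟩`.  Evaluating `T M⁻¹ Tᵗ N⁻¹ T` in two ways gives
`E_j / N_j = D_l / M_l` wherever `T_jl ≠ 0`, so it is enough to find one row without zeros that has
the asserted norm.  The row with the smallest `j` is such a row (`exists_normalized_row`): its
entries have a single term, and its norm follows by induction on one of the labels from its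
orthogonality to the next row (`sum_tet_first`).

*Uniqueness.* A solution of the recurrence is orthogonal to all columns but one, so it is a multiple
of that column (`ThreeTerm.eq_mul_tet`), and the norm determines the factor up to sign.
-/

namespace TetNet

/-! ### Quantum integers -/

theorem qint_zero (q : ℂ) : qint q 0 = 0 := by
  simp [qint]

theorem sub_inv_ne_zero_of_sq_ne_one {q : ℂ} (hq : q ≠ 0) (h : q ^ 2 ≠ 1) : q - q⁻¹ ≠ 0 := by
  intro h2
  apply h
  field_simp at h2
  linear_combination h2

/-- `[n]` as a Laurent polynomial in `q`; this form also covers `q = 1` and `q = -1`. -/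
theorem qint_natCast {q : ℂ} (hq : q ≠ 0) (n : ℕ) :
    qint q n = ∑ k ∈ Finset.range n, q ^ ((n : ℤ) - 1 - 2 * k) := by
  unfold qint
  split_ifs with h
  · rw [Finset.sum_congr rfl (g := fun _ => q ^ ((n : ℤ) - 1))]
    · simp
    · intro k _
      rw [zpow_sub₀ hq, zpow_mul]
      have : q ^ (2 : ℤ) = 1 := by exact_mod_cast h
      rw [this, one_zpow, div_one]
  · have h1 := sub_inv_ne_zero_of_sq_ne_one hq h
    rw [div_eq_iff h1, Finset.sum_mul]
    have h2 := Finset.sum_range_sub' (fun k : ℕ => q ^ ((n : ℤ) - 2 * k)) n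
    simp only [Nat.cast_zero, mul_zero, sub_zero] at h2
    rw [show (-(n : ℤ)) = n - 2 * n by ring, ← h2]
    refine Finset.sum_congr rfl fun k _ => ?_
    rw [mul_sub, ← zpow_add_one₀ hq, ← zpow_sub_one₀ hq]
    push_cast
    congr 2 <;> ring

theorem qint_neg {q : ℂ} (hq : q ≠ 0) (n : ℤ) : qint q (-n) = -qint q n := by
  unfold qint
  split_ifs with h
  · have h2 : q ^ (2 : ℤ) = 1 := by exact_mod_cast h
    have : q ^ (n - 1) = q ^ (-n - 1) * (q ^ (2 : ℤ)) ^ n := by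
      rw [← zpow_mul, ← zpow_add₀ hq]
      congr 1
      ring
    rw [this, h2]
    simp
  · rw [neg_neg]
    ring

theorem qint_one {q : ℂ} (hq : q ≠ 0) : qint q 1 = 1 := by
  have := qint_natCast hq 1
  simpa using this

theorem continuousAt_qint {q₀ : ℂ} (hq : q₀ ≠ 0) (n : ℤ) :
    ContinuousAt (fun q => qint q n) q₀ := by
  have key : ∀ m : ℕ, ContinuousAt (fun q => qint q m) q₀ := fun m => by
    have h : ContinuousAt (fun q : ℂ => ∑ k ∈ Finset.range m, q ^ ((m : ℤ) - 1 - 2 * k)) q₀ :=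
      tendsto_finsetSum _ fun k _ => continuousAt_zpow₀ q₀ _ (Or.inl hq)
    refine h.congr ?_
    filter_upwards [isOpen_ne.mem_nhds hq] with q hq'
    exact (qint_natCast hq' m).symm
  obtain ⟨m, rfl | rfl⟩ := n.eq_nat_or_neg
  · exact key m
  · refine (key m).neg.congr ?_
    filter_upwards [isOpen_ne.mem_nhds hq] with q hq'
    exact (qint_neg hq' m).symm

/-- Neither zero nor a root of unity. -/
def NotRootOfUnity (q : ℂ) : Prop :=
  q ≠ 0 ∧ ∀ n : ℕ, 0 < n → q ^ n ≠ 1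

theorem dense_notRootOfUnity : Dense {q : ℂ | NotRootOfUnity q} := by
  have hc : ({0} ∪ ⋃ n : ℕ, {q : ℂ | 0 < n ∧ q ^ n = 1}).Countable := by
    refine (Set.countable_singleton 0).union (Set.countable_iUnion fun n => ?_)
    rcases Nat.eq_zero_or_pos n with rfl | hn
    · simp
    · refine (Set.Finite.subset (Polynomial.nthRootsFinset n (1 : ℂ)).finite_toSet ?_).countable
      rintro q ⟨_, hq⟩
      simpa [Polynomial.mem_nthRootsFinset hn] using hq
  refine (hc.dense_compl ℝ).mono ?_
  intro q hq
  simp only [Set.mem_compl_iff, Set.mem_union, Set.mem_singleton_iff, Set.mem_iUnion,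
    Set.mem_ofPred_eq, not_or, not_exists, not_and] at hq
  exact ⟨hq.1, hq.2⟩

/-- An identity between functions continuous at `q₀` holds at `q₀` as soon as it holds away from
the roots of unity. -/
theorem eq_of_notRootOfUnity {F G : ℂ → ℂ} {q₀ : ℂ} (hF : ContinuousAt F q₀)
    (hG : ContinuousAt G q₀) (h : ∀ q, NotRootOfUnity q → F q = G q) : F q₀ = G q₀ := by
  have h0 : q₀ ∈ closure {q : ℂ | NotRootOfUnity q} := dense_notRootOfUnity q₀
  have := mem_closure_iff_nhdsWithin_neBot.1 h0
  refine tendsto_nhds_unique (f := F) (l := nhdsWithin q₀ {q | NotRootOfUnity q})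
    (hF.mono_left nhdsWithin_le_nhds) ((hG.mono_left nhdsWithin_le_nhds).congr' ?_)
  filter_upwards [self_mem_nhdsWithin] with q hq
  exact (h q hq).symm

theorem NotRootOfUnity.sq_ne_one {q : ℂ} (h : NotRootOfUnity q) : q ^ 2 ≠ 1 :=
  h.2 2 (by norm_num)

theorem NotRootOfUnity.qint_eq {q : ℂ} (h : NotRootOfUnity q) (n : ℤ) :
    qint q n = (q ^ n - (q ^ n)⁻¹) / (q - q⁻¹) := by
  rw [qint, if_neg h.sq_ne_one, zpow_neg]

theorem NotRootOfUnity.qint_two {q : ℂ} (h : NotRootOfUnity q) : qint q 2 = q + q⁻¹ := by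
  have hq := h.1
  rw [h.qint_eq, div_eq_iff (sub_inv_ne_zero_of_sq_ne_one hq h.sq_ne_one)]
  norm_cast
  field_simp
  ring

theorem qint_eq_zero_iff {q : ℂ} (hq : q ≠ 0) {n : ℕ} (hn : 0 < n) :
    qint q n = 0 ↔ q ^ 2 ≠ 1 ∧ (q ^ 2) ^ n = 1 := by
  unfold qint
  split_ifs with h
  · have := zpow_ne_zero ((n : ℤ) - 1) hq
    simp [h, hn.ne', this]
  · rw [div_eq_zero_iff, or_iff_left (sub_inv_ne_zero_of_sq_ne_one hq h), sub_eq_zero, zpow_neg,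
      zpow_natCast, ← mul_eq_one_iff_eq_inv₀ (pow_ne_zero _ hq), ← pow_mul, two_mul, pow_add]
    simp [h]

theorem NotRootOfUnity.qint_ne_zero {q : ℂ} (h : NotRootOfUnity q) {n : ℕ} (hn : 0 < n) :
    qint q n ≠ 0 := by
  rw [Ne, qint_eq_zero_iff h.1 hn, ← pow_mul]
  exact fun h1 => h.2 _ (by omega) h1.2

/-! ### Quantum factorials -/

theorem qfact_zero (q : ℂ) : qfact q 0 = 1 := by
  simp [qfact]

theorem qfact_succ (q : ℂ) (n : ℕ) : qfact q (n + 1) = qfact q n * qint q ((n : ℤ) + 1) := by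
  simp [qfact, Finset.prod_range_succ]

theorem qfact_ne_zero_of_le {q : ℂ} {m n : ℕ} (h : qfact q n ≠ 0) (hmn : m ≤ n) :
    qfact q m ≠ 0 := by
  induction n, hmn using Nat.le_induction with
  | base => exact h
  | succ n _ ih =>
    rw [qfact_succ] at h
    exact ih (left_ne_zero_of_mul h)

theorem qint_ne_zero_of_qfact {q : ℂ} {n : ℕ} {k : ℤ} (h : qfact q n ≠ 0) (hk : 0 < k)
    (hkn : k ≤ n) : qint q k ≠ 0 := by
  obtain ⟨m, rfl⟩ : ∃ m : ℕ, k = m + 1 := ⟨(k - 1).toNat, by omega⟩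
  have := qfact_ne_zero_of_le h (m := m + 1) (by omega)
  rw [qfact_succ] at this
  exact right_ne_zero_of_mul this

theorem NotRootOfUnity.qfact_ne_zero {q : ℂ} (h : NotRootOfUnity q) (n : ℕ) : qfact q n ≠ 0 := by
  refine Finset.prod_ne_zero_iff.2 fun k _ => ?_
  exact_mod_cast h.qint_ne_zero (n := k + 1) (by omega)

theorem continuousAt_qfact {q₀ : ℂ} (hq : q₀ ≠ 0) (n : ℕ) :
    ContinuousAt (fun q => qfact q n) q₀ :=
  tendsto_finsetProd _ fun k _ => continuousAt_qint hq ((k : ℤ) + 1)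

/-- The level `r` of `q` exceeds `n` exactly when `[n]!` does not vanish. -/
theorem forall_level_iff {q : ℂ} (hq : q ≠ 0) (n : ℕ) :
    (∀ r : ℕ, 1 < r → IsPrimitiveRoot (q ^ 2) r → n + 1 ≤ r) ↔ qfact q n ≠ 0 := by
  constructor
  · intro h
    refine Finset.prod_ne_zero_iff.2 fun k hk h0 => ?_
    have h0' : qint q ((k + 1 : ℕ) : ℤ) = 0 := by exact_mod_cast h0
    obtain ⟨h1, h2⟩ := (qint_eq_zero_iff hq (Nat.succ_pos k)).1 h0'
    have h3 := orderOf_dvd_of_pow_eq_one h2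
    have h4 : orderOf (q ^ 2) ≠ 1 := by rwa [Ne, orderOf_eq_one_iff]
    have h5 := Nat.le_of_dvd (Nat.succ_pos k) h3
    have h6 : 0 < orderOf (q ^ 2) := Nat.pos_of_dvd_of_pos h3 (Nat.succ_pos k)
    have := h _ (by omega) (IsPrimitiveRoot.orderOf (q ^ 2))
    simp at hk
    omega
  · intro h r hr hp
    by_contra hlt
    refine qint_ne_zero_of_qfact h (k := (r : ℤ)) (by omega) (by omega) ?_
    rw [qint_eq_zero_iff hq (by omega)]
    refine ⟨fun h1 => ?_, hp.pow_eq_one⟩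
    have := hp.eq_orderOf
    rw [h1, orderOf_one] at this
    omega

/-- Admissibility in terms of the half-sum `s`: the bounds on the single labels follow from the
one on `s`, and the latter says that `[s + 1]!` is nonzero. -/
theorem admissible_iff {q : ℂ} (hq : q ≠ 0) {a b c : ℕ} :
    Admissible q a b c ↔ a ≤ b + c ∧ b ≤ c + a ∧ c ≤ a + b ∧ (a + b + c) % 2 = 0 ∧
      qfact q ((a + b + c) / 2 + 1) ≠ 0 := by
  rw [← forall_level_iff hq, Admissible, Nat.even_iff]
  constructor
  · rintro ⟨⟨h1, h2, h3⟩, h4, h5⟩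
    refine ⟨h1, h2, h3, h4, fun r hr hp => ?_⟩
    have := h5 r hr hp
    omega
  · rintro ⟨h1, h2, h3, h4, h5⟩
    refine ⟨⟨h1, h2, h3⟩, h4, fun r hr hp => ?_⟩
    have := h5 r hr hp
    omega

theorem bubble_of_ne {q : ℂ} (hq : q ≠ 0) {j : ℕ} (h : qfact q (j + 1) ≠ 0) :
    bubble q j = (-1) ^ j * qint q ((j : ℤ) + 1) := by
  rw [bubble, if_pos]
  exact (forall_level_iff hq (j + 1)).2 h

theorem bubble_of_eq {q : ℂ} (hq : q ≠ 0) {j : ℕ} (h : qfact q (j + 1) = 0) :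
    bubble q j = 0 := by
  rw [bubble, if_neg]
  intro h1
  exact (forall_level_iff hq (j + 1)).1 h1 h

theorem bubble_ne_zero {q : ℂ} (hq : q ≠ 0) {j : ℕ} (h : qfact q (j + 1) ≠ 0) :
    bubble q j ≠ 0 := by
  rw [bubble_of_ne hq h]
  exact mul_ne_zero (by simp) (qint_ne_zero_of_qfact h (by omega) (by push_cast; rfl))

/-! ### The alternating sum of the tetrahedron and its recurrence -/

/-- The reciprocal quantum factorial `1/[n]!`, which is `0` for negative `n`. -/
noncomputable def qfactInv (q : ℂ) (n : ℤ) : ℂ :=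
  if n < 0 then 0 else (qfact q n.toNat)⁻¹

theorem qfactInv_of_neg (q : ℂ) {n : ℤ} (h : n < 0) : qfactInv q n = 0 :=
  if_pos h

theorem qfactInv_natCast (q : ℂ) (n : ℕ) : qfactInv q n = (qfact q n)⁻¹ := by
  rw [qfactInv, if_neg (by omega), Int.toNat_natCast]

theorem qfactInv_zero (q : ℂ) : qfactInv q 0 = 1 := by
  simpa [qfact_zero] using qfactInv_natCast q 0

/-- The step `1/[n-1]! = [n]/[n]!`, valid for negative `n` and for `n = 0` as well. -/
theorem qfactInv_sub_one {q : ℂ} {N : ℕ} (hN : qfact q N ≠ 0) {n : ℤ} (hn : n ≤ N) :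
    qfactInv q (n - 1) = qint q n * qfactInv q n := by
  rcases lt_trichotomy n 0 with h | rfl | h
  · rw [qfactInv_of_neg q h, qfactInv_of_neg q (by omega), mul_zero]
  · rw [qint_zero, zero_mul, qfactInv_of_neg q (by omega)]
  · obtain ⟨m, rfl⟩ : ∃ m : ℕ, n = (m : ℤ) + 1 := ⟨(n - 1).toNat, by omega⟩
    have h1 := qint_ne_zero_of_qfact hN h hn
    rw [add_sub_cancel_right, qfactInv_natCast, show ((m : ℤ) + 1) = ((m + 1 : ℕ) : ℤ) by simp,
      qfactInv_natCast, qfact_succ, mul_inv]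
    push_cast
    field_simp

theorem NotRootOfUnity.qfactInv_sub_one {q : ℂ} (h : NotRootOfUnity q) (n : ℤ) :
    qfactInv q (n - 1) = qint q n * qfactInv q n :=
  TetNet.qfactInv_sub_one (h.qfact_ne_zero n.toNat) (by omega)

theorem continuousAt_qfactInv {q₀ : ℂ} (hq : q₀ ≠ 0) {N : ℕ} (hN : qfact q₀ N ≠ 0) {n : ℤ}
    (hn : n ≤ N) : ContinuousAt (fun q => qfactInv q n) q₀ := by
  unfold qfactInv
  split_ifs with h
  · exact continuousAt_const
  · exact (continuousAt_qfact hq _).inv₀ (qfact_ne_zero_of_le hN (by omega))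

/-- The summand of a tetrahedron with vertex half-sums `aᵢ` and quadrilateral half-sums `bₖ`. -/
noncomputable def racahTerm (q : ℂ) (a₁ a₂ a₃ a₄ b₁ b₂ b₃ : ℤ) (S : ℕ) : ℂ :=
  (-1) ^ S * qfact q (S + 1) *
    (qfactInv q (S - a₁) * qfactInv q (S - a₂) * qfactInv q (S - a₃) * qfactInv q (S - a₄)) *
    (qfactInv q (b₁ - S) * qfactInv q (b₂ - S) * qfactInv q (b₃ - S))

/-- The sum of `racahTerm` over `0 ≤ S < K`.  The terms with `S < aᵢ` or `bₖ < S` vanish. -/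
noncomputable def racahSum (q : ℂ) (K : ℕ) (a₁ a₂ a₃ a₄ b₁ b₂ b₃ : ℤ) : ℂ :=
  ∑ S ∈ Finset.range K, racahTerm q a₁ a₂ a₃ a₄ b₁ b₂ b₃ S

theorem racahTerm_eq_zero (q : ℂ) {a₁ a₂ a₃ a₄ b₁ b₂ b₃ : ℤ} {S : ℕ}
    (h : S < a₁ ∨ S < a₂ ∨ S < a₃ ∨ S < a₄ ∨ b₁ < S ∨ b₂ < S ∨ b₃ < S) :
    racahTerm q a₁ a₂ a₃ a₄ b₁ b₂ b₃ S = 0 := by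
  unfold racahTerm
  rcases h with h | h | h | h | h | h | h
  · rw [qfactInv_of_neg q (n := S - a₁) (by omega)]; ring
  · rw [qfactInv_of_neg q (n := S - a₂) (by omega)]; ring
  · rw [qfactInv_of_neg q (n := S - a₃) (by omega)]; ring
  · rw [qfactInv_of_neg q (n := S - a₄) (by omega)]; ring
  · rw [qfactInv_of_neg q (n := b₁ - S) (by omega)]; ring
  · rw [qfactInv_of_neg q (n := b₂ - S) (by omega)]; ring
  · rw [qfactInv_of_neg q (n := b₃ - S) (by omega)]; ring

theorem continuousAt_racahSum {q₀ : ℂ} (hq : q₀ ≠ 0) {N : ℕ} (hN : qfact q₀ N ≠ 0) (K : ℕ)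
    {a₁ a₂ a₃ a₄ b₁ b₂ b₃ : ℤ} (h₂ : b₁ - a₂ ≤ N) (h₃ : b₁ - a₃ ≤ N) (h₄ : b₁ - a₄ ≤ N)
    (h₅ : b₂ - a₁ ≤ N) (h₆ : b₃ - a₁ ≤ N) :
    ContinuousAt (fun q => racahSum q K a₁ a₂ a₃ a₄ b₁ b₂ b₃) q₀ := by
  refine tendsto_finsetSum _ fun S _ => ?_
  by_cases h : (S < a₁ ∨ S < a₂ ∨ S < a₃ ∨ S < a₄ ∨ b₁ < S ∨ b₂ < S ∨ b₃ < S)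
  · simp only [racahTerm_eq_zero _ h]
    exact tendsto_const_nhds
  · have hc : ∀ n : ℤ, n ≤ N → ContinuousAt (fun q => qfactInv q n) q₀ :=
      fun n hn => continuousAt_qfactInv hq hN hn
    exact ((continuousAt_const.mul (continuousAt_qfact hq _)).mul
      ((((hc _ (by omega)).mul (hc _ (by omega))).mul (hc _ (by omega))).mul
        (hc _ (by omega)))).mul (((hc _ (by omega)).mul (hc _ (by omega))).mul (hc _ (by omega)))

set_option maxHeartbeats 4000000 in
/-- The certificate for the recurrence of `racahSum`, as an identity of Laurent polynomials.  Upper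
case letters stand for powers of `q`, with exponents `aᵢ`, `bₖ`, `j` and, for `X`, the summation
index.  Divided by `q - q⁻¹`, the value `s (q ^ n) = q ^ n - q ^ (-n)` is `[n]`.  The function `y` is
the Laurent polynomial `y₂ x ^ 2 + y₀ + y₋₂ x ^ (-2)` found by Zeilberger's method. -/
theorem laurent_certificate {A₁ A₂ A₃ A₄ B₁ B₂ B₃ J q : ℂ} (h₁ : A₁ ≠ 0) (h₂ : A₂ ≠ 0)
    (h₃ : A₃ ≠ 0) (h₄ : A₄ ≠ 0) (h₅ : B₁ ≠ 0) (h₆ : B₂ ≠ 0) (hq : q ≠ 0)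
    (hB₃ : B₃ = A₁ * A₂ * A₃ * A₄ / (B₁ * B₂)) (hJ : J = B₁ * B₂ / (A₃ * A₄)) {s : ℂ → ℂ}
    (hs : ∀ x, s x = x - x⁻¹) :
    ∃ y : ℂ → ℂ, ∀ X : ℂ, X ≠ 0 →
      (s (J * q ^ 2) * s (A₁ * q) * s (A₂ * q) * s (B₃ / A₁ * q) * s (B₃ / A₂ * q)
          * (s (B₁ / X * q) * s (B₁ / X) * (s (B₂ / X * q) * s (B₂ / X)))
        + s J * s (B₁ / A₃ * q) * s (B₁ / A₄ * q) * s (B₂ / A₃ * q) * s (B₂ / A₄ * q)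
          * (s (X / A₁ * q) * s (X / A₁) * (s (X / A₂ * q) * s (X / A₂)))
        + y (X * q) * (s (X * q ^ 2) * s (B₁ / X * q) * s (B₂ / X * q) * s (B₃ / X))
        + y X * (s (X / A₁ * q) * s (X / A₂ * q) * s (X / A₃) * s (X / A₄))) * (q + q⁻¹)
      = s (J * q) *
        ((s (B₃ / A₂) * s (B₁ / A₃) - s (B₂ / A₄) * s (A₁ * q ^ 2))
            * (s (B₃ / A₁) * s (B₂ / A₃) - s (B₁ / A₄) * s (A₂ * q ^ 2))
          + s J * s (J * q ^ 2) * (s (B₂ / A₂) * s (B₁ / A₁) - s (B₃ / A₄) * s (A₃ * q ^ 2)))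
        * (s (X / A₁ * q) * s (X / A₂ * q) * (s (B₁ / X * q) * s (B₂ / X * q))) := by
  refine ⟨fun x =>
    -(s (J * q ^ 2) * s (A₂ * q) * s (B₃ / A₂ * q) * s (B₁ / A₁ * q) * s (B₂ / A₁ * q))
    + (s (J * q ^ 2) * ((A₁ ^ 2 + A₂ ^ 2) / (J * q ^ 2) - J * B₃ ^ 2 - J / q ^ 4)
        + s J * (J * (A₃ ^ 2 + A₄ ^ 2) - (B₁ ^ 2 + B₂ ^ 2) / (q ^ 2 * J))) / (A₁ * A₂ * B₁ * B₂)
      * (x ^ 2 - A₁ ^ 2)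
    + (s (J * q ^ 2) * ((1 / A₁ ^ 2 + 1 / A₂ ^ 2) * (J * q ^ 2) - 1 / (J * B₃ ^ 2) - q ^ 4 / J)
        + s J * ((1 / A₃ ^ 2 + 1 / A₄ ^ 2) / J - (1 / B₁ ^ 2 + 1 / B₂ ^ 2) * (q ^ 2 * J)))
      * (A₁ * A₂ * B₁ * B₂) * (1 / x ^ 2 - 1 / A₁ ^ 2), fun X hX => ?_⟩
  simp only [hs]
  subst hB₃ hJ
  field_simp
  ring

/-- `[2] λ(a,b,l)` in terms of the half-sum `s = (a + b + l)/2`, with `u = s - a`, `v = s - b`,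
`w = s - l`. -/
noncomputable def lamNum (q : ℂ) (s u v w : ℤ) : ℂ :=
  qint q v * qint q u - qint q w * qint q (s + 2)

/-- The certificate in terms of quantum integers. -/
theorem NotRootOfUnity.exists_certificate {q : ℂ} (h : NotRootOfUnity q)
    {a₁ a₂ a₃ a₄ b₁ b₂ b₃ j : ℤ} (hb : a₁ + a₂ + a₃ + a₄ = b₁ + b₂ + b₃) (hj : j = a₁ + a₂ - b₃) :
    ∃ y : ℤ → ℂ, ∀ S : ℤ,
      qint q 2 *
        (qint q (j + 2) * qint q (a₁ + 1) * qint q (a₂ + 1) * qint q (b₃ - a₁ + 1)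
            * qint q (b₃ - a₂ + 1) *
            (qint q (b₁ + 1 - S) * qint q (b₁ - S) * (qint q (b₂ + 1 - S) * qint q (b₂ - S)))
          + qint q j * qint q (b₁ - a₃ + 1) * qint q (b₁ - a₄ + 1) * qint q (b₂ - a₃ + 1)
            * qint q (b₂ - a₄ + 1) *
            (qint q (S - a₁ + 1) * qint q (S - a₁) * (qint q (S - a₂ + 1) * qint q (S - a₂)))
          + y (S + 1) * (qint q (S + 2) * qint q (b₁ + 1 - S) * qint q (b₂ + 1 - S)
            * qint q (b₃ - S))
          + y S * (qint q (S - a₁ + 1) * qint q (S - a₂ + 1) * qint q (S - a₃) * qint q (S - a₄)))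
      = qint q (j + 1) *
          (lamNum q a₁ (b₁ - a₃) (b₃ - a₂) (b₂ - a₄) * lamNum q a₂ (b₂ - a₃) (b₃ - a₁) (b₁ - a₄)
            + qint q j * qint q (j + 2) * lamNum q a₃ (b₁ - a₁) (b₂ - a₂) (b₃ - a₄)) *
          (qint q (S - a₁ + 1) * qint q (S - a₂ + 1) * (qint q (b₁ + 1 - S)
            * qint q (b₂ + 1 - S))) := by
  have hq := h.1
  set w := q - q⁻¹ with hw
  have hw0 : w ≠ 0 := sub_inv_ne_zero_of_sq_ne_one hq h.sq_ne_one
  obtain ⟨s, hs⟩ : ∃ s : ℂ → ℂ, ∀ x, s x = x - x⁻¹ := ⟨_, fun _ => rfl⟩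
  have hz : ∀ n : ℤ, q ^ n ≠ 0 := fun n => zpow_ne_zero n hq
  have e : ∀ (n : ℤ) (x : ℂ), q ^ n = x → qint q n = s x * w⁻¹ := fun n x hx => by
    rw [h.qint_eq, hx, div_eq_mul_inv, hs]
  have hB3 : q ^ b₃ = q ^ a₁ * q ^ a₂ * q ^ a₃ * q ^ a₄ / (q ^ b₁ * q ^ b₂) := by
    rw [eq_div_iff (mul_ne_zero (hz _) (hz _))]
    simp only [← zpow_add₀ hq]
    congr 1
    omega
  have hJ : q ^ j = q ^ b₁ * q ^ b₂ / (q ^ a₃ * q ^ a₄) := by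
    rw [eq_div_iff (mul_ne_zero (hz _) (hz _))]
    simp only [← zpow_add₀ hq]
    congr 1
    omega
  obtain ⟨Y, hY⟩ := laurent_certificate (hz a₁) (hz a₂) (hz a₃) (hz a₄) (hz b₁) (hz b₂) hq
    hB3 hJ hs
  refine ⟨fun S => Y (q ^ S) * w⁻¹ ^ 5, fun S => ?_⟩
  have key := hY (q ^ S) (hz S)
  have z1 : ∀ n : ℤ, q ^ (n + 1) = q ^ n * q := fun n => zpow_add_one₀ hq n
  have z2 : ∀ n : ℤ, q ^ (n + 2) = q ^ n * q ^ 2 := fun n => by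
    rw [zpow_add₀ hq]
    norm_cast
  have zs : ∀ m n : ℤ, q ^ (m - n) = q ^ m / q ^ n := fun m n => zpow_sub₀ hq m n
  have zc : ∀ m n : ℤ, q ^ (m + 1 - n) = q ^ m / q ^ n * q := fun m n => by
    rw [zs, z1]
    ring
  beta_reduce
  unfold lamNum
  rw [h.qint_two, e (j + 2) _ (z2 _), e (j + 1) _ (z1 _), e j _ rfl, e (a₁ + 1) _ (z1 _),
    e (a₂ + 1) _ (z1 _), e (a₁ + 2) _ (z2 _), e (a₂ + 2) _ (z2 _), e (a₃ + 2) _ (z2 _),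
    e (S + 2) _ (z2 _), e (b₃ - a₁ + 1) (q ^ b₃ / q ^ a₁ * q) (by rw [z1, zs]),
    e (b₃ - a₂ + 1) (q ^ b₃ / q ^ a₂ * q) (by rw [z1, zs]),
    e (b₁ - a₃ + 1) (q ^ b₁ / q ^ a₃ * q) (by rw [z1, zs]),
    e (b₁ - a₄ + 1) (q ^ b₁ / q ^ a₄ * q) (by rw [z1, zs]),
    e (b₂ - a₃ + 1) (q ^ b₂ / q ^ a₃ * q) (by rw [z1, zs]),
    e (b₂ - a₄ + 1) (q ^ b₂ / q ^ a₄ * q) (by rw [z1, zs]),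
    e (S - a₁ + 1) (q ^ S / q ^ a₁ * q) (by rw [z1, zs]),
    e (S - a₂ + 1) (q ^ S / q ^ a₂ * q) (by rw [z1, zs]),
    e (b₁ + 1 - S) _ (zc _ _), e (b₂ + 1 - S) _ (zc _ _), e (b₁ - S) _ (zs _ _),
    e (b₂ - S) _ (zs _ _), e (b₃ - S) _ (zs _ _), e (S - a₁) _ (zs _ _), e (S - a₂) _ (zs _ _),
    e (S - a₃) _ (zs _ _), e (S - a₄) _ (zs _ _), e (b₁ - a₃) _ (zs _ _),
    e (b₃ - a₂) _ (zs _ _), e (b₂ - a₄) _ (zs _ _), e (b₂ - a₃) _ (zs _ _),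
    e (b₃ - a₁) _ (zs _ _), e (b₁ - a₄) _ (zs _ _), e (b₁ - a₁) _ (zs _ _),
    e (b₂ - a₂) _ (zs _ _), e (b₃ - a₄) _ (zs _ _), z1 S]
  linear_combination w⁻¹ ^ 9 * key

/-- The recurrence for `racahSum` away from the roots of unity, by creative telescoping: `G` is the
antidifference supplied by the certificate, and it vanishes at both ends of the range. -/
theorem NotRootOfUnity.racahSum_recurrence {q : ℂ} (h : NotRootOfUnity q) {K : ℕ}
    {a₁ a₂ a₃ a₄ b₁ b₂ b₃ j : ℤ} (hb : a₁ + a₂ + a₃ + a₄ = b₁ + b₂ + b₃) (hj : j = a₁ + a₂ - b₃)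
    (ha : 0 ≤ a₃) (hK : b₃ < K) :
    qint q 2 *
        (qint q (j + 2) * qint q (a₁ + 1) * qint q (a₂ + 1) * qint q (b₃ - a₁ + 1)
            * qint q (b₃ - a₂ + 1) *
            racahSum q K (a₁ - 1) (a₂ - 1) a₃ a₄ (b₁ - 1) (b₂ - 1) b₃
          + qint q j * qint q (b₁ - a₃ + 1) * qint q (b₁ - a₄ + 1) * qint q (b₂ - a₃ + 1)
            * qint q (b₂ - a₄ + 1) *
            racahSum q K (a₁ + 1) (a₂ + 1) a₃ a₄ (b₁ + 1) (b₂ + 1) b₃)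
      = qint q (j + 1) *
          (lamNum q a₁ (b₁ - a₃) (b₃ - a₂) (b₂ - a₄) * lamNum q a₂ (b₂ - a₃) (b₃ - a₁) (b₁ - a₄)
            + qint q j * qint q (j + 2) * lamNum q a₃ (b₁ - a₁) (b₂ - a₂) (b₃ - a₄)) *
          racahSum q K a₁ a₂ a₃ a₄ b₁ b₂ b₃ := by
  obtain ⟨y, hy⟩ := h.exists_certificate hb hj
  -- all summands are multiples of `f`, the summand with the smallest `aᵢ` and the largest `bₖ`
  obtain ⟨f, hf⟩ : ∃ f : ℕ → ℂ, f = racahTerm q (a₁ - 1) (a₂ - 1) a₃ a₄ (b₁ + 1) (b₂ + 1) b₃ :=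
    ⟨_, rfl⟩
  obtain ⟨G, hG⟩ : ∃ G : ℕ → ℂ, G = fun S : ℕ => y S * (qint q (S - a₁ + 1) *
    qint q (S - a₂ + 1) * qint q (S - a₃) * qint q (S - a₄)) * f S := ⟨_, rfl⟩
  have step := h.qfactInv_sub_one
  have fm : ∀ S : ℕ, racahTerm q (a₁ - 1) (a₂ - 1) a₃ a₄ (b₁ - 1) (b₂ - 1) b₃ S =
      qint q (b₁ + 1 - S) * qint q (b₁ - S) * (qint q (b₂ + 1 - S) * qint q (b₂ - S)) * f S := by
    intro S
    have s1 := step (b₁ + 1 - S)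
    have s2 := step (b₁ - S)
    have s3 := step (b₂ + 1 - S)
    have s4 := step (b₂ - S)
    rw [show b₁ + 1 - (S : ℤ) - 1 = b₁ - S by ring] at s1
    rw [show b₂ + 1 - (S : ℤ) - 1 = b₂ - S by ring] at s3
    rw [hf]
    unfold racahTerm
    rw [show b₁ - 1 - (S : ℤ) = b₁ - S - 1 by ring, show b₂ - 1 - (S : ℤ) = b₂ - S - 1 by ring,
      s2, s4, s1, s3]
    ring
  have f0 : ∀ S : ℕ, racahTerm q a₁ a₂ a₃ a₄ b₁ b₂ b₃ S =
      qint q (S - a₁ + 1) * qint q (S - a₂ + 1) * (qint q (b₁ + 1 - S) * qint q (b₂ + 1 - S))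
        * f S := by
    intro S
    have s1 := step (b₁ + 1 - S)
    have s2 := step (S - a₁ + 1)
    have s3 := step (b₂ + 1 - S)
    have s4 := step (S - a₂ + 1)
    rw [show b₁ + 1 - (S : ℤ) - 1 = b₁ - S by ring] at s1
    rw [show b₂ + 1 - (S : ℤ) - 1 = b₂ - S by ring] at s3
    rw [add_sub_cancel_right] at s2 s4
    rw [hf]
    unfold racahTerm
    rw [show (S : ℤ) - (a₁ - 1) = S - a₁ + 1 by ring,
      show (S : ℤ) - (a₂ - 1) = S - a₂ + 1 by ring, s1, s2, s3, s4]
    ring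
  have fp : ∀ S : ℕ, racahTerm q (a₁ + 1) (a₂ + 1) a₃ a₄ (b₁ + 1) (b₂ + 1) b₃ S =
      qint q (S - a₁ + 1) * qint q (S - a₁) * (qint q (S - a₂ + 1) * qint q (S - a₂)) * f S := by
    intro S
    have s1 := step (S - a₁)
    have s2 := step (S - a₁ + 1)
    have s3 := step (S - a₂)
    have s4 := step (S - a₂ + 1)
    rw [add_sub_cancel_right] at s2 s4
    rw [hf]
    unfold racahTerm
    rw [show (S : ℤ) - (a₁ - 1) = S - a₁ + 1 by ring,
      show (S : ℤ) - (a₂ - 1) = S - a₂ + 1 by ring,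
      show (S : ℤ) - (a₁ + 1) = S - a₁ - 1 by ring,
      show (S : ℤ) - (a₂ + 1) = S - a₂ - 1 by ring, s1, s2, s3, s4]
    ring
  have gs : ∀ S : ℕ, G (S + 1) = -(y (S + 1) * (qint q (S + 2) * qint q (b₁ + 1 - S)
      * qint q (b₂ + 1 - S) * qint q (b₃ - S)) * f S) := by
    intro S
    have s1 := step (b₁ + 1 - S)
    have s2 := step (b₂ + 1 - S)
    have s3 := step (b₃ - S)
    have s4 := step (S - a₁ + 1 + 1)
    have s5 := step (S - a₂ + 1 + 1)
    have s6 := step (S - a₃ + 1)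
    have s7 := step (S - a₄ + 1)
    rw [add_sub_cancel_right] at s4 s5 s6 s7
    rw [hG, hf]
    unfold racahTerm
    push_cast
    rw [qfact_succ q (S + 1), pow_succ]
    push_cast
    rw [show (S : ℤ) + 1 - a₁ + 1 = S - a₁ + 1 + 1 by ring,
      show (S : ℤ) + 1 - a₂ + 1 = S - a₂ + 1 + 1 by ring,
      show (S : ℤ) + 1 - a₃ = S - a₃ + 1 by ring,
      show (S : ℤ) + 1 - a₄ = S - a₄ + 1 by ring,
      show (S : ℤ) + 1 - (a₁ - 1) = S - a₁ + 1 + 1 by ring,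
      show (S : ℤ) + 1 - (a₂ - 1) = S - a₂ + 1 + 1 by ring,
      show b₁ + 1 - ((S : ℤ) + 1) = b₁ + 1 - S - 1 by ring,
      show b₂ + 1 - ((S : ℤ) + 1) = b₂ + 1 - S - 1 by ring,
      show b₃ - ((S : ℤ) + 1) = b₃ - S - 1 by ring, s1, s2, s3,
      show (S : ℤ) + 1 + 1 = S + 2 by ring,
      show (S : ℤ) - (a₁ - 1) = S - a₁ + 1 by ring,
      show (S : ℤ) - (a₂ - 1) = S - a₂ + 1 by ring, s4, s5, s6, s7]
    ring
  have g0 : G 0 = 0 := by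
    rcases ha.eq_or_lt with h0 | h0
    · simp [hG, ← h0, qint_zero]
    · rw [hG]
      simp only [hf]
      rw [racahTerm_eq_zero q (by push_cast; omega), mul_zero]
  have gK : G K = 0 := by
    rw [hG]
    simp only [hf]
    rw [racahTerm_eq_zero q (by omega), mul_zero]
  have tel := Finset.sum_range_sub G K
  rw [g0, gK, sub_zero] at tel
  have main : ∀ S : ℕ, qint q 2 *
        (qint q (j + 2) * qint q (a₁ + 1) * qint q (a₂ + 1) * qint q (b₃ - a₁ + 1)
            * qint q (b₃ - a₂ + 1) *
            racahTerm q (a₁ - 1) (a₂ - 1) a₃ a₄ (b₁ - 1) (b₂ - 1) b₃ S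
          + qint q j * qint q (b₁ - a₃ + 1) * qint q (b₁ - a₄ + 1) * qint q (b₂ - a₃ + 1)
            * qint q (b₂ - a₄ + 1) *
            racahTerm q (a₁ + 1) (a₂ + 1) a₃ a₄ (b₁ + 1) (b₂ + 1) b₃ S)
      - qint q (j + 1) *
          (lamNum q a₁ (b₁ - a₃) (b₃ - a₂) (b₂ - a₄) * lamNum q a₂ (b₂ - a₃) (b₃ - a₁) (b₁ - a₄)
            + qint q j * qint q (j + 2) * lamNum q a₃ (b₁ - a₁) (b₂ - a₂) (b₃ - a₄)) *
          racahTerm q a₁ a₂ a₃ a₄ b₁ b₂ b₃ S = qint q 2 * (G (S + 1) - G S) := by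
    intro S
    rw [fm, f0, fp, gs]
    simp only [hG]
    linear_combination f S * hy S
  have tot := Finset.sum_congr (rfl : Finset.range K = Finset.range K) fun S _ => main S
  rw [← Finset.mul_sum, tel, mul_zero, Finset.sum_sub_distrib, ← Finset.mul_sum,
    Finset.sum_add_distrib, ← Finset.mul_sum, ← Finset.mul_sum, ← Finset.mul_sum] at tot
  exact sub_eq_zero.1 tot

theorem continuousAt_lamNum {q₀ : ℂ} (hq : q₀ ≠ 0) (s u v w : ℤ) :
    ContinuousAt (fun q => lamNum q s u v w) q₀ :=
  ((continuousAt_qint hq _).mul (continuousAt_qint hq _)).sub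
    ((continuousAt_qint hq _).mul (continuousAt_qint hq _))

/-- The recurrence for `racahSum`.  At a root of unity it follows by continuity, provided that all
the denominators stay away from zero. -/
theorem racahSum_recurrence {q : ℂ} (hq : q ≠ 0) {N K : ℕ} (hN : qfact q N ≠ 0)
    {a₁ a₂ a₃ a₄ b₁ b₂ b₃ j : ℤ} (hb : a₁ + a₂ + a₃ + a₄ = b₁ + b₂ + b₃) (hj : j = a₁ + a₂ - b₃)
    (ha : 0 ≤ a₃) (hK : b₃ < K) (h₁ : b₁ - a₂ ≤ N) (h₂ : b₂ - a₁ ≤ N) (h₃ : b₁ - a₃ + 1 ≤ N)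
    (h₄ : b₁ - a₄ + 1 ≤ N) (h₅ : b₃ - a₁ + 1 ≤ N) :
    qint q 2 *
        (qint q (j + 2) * qint q (a₁ + 1) * qint q (a₂ + 1) * qint q (b₃ - a₁ + 1)
            * qint q (b₃ - a₂ + 1) *
            racahSum q K (a₁ - 1) (a₂ - 1) a₃ a₄ (b₁ - 1) (b₂ - 1) b₃
          + qint q j * qint q (b₁ - a₃ + 1) * qint q (b₁ - a₄ + 1) * qint q (b₂ - a₃ + 1)
            * qint q (b₂ - a₄ + 1) *
            racahSum q K (a₁ + 1) (a₂ + 1) a₃ a₄ (b₁ + 1) (b₂ + 1) b₃)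
      = qint q (j + 1) *
          (lamNum q a₁ (b₁ - a₃) (b₃ - a₂) (b₂ - a₄) * lamNum q a₂ (b₂ - a₃) (b₃ - a₁) (b₁ - a₄)
            + qint q j * qint q (j + 2) * lamNum q a₃ (b₁ - a₁) (b₂ - a₂) (b₃ - a₄)) *
          racahSum q K a₁ a₂ a₃ a₄ b₁ b₂ b₃ := by
  have c := continuousAt_qint hq
  have cl := continuousAt_lamNum hq
  have um := continuousAt_racahSum hq hN K (a₁ := a₁ - 1) (a₂ := a₂ - 1) (a₃ := a₃) (a₄ := a₄)
    (b₁ := b₁ - 1) (b₂ := b₂ - 1) (b₃ := b₃) (by omega) (by omega) (by omega) (by omega) (by omega)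
  have u0 := continuousAt_racahSum hq hN K (a₁ := a₁) (a₂ := a₂) (a₃ := a₃) (a₄ := a₄)
    (b₁ := b₁) (b₂ := b₂) (b₃ := b₃) (by omega) (by omega) (by omega) (by omega) (by omega)
  have up := continuousAt_racahSum hq hN K (a₁ := a₁ + 1) (a₂ := a₂ + 1) (a₃ := a₃) (a₄ := a₄)
    (b₁ := b₁ + 1) (b₂ := b₂ + 1) (b₃ := b₃) (by omega) (by omega) (by omega) (by omega) (by omega)
  exact eq_of_notRootOfUnity
    ((c _).mul ((((((c _).mul (c _)).mul (c _)).mul (c _)).mul (c _)).mul um |>.add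
      ((((((c _).mul (c _)).mul (c _)).mul (c _)).mul (c _)).mul up)))
    (((c _).mul (((cl _ _ _ _).mul (cl _ _ _ _)).add
      (((c _).mul (c _)).mul (cl _ _ _ _)))).mul u0)
    fun q h => h.racahSum_recurrence hb hj ha hK

/-- The recurrence at the upper end `j = a + d = b + c`, divided by its common factor `[j + 2]`,
which may vanish. -/
theorem racahSum_recurrence_top {q : ℂ} (hq : q ≠ 0) {N K j : ℕ} (hN : qfact q N ≠ 0)
    {a₃ a₄ b₁ b₂ : ℤ} (hb : j + a₃ + a₄ = b₁ + b₂) (ha : 0 ≤ a₃) (hK : j < K) (h₁ : b₁ - j ≤ N)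
    (h₂ : b₂ - j ≤ N) (h₃ : b₁ - a₃ ≤ N) (h₄ : b₁ - a₄ ≤ N) (h₅ : 1 ≤ N) :
    qint q 2 * qint q (j + 1) * racahSum q K (j - 1) (j - 1) a₃ a₄ (b₁ - 1) (b₂ - 1) j
      = (qint q (b₂ - a₄) * qint q (b₁ - a₄) * qint q (j + 2)
          + qint q j * lamNum q a₃ (b₁ - j) (b₂ - j) (j - a₄)) *
          racahSum q K j j a₃ a₄ b₁ b₂ j := by
  have c := continuousAt_qint hq
  have cl := continuousAt_lamNum hq
  have um := continuousAt_racahSum hq hN K (a₁ := j - 1) (a₂ := j - 1) (a₃ := a₃) (a₄ := a₄)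
    (b₁ := b₁ - 1) (b₂ := b₂ - 1) (b₃ := j) (by omega) (by omega) (by omega) (by omega) (by omega)
  have u0 := continuousAt_racahSum hq hN K (a₁ := j) (a₂ := j) (a₃ := a₃) (a₄ := a₄)
    (b₁ := b₁) (b₂ := b₂) (b₃ := j) (by omega) (by omega) (by omega) (by omega) (by omega)
  refine eq_of_notRootOfUnity (((c _).mul (c _)).mul um)
    (((((c _).mul (c _)).mul (c _)).add ((c _).mul (cl _ _ _ _))).mul u0) fun q h => ?_
  simp only [Pi.mul_apply, Pi.add_apply]
  have key := h.racahSum_recurrence (K := K) (a₁ := j) (a₂ := j) (a₃ := a₃) (a₄ := a₄) (b₁ := b₁)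
    (b₂ := b₂) (b₃ := j) (j := j) (by omega) (by omega) ha (by omega)
  have hU : racahSum q K (j + 1) (j + 1) a₃ a₄ (b₁ + 1) (b₂ + 1) j = 0 :=
    Finset.sum_eq_zero fun S _ => racahTerm_eq_zero q (by omega)
  have n1 : qint q (j + 1) ≠ 0 := by exact_mod_cast h.qint_ne_zero (Nat.succ_pos j)
  have n2 : qint q (j + 2) ≠ 0 := by exact_mod_cast h.qint_ne_zero (Nat.succ_pos (j + 1))
  rw [hU, sub_self, zero_add, qint_one h.1] at key
  unfold lamNum at key ⊢
  rw [qint_zero] at key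
  apply mul_left_cancel₀ (mul_ne_zero n1 n2)
  linear_combination key

/-! ### Evaluation of the networks through half-sums -/

theorem Admissible.swap {q : ℂ} {a b c : ℕ} (h : Admissible q a b c) : Admissible q b a c := by
  obtain ⟨⟨h1, h2, h3⟩, h4, h5⟩ := h
  rw [Nat.even_iff] at h4
  exact ⟨⟨by omega, by omega, by omega⟩, Nat.even_iff.2 (by omega), fun r hr hp => by
    have := h5 r hr hp
    omega⟩

theorem Admissible.rotate {q : ℂ} {a b c : ℕ} (h : Admissible q a b c) : Admissible q b c a := by
  obtain ⟨⟨h1, h2, h3⟩, h4, h5⟩ := h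
  rw [Nat.even_iff] at h4
  exact ⟨⟨by omega, by omega, by omega⟩, Nat.even_iff.2 (by omega), fun r hr hp => by
    have := h5 r hr hp
    omega⟩

theorem admissible_swap {q : ℂ} {a b c : ℕ} : Admissible q a b c ↔ Admissible q b a c :=
  ⟨Admissible.swap, Admissible.swap⟩

theorem Admissible.qfact_ne_zero {q : ℂ} (hq : q ≠ 0) {a b c s : ℕ} (h : Admissible q a b c)
    (hs : 2 * s = a + b + c) : qfact q (s + 1) ≠ 0 := by
  have := ((admissible_iff hq).1 h).2.2.2.2
  rwa [← hs, Nat.mul_div_cancel_left _ two_pos] at this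

theorem admissible_of_half_sum {q : ℂ} (hq : q ≠ 0) {a b c s : ℕ} (hs : 2 * s = a + b + c)
    (ha : a ≤ s) (hb : b ≤ s) (hc : c ≤ s) (h : qfact q (s + 1) ≠ 0) : Admissible q a b c := by
  rw [admissible_iff hq, ← hs, Nat.mul_div_cancel_left _ two_pos]
  exact ⟨by omega, by omega, by omega, by omega, h⟩

theorem theta_eq_zero {q : ℂ} {a b c : ℕ} (h : ¬Admissible q a b c) : theta q a b c = 0 :=
  if_neg h

theorem theta_eq {q : ℂ} {a b c s : ℕ} (h : Admissible q a b c) (hs : 2 * s = a + b + c) :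
    theta q a b c = (-1) ^ s * qfact q (s + 1) * qfact q (s - a) * qfact q (s - b)
      * qfact q (s - c) / (qfact q a * qfact q b * qfact q c) := by
  rw [theta, if_pos h]
  simp only [← hs, Nat.mul_div_cancel_left _ two_pos]

theorem Admissible.exists_half_sum {q : ℂ} {a b c : ℕ} (h : Admissible q a b c) :
    ∃ s, 2 * s = a + b + c ∧ a ≤ s ∧ b ≤ s ∧ c ≤ s := by
  obtain ⟨⟨h1, h2, h3⟩, h4, -⟩ := h
  rw [Nat.even_iff] at h4
  exact ⟨(a + b + c) / 2, by omega, by omega, by omega, by omega⟩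

theorem theta_ne_zero {q : ℂ} (hq : q ≠ 0) {a b c : ℕ} (h : Admissible q a b c) :
    theta q a b c ≠ 0 := by
  obtain ⟨s, hs, h1, h2, h3⟩ := h.exists_half_sum
  have hf := h.qfact_ne_zero hq hs
  have f : ∀ n ≤ s + 1, qfact q n ≠ 0 := fun n hn => qfact_ne_zero_of_le hf hn
  rw [theta_eq h hs]
  simp [f (s + 1) le_rfl, f (s - a) (by omega), f (s - b) (by omega), f (s - c) (by omega),
    f a (by omega), f b (by omega), f c (by omega)]

theorem theta_swap (q : ℂ) (a b c : ℕ) : theta q a b c = theta q b a c := by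
  by_cases h : Admissible q a b c
  · obtain ⟨s, hs, -⟩ := h.exists_half_sum
    rw [theta_eq h hs, theta_eq h.swap (by omega : 2 * s = b + a + c)]
    ring
  · rw [theta_eq_zero h, theta_eq_zero fun h' => h h'.swap]

theorem theta_rotate (q : ℂ) (a b c : ℕ) : theta q a b c = theta q b c a := by
  by_cases h : Admissible q a b c
  · obtain ⟨s, hs, -⟩ := h.exists_half_sum
    rw [theta_eq h hs, theta_eq h.rotate (by omega : 2 * s = b + c + a)]
    ring
  · rw [theta_eq_zero h, theta_eq_zero fun h' => h h'.rotate.rotate]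

theorem bubble_ne_zero_of_admissible {q : ℂ} (hq : q ≠ 0) {a b c : ℕ} (h : Admissible q a b c) :
    bubble q c ≠ 0 := by
  obtain ⟨s, hs, -, -, h3⟩ := h.exists_half_sum
  exact bubble_ne_zero hq (qfact_ne_zero_of_le (h.qfact_ne_zero hq hs) (by omega))

theorem tet_eq_zero {q : ℂ} {a b c d j l : ℕ} (h : ¬(Admissible q a b l ∧ Admissible q c d l ∧
    Admissible q a d j ∧ Admissible q c b j)) : tet q a b c d j l = 0 :=
  if_neg h

theorem tet_eq {q : ℂ} {a b c d j l : ℕ} (h₁ : Admissible q a b l) (h₂ : Admissible q c d l)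
    (h₃ : Admissible q a d j) (h₄ : Admissible q c b j) {a₁ a₂ a₃ a₄ b₁ b₂ b₃ K : ℕ}
    (ha₁ : 2 * a₁ = a + d + j) (ha₂ : 2 * a₂ = b + c + j) (ha₃ : 2 * a₃ = a + b + l)
    (ha₄ : 2 * a₄ = c + d + l) (hb₁ : 2 * b₁ = b + d + j + l) (hb₂ : 2 * b₂ = a + c + j + l)
    (hb₃ : 2 * b₃ = a + b + c + d) (hK : b₃ < K) :
    tet q a b c d j l =
      (qfact q (b₁ - a₁) * qfact q (b₂ - a₁) * qfact q (b₃ - a₁) *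
          (qfact q (b₁ - a₂) * qfact q (b₂ - a₂) * qfact q (b₃ - a₂)) *
          (qfact q (b₁ - a₃) * qfact q (b₂ - a₃) * qfact q (b₃ - a₃)) *
          (qfact q (b₁ - a₄) * qfact q (b₂ - a₄) * qfact q (b₃ - a₄))) /
        (qfact q a * qfact q b * qfact q c * qfact q d * qfact q j * qfact q l) *
      racahSum q K a₁ a₂ a₃ a₄ b₁ b₂ b₃ := by
  have hv : vtx a b c d j l = ![a₁, a₂, a₃, a₄] := by
    simp only [vtx, ← ha₁, ← ha₂, ← ha₃, ← ha₄, Nat.mul_div_cancel_left _ two_pos]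
  have hk : quad a b c d j l = ![b₁, b₂, b₃] := by
    simp only [quad, ← hb₁, ← hb₂, ← hb₃, Nat.mul_div_cancel_left _ two_pos]
  rw [tet, if_pos ⟨h₁, h₂, h₃, h₄⟩, hv, hk]
  congr 1
  · simp [Fin.prod_univ_four, Fin.prod_univ_three]
  · have hmem : ∀ S, S ∈ Finset.Icc (Finset.univ.sup' Finset.univ_nonempty ![a₁, a₂, a₃, a₄])
        (Finset.univ.inf' Finset.univ_nonempty ![b₁, b₂, b₃]) ↔
        (a₁ ≤ S ∧ a₂ ≤ S ∧ a₃ ≤ S ∧ a₄ ≤ S) ∧ S ≤ b₁ ∧ S ≤ b₂ ∧ S ≤ b₃ := by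
      intro S
      simp [Finset.mem_Icc, Finset.sup'_le_iff, Finset.le_inf'_iff, Fin.forall_fin_succ]
    have hsub : Finset.Icc (Finset.univ.sup' Finset.univ_nonempty ![a₁, a₂, a₃, a₄])
        (Finset.univ.inf' Finset.univ_nonempty ![b₁, b₂, b₃]) ⊆ Finset.range K := by
      intro S hS
      rw [hmem] at hS
      rw [Finset.mem_range]
      omega
    rw [racahSum, ← Finset.sum_subset hsub fun S _ hS => racahTerm_eq_zero q (by
      rw [hmem] at hS
      omega)]
    refine Finset.sum_congr rfl fun S hS => ?_
    rw [hmem] at hS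
    obtain ⟨⟨g1, g2, g3, g4⟩, g5, g6, g7⟩ := hS
    unfold racahTerm
    rw [← Nat.cast_sub g1, ← Nat.cast_sub g2, ← Nat.cast_sub g3, ← Nat.cast_sub g4,
      ← Nat.cast_sub g5, ← Nat.cast_sub g6, ← Nat.cast_sub g7]
    simp only [qfactInv_natCast]
    simp [Fin.prod_univ_four, Fin.prod_univ_three, div_eq_mul_inv]
    ring

/-- Half-sums for the four vertices and the three quadrilaterals of a tetrahedron. -/
theorem exists_half_sums {q : ℂ} {a b c d j l : ℕ} (h₁ : Admissible q a b l)
    (h₂ : Admissible q c d l) (h₃ : Admissible q a d j) (h₄ : Admissible q c b j) :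
    ∃ a₁ a₂ a₃ a₄ b₁ b₂ b₃ : ℕ, 2 * a₁ = a + d + j ∧ 2 * a₂ = b + c + j ∧ 2 * a₃ = a + b + l ∧
      2 * a₄ = c + d + l ∧ 2 * b₁ = b + d + j + l ∧ 2 * b₂ = a + c + j + l ∧
      2 * b₃ = a + b + c + d := by
  obtain ⟨s₁, e₁, -⟩ := h₁.exists_half_sum
  obtain ⟨s₂, e₂, -⟩ := h₂.exists_half_sum
  obtain ⟨s₃, e₃, -⟩ := h₃.exists_half_sum
  obtain ⟨s₄, e₄, -⟩ := h₄.exists_half_sum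
  exact ⟨s₃, s₄, s₁, s₂, (b + d + j + l) / 2, (a + c + j + l) / 2, (a + b + c + d) / 2, by omega,
    by omega, by omega, by omega, by omega, by omega, by omega⟩

/-- The symmetry exchanging the two pairings of the free edges. -/
theorem tet_dual (q : ℂ) (a b c d j l : ℕ) : tet q a b c d j l = tet q a d c b l j := by
  by_cases h : Admissible q a b l ∧ Admissible q c d l ∧ Admissible q a d j ∧ Admissible q c b j
  · obtain ⟨h₁, h₂, h₃, h₄⟩ := h
    obtain ⟨a₁, a₂, a₃, a₄, b₁, b₂, b₃, e₁, e₂, e₃, e₄, e₅, e₆, e₇⟩ := exists_half_sums h₁ h₂ h₃ h₄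
    rw [tet_eq h₁ h₂ h₃ h₄ e₁ e₂ e₃ e₄ e₅ e₆ e₇ (Nat.lt_succ_self b₃),
      tet_eq h₃ h₄ h₁ h₂ (a₁ := a₃) (a₂ := a₄) (a₃ := a₁) (a₄ := a₂) (b₁ := b₁) (b₂ := b₂)
        (b₃ := b₃) (by omega) (by omega) (by omega) (by omega) (by omega) (by omega) (by omega)
        (Nat.lt_succ_self b₃)]
    have : racahSum q (b₃ + 1) a₁ a₂ a₃ a₄ b₁ b₂ b₃ = racahSum q (b₃ + 1) a₃ a₄ a₁ a₂ b₁ b₂ b₃ :=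
      Finset.sum_congr rfl fun S _ => by unfold racahTerm; ring
    rw [this]
    ring
  · rw [tet_eq_zero h, tet_eq_zero (by tauto)]

/-- The reflection exchanging `a` with `b` and `c` with `d`. -/
theorem tet_symm₁ (q : ℂ) (a b c d j l : ℕ) : tet q a b c d j l = tet q b a d c j l := by
  by_cases h : Admissible q a b l ∧ Admissible q c d l ∧ Admissible q a d j ∧ Admissible q c b j
  · obtain ⟨h₁, h₂, h₃, h₄⟩ := h
    obtain ⟨a₁, a₂, a₃, a₄, b₁, b₂, b₃, e₁, e₂, e₃, e₄, e₅, e₆, e₇⟩ := exists_half_sums h₁ h₂ h₃ h₄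
    rw [tet_eq h₁ h₂ h₃ h₄ e₁ e₂ e₃ e₄ e₅ e₆ e₇ (Nat.lt_succ_self b₃),
      tet_eq h₁.swap h₂.swap h₄.swap h₃.swap (a₁ := a₂) (a₂ := a₁) (a₃ := a₃) (a₄ := a₄)
        (b₁ := b₂) (b₂ := b₁) (b₃ := b₃) (by omega) (by omega) (by omega) (by omega) (by omega)
        (by omega) (by omega) (Nat.lt_succ_self b₃)]
    have : racahSum q (b₃ + 1) a₁ a₂ a₃ a₄ b₁ b₂ b₃ = racahSum q (b₃ + 1) a₂ a₁ a₃ a₄ b₂ b₁ b₃ :=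
      Finset.sum_congr rfl fun S _ => by unfold racahTerm; ring
    rw [this]
    ring
  · rw [tet_eq_zero h, tet_eq_zero fun h' =>
      h ⟨h'.1.swap, h'.2.1.swap, h'.2.2.2.swap, h'.2.2.1.swap⟩]

/-- The reflection exchanging `a` with `d` and `b` with `c`. -/
theorem tet_symm₂ (q : ℂ) (a b c d j l : ℕ) : tet q a b c d j l = tet q d c b a j l := by
  rw [tet_dual, tet_symm₁, ← tet_dual]

/-! ### The evaluations with an edge of twice-spin two -/

theorem qfact_two {q : ℂ} (hq : q ≠ 0) : qfact q 2 = qint q 2 := by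
  rw [qfact_succ, qfact_succ, qfact_zero]
  norm_num [qint_one hq]

theorem qfact_one {q : ℂ} (hq : q ≠ 0) : qfact q 1 = 1 := by
  rw [qfact_succ, qfact_zero]
  norm_num [qint_one hq]

theorem qfactInv_one {q : ℂ} (hq : q ≠ 0) : qfactInv q 1 = 1 := by
  simpa [qfact_one hq] using qfactInv_natCast q 1

theorem lam_eq (q : ℂ) {a b l s : ℕ} (hs : 2 * s = a + b + l) :
    lam q a b l = lamNum q s (s - a) (s - b) (s - l) / qint q 2 := by
  rw [lam, lamNum, show ((a : ℤ) - b + l) / 2 = s - b by omega,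
    show (-(a : ℤ) + b + l) / 2 = s - a by omega, show ((a : ℤ) + b - l) / 2 = s - l by omega,
    show ((a : ℤ) + b + l) / 2 = s by omega]

/-- Only `S = s` and `S = s + 1` contribute to the alternating sum, where `s` is the half-sum of
`(x, y, l)`.  If `(x, x, 2)` or `(y, y, 2)` is not admissible, then `λ(x,y,l)` vanishes too. -/
theorem tet_vertical_two {q : ℂ} (hq : q ≠ 0) {x y l : ℕ} (hx : 0 < x) (hy : 0 < y)
    (h : Admissible q x y l) :
    tet q x x y y l 2 = theta q x y l / (qint q x * qint q y) * lam q x y l := by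
  obtain ⟨s, hs, h1, h2, h3⟩ := h.exists_half_sum
  have hf := h.qfact_ne_zero hq hs
  have f : ∀ n ≤ s + 1, qfact q n ≠ 0 := fun n hn => qfact_ne_zero_of_le hf hn
  rw [lam_eq q hs]
  -- at level `r` the edge `(x, x, 2)` is forbidden for `x = r - 2`; then `s = x` and `[s + 2] = 0`
  have hedge : ∀ z : ℕ, 0 < z → z ≤ s → ¬Admissible q z z 2 →
      s = z ∧ qint q (s + 2) = 0 := by
    intro z hz hzs hna
    by_contra hcon
    apply hna
    refine admissible_of_half_sum hq (s := z + 1) (by omega) (by omega) (by omega) (by omega) ?_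
    rcases hzs.eq_or_lt with rfl | hlt
    · rw [qfact_succ]
      refine mul_ne_zero hf fun h0 => hcon ⟨rfl, ?_⟩
      rw [← h0]
      congr 1
    · exact f _ (by omega)
  by_cases hx2 : Admissible q x x 2
  swap
  · obtain ⟨e, h0⟩ := hedge x hx h1 hx2
    rw [tet_eq_zero fun h' => hx2 h'.1, lamNum, h0, show (s : ℤ) - x = 0 by omega, qint_zero]
    ring
  by_cases hy2 : Admissible q y y 2
  swap
  · obtain ⟨e, h0⟩ := hedge y hy h2 hy2
    rw [tet_eq_zero fun h' => hy2 h'.2.1, lamNum, h0, show (s : ℤ) - y = 0 by omega, qint_zero]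
    ring
  obtain ⟨p, hp⟩ : ∃ p, s = x + p := ⟨s - x, by omega⟩
  obtain ⟨r, hr⟩ : ∃ r, s = y + r := ⟨s - y, by omega⟩
  obtain ⟨t, ht⟩ : ∃ t, s = l + t := ⟨s - l, by omega⟩
  obtain ⟨x', rfl⟩ : ∃ x', x = x' + 1 := ⟨x - 1, by omega⟩
  obtain ⟨y', rfl⟩ : ∃ y', y = y' + 1 := ⟨y - 1, by omega⟩
  rw [tet_eq hx2 hy2 h h.swap (a₁ := s) (a₂ := s) (a₃ := x' + 2) (a₄ := y' + 2) (b₁ := s + 1)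
    (b₂ := s + 1) (b₃ := x' + y' + 2) (K := x' + y' + 4) (by omega) (by omega) (by omega)
    (by omega) (by omega) (by omega) (by omega) (by omega), theta_eq h hs]
  have hU : racahSum q (x' + y' + 4) s s (x' + 2 : ℕ) (y' + 2 : ℕ) (s + 1 : ℕ) (s + 1 : ℕ)
      (x' + y' + 2 : ℕ) = (-1) ^ s * qfact q (s + 1) * (qfact q p)⁻¹ * (qfact q r)⁻¹
        * (qfact q t)⁻¹ * (qint q p * qint q r - qint q t * qint q (s + 2)) := by
    have hsub : ({s, s + 1} : Finset ℕ) ⊆ Finset.range (x' + y' + 4) := by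
      intro S
      simp only [Finset.mem_insert, Finset.mem_singleton, Finset.mem_range]
      omega
    rw [racahSum, ← Finset.sum_subset hsub fun S _ hS => racahTerm_eq_zero q (by
      simp only [Finset.mem_insert, Finset.mem_singleton] at hS
      omega), Finset.sum_pair (by omega)]
    unfold racahTerm
    rw [show (s : ℤ) - s = 0 by ring, show (s : ℤ) - (x' + 2 : ℕ) = p - 1 by omega,
      show (s : ℤ) - (y' + 2 : ℕ) = r - 1 by omega, show ((s + 1 : ℕ) : ℤ) - s = 1 by omega,
      show ((x' + y' + 2 : ℕ) : ℤ) - s = t by omega,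
      show ((s + 1 : ℕ) : ℤ) - (x' + 2 : ℕ) = p by omega,
      show ((s + 1 : ℕ) : ℤ) - (y' + 2 : ℕ) = r by omega,
      show ((s + 1 : ℕ) : ℤ) - (s + 1 : ℕ) = 0 by omega,
      show ((x' + y' + 2 : ℕ) : ℤ) - (s + 1 : ℕ) = t - 1 by omega,
      qfactInv_sub_one hf (n := p) (by omega), qfactInv_sub_one hf (n := r) (by omega),
      qfactInv_sub_one hf (n := t) (by omega), qfactInv_zero, qfactInv_one hq, qfactInv_natCast,
      qfactInv_natCast, qfactInv_natCast, qfact_succ q (s + 1), pow_succ,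
      show ((s + 1 : ℕ) : ℤ) + 1 = s + 2 by omega]
    ring
  rw [hU, show s + 1 - s = 1 by omega, show s + 1 - (x' + 2) = p by omega,
    show s + 1 - (y' + 2) = r by omega, show x' + y' + 2 - s = t by omega,
    show x' + y' + 2 - (x' + 2) = y' by omega, show x' + y' + 2 - (y' + 2) = x' by omega,
    show s - (x' + 1) = p by omega, show s - (y' + 1) = r by omega, show s - l = t by omega,
    lamNum, show (s : ℤ) - (x' + 1 : ℕ) = p by omega, show (s : ℤ) - (y' + 1 : ℕ) = r by omega,
    show (s : ℤ) - l = t by omega, qfact_one hq, qfact_two hq, qfact_succ q x',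
    qfact_succ q y']
  have n1 := f p (by omega)
  have n2 := f r (by omega)
  have n3 := f t (by omega)
  have n4 := f x' (by omega)
  have n5 := f y' (by omega)
  have n6 := f l (by omega)
  have n7 := qint_ne_zero_of_qfact hf (k := (x' : ℤ) + 1) (by omega) (by omega)
  have n8 := qint_ne_zero_of_qfact hf (k := (y' : ℤ) + 1) (by omega) (by omega)
  push_cast
  field_simp

/-- Only one term contributes to the alternating sum. -/
theorem tet_horizontal_two {q : ℂ} (hq : q ≠ 0) {x y j : ℕ} (hx : 0 < x)
    (h : Admissible q x y j) :
    tet q x x j (j + 2) y 2 =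
      1 / qint q x * qint q (((x : ℤ) + y - j) / 2) * theta q x y (j + 2) := by
  obtain ⟨s, hs, h1, h2, h3⟩ := h.exists_half_sum
  by_cases h' : Admissible q x y (j + 2)
  swap
  · rw [theta_eq_zero h', tet_eq_zero fun h'' => h' h''.2.2.1.rotate.rotate.swap]
    ring
  have hj : j + 2 ≤ x + y := h'.1.2.2
  have hf := h'.qfact_ne_zero hq (s := s + 1) (by omega)
  have f : ∀ n ≤ s + 2, qfact q n ≠ 0 := fun n hn => qfact_ne_zero_of_le hf hn
  have hxx : Admissible q x x 2 := admissible_of_half_sum hq (s := x + 1) (by omega) (by omega)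
    (by omega) (by omega) (f _ (by omega))
  have hjj : Admissible q j (j + 2) 2 := admissible_of_half_sum hq (s := j + 2) (by omega)
    (by omega) (by omega) (by omega) (f _ (by omega))
  obtain ⟨p, hp⟩ : ∃ p, s = x + p := ⟨s - x, by omega⟩
  obtain ⟨r, hr⟩ : ∃ r, s = y + r := ⟨s - y, by omega⟩
  obtain ⟨t, ht⟩ : ∃ t, s = j + (t + 1) := ⟨s - j - 1, by omega⟩
  obtain ⟨x', rfl⟩ : ∃ x', x = x' + 1 := ⟨x - 1, by omega⟩
  rw [tet_eq hxx hjj h'.rotate.rotate.swap h.rotate.rotate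
    (a₁ := s + 1) (a₂ := s) (a₃ := x' + 2)
    (a₄ := j + 2) (b₁ := s + 2) (b₂ := s + 1) (b₃ := x' + j + 2) (K := x' + j + 3) (by omega)
    (by omega) (by omega) (by omega) (by omega) (by omega) (by omega) (by omega),
    theta_eq h' (s := s + 1) (by omega)]
  have hU : racahSum q (x' + j + 3) (s + 1 : ℕ) s (x' + 2 : ℕ) (j + 2 : ℕ) (s + 2 : ℕ)
      (s + 1 : ℕ) (x' + j + 2 : ℕ) = (-1) ^ (s + 1) * qfact q (s + 1 + 1) * (qfact q p)⁻¹
        * (qfact q r)⁻¹ * (qfact q t)⁻¹ := by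
    rw [racahSum, Finset.sum_eq_single (s + 1) (fun S _ hS => racahTerm_eq_zero q (by omega))
      (fun hS => absurd (Finset.mem_range.2 (by omega)) hS)]
    unfold racahTerm
    rw [show ((s + 1 : ℕ) : ℤ) - (s + 1 : ℕ) = 0 by ring,
      show ((s + 1 : ℕ) : ℤ) - s = 1 by omega,
      show ((s + 1 : ℕ) : ℤ) - (x' + 2 : ℕ) = p by omega,
      show ((s + 1 : ℕ) : ℤ) - (j + 2 : ℕ) = t by omega,
      show ((s + 2 : ℕ) : ℤ) - (s + 1 : ℕ) = 1 by omega,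
      show ((x' + j + 2 : ℕ) : ℤ) - (s + 1 : ℕ) = r by omega, qfactInv_zero, qfactInv_one hq,
      qfactInv_natCast, qfactInv_natCast, qfactInv_natCast]
    ring
  rw [hU, show s + 2 - (s + 1) = 1 by omega, show s + 1 - (s + 1) = 0 by omega,
    show x' + j + 2 - (s + 1) = r by omega, show s + 2 - s = 2 by omega,
    show s + 1 - s = 1 by omega, show x' + j + 2 - s = r + 1 by omega,
    show s + 2 - (x' + 2) = p + 1 by omega, show s + 1 - (x' + 2) = p by omega,
    show x' + j + 2 - (x' + 2) = j by omega, show s + 2 - (j + 2) = t + 1 by omega,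
    show s + 1 - (j + 2) = t by omega, show x' + j + 2 - (j + 2) = x' by omega,
    show s + 1 - (x' + 1) = p + 1 by omega, show s + 1 - y = r + 1 by omega,
    show (((x' + 1 : ℕ) : ℤ) + y - j) / 2 = t + 1 by omega, qfact_one hq, qfact_zero,
    qfact_two hq, qfact_succ q t, qfact_succ q x']
  have n1 := f p (by omega)
  have n2 := f r (by omega)
  have n3 := f t (by omega)
  have n4 := f x' (by omega)
  have n5 := f y (by omega)
  have n6 := f j (by omega)
  have n7 := qint_ne_zero_of_qfact hf (k := (x' : ℤ) + 1) (by omega) (by omega)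
  have n8 := qint_ne_zero_of_qfact hf (k := 2) (by omega) (by omega)
  have n9 := f (j + 2) (by omega)
  push_cast
  field_simp

theorem theta_self_two {q : ℂ} (hq : q ≠ 0) {j : ℕ} (hj : 0 < j)
    (h : qint q 2 * qint q j ≠ 0) :
    theta q j j 2 = -(qint q ((j : ℤ) + 2) / (qint q 2 * qint q j)) * bubble q j := by
  by_cases h2 : qfact q (j + 2) = 0
  · rw [theta_eq_zero fun h' => h'.qfact_ne_zero hq (s := j + 1) (by omega) h2]
    rw [qfact_succ] at h2
    rcases mul_eq_zero.1 h2 with h3 | h3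
    · rw [bubble_of_eq hq h3, mul_zero]
    · rw [show (j : ℤ) + 2 = (j + 1 : ℕ) + 1 by push_cast; ring, h3]
      ring
  · have hadm : Admissible q j j 2 := admissible_of_half_sum hq (s := j + 1) (by omega) (by omega)
      (by omega) (by omega) h2
    rw [theta_eq hadm (s := j + 1) (by omega),
      bubble_of_ne hq (qfact_ne_zero_of_le h2 (by omega))]
    obtain ⟨i, rfl⟩ : ∃ i, j = i + 1 := ⟨j - 1, by omega⟩
    have n1 := qfact_ne_zero_of_le h2 (m := i) (by omega)
    have n2 := left_ne_zero_of_mul h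
    have n3 := right_ne_zero_of_mul h
    rw [show i + 1 + 1 - (i + 1) = 1 by omega, show i + 1 + 1 - 2 = i by omega, qfact_one hq,
      qfact_two hq, qfact_succ q (i + 1 + 1), qfact_succ q (i + 1), qfact_succ q i]
    push_cast at n3 ⊢
    rw [show (i : ℤ) + 1 + 2 = i + 1 + 1 + 1 by ring]
    field_simp
    ring

theorem theta_add_two_two {q : ℂ} (hq : q ≠ 0) (j : ℕ) :
    theta q j (j + 2) 2 = bubble q (j + 2) := by
  by_cases h2 : qfact q (j + 3) = 0
  · rw [theta_eq_zero fun h' => h'.qfact_ne_zero hq (s := j + 2) (by omega) h2,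
      bubble_of_eq hq h2]
  · have hadm : Admissible q j (j + 2) 2 := admissible_of_half_sum hq (s := j + 2) (by omega)
      (by omega) (by omega) (by omega) h2
    rw [theta_eq hadm (s := j + 2) (by omega), bubble_of_ne hq h2]
    have n1 := qfact_ne_zero_of_le h2 (m := j) (by omega)
    have n2 := qfact_ne_zero_of_le h2 (m := j + 2) (by omega)
    have n3 := qfact_ne_zero_of_le h2 (m := 2) (by omega)
    rw [show j + 2 - j = 2 by omega, show j + 2 - (j + 2) = 0 by omega,
      show j + 2 - 2 = j by omega, qfact_zero, qfact_succ q (j + 2)]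
    field_simp

/-! ### The matrix elements of `L` -/

theorem normH_ne_zero {q : ℂ} (hq : q ≠ 0) {a b c d j : ℕ} (hj : j ∈ jSet q a b c d) :
    normH q a b c d j ≠ 0 := by
  rw [mem_jSet] at hj
  exact div_ne_zero (mul_ne_zero (theta_ne_zero hq hj.2.swap) (theta_ne_zero hq hj.1))
    (bubble_ne_zero_of_admissible hq hj.1)

theorem mem_lSet_iff_mem_jSet {q : ℂ} {a b c d l : ℕ} :
    l ∈ lSet q a b c d ↔ l ∈ jSet q a d c b := by
  rw [mem_lSet, mem_jSet]

theorem lSet_eq_jSet (q : ℂ) (a b c d : ℕ) : lSet q a b c d = jSet q a d c b :=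
  Finset.ext fun _ => mem_lSet_iff_mem_jSet

theorem normV_eq_normH (q : ℂ) (a b c d l : ℕ) : normV q a b c d l = normH q a d c b l := by
  rw [normV, normH, theta_swap q c d, mul_comm]

theorem normV_ne_zero {q : ℂ} (hq : q ≠ 0) {a b c d l : ℕ} (hl : l ∈ lSet q a b c d) :
    normV q a b c d l ≠ 0 := by
  rw [normV_eq_normH]
  exact normH_ne_zero hq (mem_lSet_iff_mem_jSet.1 hl)

theorem tet_horizontal_two' {q : ℂ} (hq : q ≠ 0) {x y j : ℕ} (hx : 0 < x)
    (h : Admissible q x y j) :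
    tet q x x (j + 2) j y 2 =
      1 / qint q x * qint q (((x : ℤ) + y - j) / 2) * theta q x y (j + 2) := by
  rw [tet_symm₁, tet_horizontal_two hq hx h]

theorem Lbar_eq_zero {q : ℂ} {a b c d j j' : ℕ} (h : ¬(j ∈ jSet q a b c d ∧
    j' ∈ jSet q a b c d ∧ Admissible q j j' 2)) : Lbar q a b c d j j' = 0 :=
  if_neg h

theorem Lbar_tridiagonal {q : ℂ} {a b c d j j' : ℕ} (h : Lbar q a b c d j j' ≠ 0) :
    j' = j ∨ j' = j + 2 ∨ j = j' + 2 := by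
  by_contra hcon
  refine h (Lbar_eq_zero fun hn => hcon ?_)
  obtain ⟨⟨h1, h2, h3⟩, h4, -⟩ := hn.2.2
  rw [Nat.even_iff] at h4
  omega

theorem Lbar_comm (q : ℂ) (a b c d j j' : ℕ) : Lbar q a b c d j j' = Lbar q a b c d j' j := by
  by_cases h : j ∈ jSet q a b c d ∧ j' ∈ jSet q a b c d ∧ Admissible q j j' 2
  · rw [Lbar, Lbar, if_pos h, if_pos ⟨h.2.1, h.1, h.2.2.swap⟩, theta_swap, tet_symm₁ q a,
      tet_symm₁ q b]
  · rw [Lbar_eq_zero h, Lbar_eq_zero fun h' => h ⟨h'.2.1, h'.1, h'.2.2.swap⟩]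

theorem Lbar_add_two {q : ℂ} (hq : q ≠ 0) {a b c d j : ℕ} (hj : j ∈ jSet q a b c d)
    (hj2 : j + 2 ∈ jSet q a b c d) :
    Lbar q a b c d j (j + 2) = normH q a b c d (j + 2) * qint q (((a : ℤ) + d - j) / 2)
      * qint q (((b : ℤ) + c - j) / 2) := by
  have hj' := mem_jSet.1 hj
  have hj2' := mem_jSet.1 hj2
  obtain ⟨s, hs, h1, h2, h3⟩ := hj2'.1.exists_half_sum
  obtain ⟨t, ht, k1, k2, k3⟩ := hj2'.2.exists_half_sum
  have e1 := hj'.1.1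
  have e2 := hj'.2.1
  have hf := hj2'.1.qfact_ne_zero hq hs
  have hg := hj2'.2.qfact_ne_zero hq ht
  have ha : qint q a ≠ 0 := qint_ne_zero_of_qfact hf (by omega) (by omega)
  have hb : qint q b ≠ 0 := qint_ne_zero_of_qfact hg (by omega) (by omega)
  have hadm : Admissible q j (j + 2) 2 := by
    refine admissible_of_half_sum hq (s := j + 2) (by omega) (by omega) (by omega) (by omega) ?_
    exact qfact_ne_zero_of_le hf (by omega)
  rw [Lbar, if_pos ⟨hj, hj2, hadm⟩, theta_add_two_two hq,
    tet_horizontal_two hq (by omega) hj'.1, tet_horizontal_two hq (by omega) hj'.2.swap, normH]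
  field_simp

theorem Lbar_self_eq_zero {q : ℂ} (hq : q ≠ 0) {a b c d j : ℕ}
    (h : j = 0 ∨ qint q ((j : ℤ) + 2) = 0) : Lbar q a b c d j j = 0 := by
  refine Lbar_eq_zero fun h' => ?_
  rcases h with rfl | h
  · have := h'.2.2.1
    omega
  · have := h'.2.2.qfact_ne_zero hq (s := j + 1) (by omega)
    exact qint_ne_zero_of_qfact this (by omega) (by push_cast; omega) h

theorem lam_eq_zero_of_zero_left {q : ℂ} {a b l : ℕ} (h : Admissible q a b l) (ha : a = 0) :
    lam q a b l = 0 := by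
  obtain ⟨s, hs, h1, h2, h3⟩ := h.exists_half_sum
  rw [lam_eq q hs, lamNum, show (s : ℤ) - b = 0 by omega, show (s : ℤ) - l = 0 by omega,
    qint_zero]
  ring

theorem lam_eq_zero_of_zero_right {q : ℂ} {a b l : ℕ} (h : Admissible q a b l) (hb : b = 0) :
    lam q a b l = 0 := by
  obtain ⟨s, hs, h1, h2, h3⟩ := h.exists_half_sum
  rw [lam_eq q hs, lamNum, show (s : ℤ) - a = 0 by omega, show (s : ℤ) - l = 0 by omega,
    qint_zero]
  ring

theorem theta_swap_right (q : ℂ) (a b c : ℕ) : theta q a b c = theta q a c b := by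
  rw [theta_rotate, theta_swap, ← theta_rotate]

theorem tet_diagonal_two {q : ℂ} (hq : q ≠ 0) {x y j : ℕ} (hx : 0 < x) (hj : 0 < j)
    (h : Admissible q x y j) :
    tet q x x j j y 2 = theta q x y j / (qint q x * qint q j) * lam q x j y := by
  rw [tet_vertical_two hq hx hj h.rotate.rotate.swap, theta_swap_right]

theorem Lbar_self {q : ℂ} (hq : q ≠ 0) {a b c d j : ℕ} (hj : j ∈ jSet q a b c d) (hj0 : j ≠ 0)
    (hj2 : qint q ((j : ℤ) + 2) ≠ 0) :
    Lbar q a b c d j j = -(normH q a b c d j * (qint q 2 * lam q a j d * lam q b j c) /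
      (qint q j * qint q ((j : ℤ) + 2))) := by
  have hj' := mem_jSet.1 hj
  obtain ⟨s, hs, h1, h2, h3⟩ := hj'.1.exists_half_sum
  have hf1 := qfact_ne_zero_of_le (hj'.1.qfact_ne_zero hq hs) (m := j + 1) (by omega)
  have hf : qfact q (j + 2) ≠ 0 := by
    rw [qfact_succ]
    refine mul_ne_zero hf1 ?_
    rwa [show ((j + 1 : ℕ) : ℤ) + 1 = j + 2 by push_cast; ring]
  have hadm : Admissible q j j 2 := by
    exact admissible_of_half_sum hq (s := j + 1) (by omega) (by omega) (by omega) (by omega) hf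
  have n2 : qint q 2 ≠ 0 := qint_ne_zero_of_qfact hf (by omega) (by omega)
  have nj : qint q j ≠ 0 := qint_ne_zero_of_qfact hf (by omega) (by omega)
  have nb := bubble_ne_zero hq hf1
  rw [Lbar, if_pos ⟨hj, hj, hadm⟩]
  rcases Nat.eq_zero_or_pos a with ha | ha
  · rw [lam_eq_zero_of_zero_left hj'.1.rotate.rotate.swap ha, ha, Nat.cast_zero, qint_zero]
    ring
  rcases Nat.eq_zero_or_pos b with hb | hb
  · rw [lam_eq_zero_of_zero_left hj'.2.rotate hb, hb, Nat.cast_zero, qint_zero]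
    ring
  have na : qint q a ≠ 0 :=
    qint_ne_zero_of_qfact (hj'.1.qfact_ne_zero hq hs) (by omega) (by omega)
  have nb' : qint q b ≠ 0 := by
    obtain ⟨t, ht, _, k2, _⟩ := hj'.2.exists_half_sum
    exact qint_ne_zero_of_qfact (hj'.2.qfact_ne_zero hq ht) (by omega) (by omega)
  rw [tet_diagonal_two hq ha (by omega) hj'.1, tet_diagonal_two hq hb (by omega) hj'.2.swap,
    theta_self_two hq (by omega) (mul_ne_zero n2 nj), normH]
  field_simp

/-! ### The three-term recurrence -/

/-- The factor in front of the alternating sum of a tetrahedron. -/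
noncomputable def tetCoeff (q : ℂ) (a b c d j l a₁ a₂ a₃ a₄ b₁ b₂ b₃ : ℕ) : ℂ :=
  (qfact q (b₁ - a₁) * qfact q (b₂ - a₁) * qfact q (b₃ - a₁) *
      (qfact q (b₁ - a₂) * qfact q (b₂ - a₂) * qfact q (b₃ - a₂)) *
      (qfact q (b₁ - a₃) * qfact q (b₂ - a₃) * qfact q (b₃ - a₃)) *
      (qfact q (b₁ - a₄) * qfact q (b₂ - a₄) * qfact q (b₃ - a₄))) /
    (qfact q a * qfact q b * qfact q c * qfact q d * qfact q j * qfact q l)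

/-- The bookkeeping of denominators in `recurrence_term_up`: `J` is `[j]!`, and `x`, `y` are the
factors `[j + 1]`, `[j + 2]` by which it changes. -/
theorem div_mul_mul_eq {v n n' e J x y L R u : ℂ} (hx : x ≠ 0) (hy : y ≠ 0)
    (h : v * n' = n * u) :
    v * (n' / (e * (J * x * y) * L) * R) * (x * y) = n / (e * J * L) * (u * R) := by
  field_simp
  rw [h]
  ring

theorem Lbar_add_two_mul_tet {q : ℂ} (hq : q ≠ 0) {a b c d j l : ℕ} (hj : j ∈ jSet q a b c d) :
    Lbar q a b c d j (j + 2) / normH q a b c d (j + 2) * tet q a b c d (j + 2) l =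
      qint q (((a : ℤ) + d - j) / 2) * qint q (((b : ℤ) + c - j) / 2)
        * tet q a b c d (j + 2) l := by
  by_cases hj2 : j + 2 ∈ jSet q a b c d
  · have := normH_ne_zero hq hj2
    rw [Lbar_add_two hq hj hj2]
    field_simp
  · rw [tet_eq_zero fun h => hj2 (mem_jSet.2 ⟨h.2.2.1, h.2.2.2⟩)]
    ring

set_option maxHeartbeats 2000000 in
/-- The term of the recurrence with index `j + 2`.  If `j + 2` is not admissible, then the
alternating sum on the right vanishes: either it is empty or all its terms contain a zero
`[S + 1]!`. -/
theorem recurrence_term_up {q : ℂ} (hq : q ≠ 0) {a b c d j l : ℕ} (h₁ : Admissible q a b l)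
    (h₂ : Admissible q c d l) (h₃ : Admissible q a d j) (h₄ : Admissible q c b j)
    {a₁ a₂ a₃ a₄ b₁ b₂ b₃ : ℕ}
    (ha₁ : 2 * a₁ = a + d + j) (ha₂ : 2 * a₂ = b + c + j) (ha₃ : 2 * a₃ = a + b + l)
    (ha₄ : 2 * a₄ = c + d + l) (hb₁ : 2 * b₁ = b + d + j + l) (hb₂ : 2 * b₂ = a + c + j + l)
    (hb₃ : 2 * b₃ = a + b + c + d) :
    Lbar q a b c d j (j + 2) / normH q a b c d (j + 2) * tet q a b c d (j + 2) l *
        (qint q (j + 1) * qint q (j + 2)) =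
      tetCoeff q a b c d j l a₁ a₂ a₃ a₄ b₁ b₂ b₃ *
        (qint q (b₁ - a₃ + 1) * qint q (b₁ - a₄ + 1) * qint q (b₂ - a₃ + 1)
            * qint q (b₂ - a₄ + 1) *
            racahSum q (b₃ + 1) (a₁ + 1) (a₂ + 1) a₃ a₄ (b₁ + 1) (b₂ + 1) b₃) := by
  have hj : j ∈ jSet q a b c d := mem_jSet.2 ⟨h₃, h₄⟩
  obtain ⟨⟨t1, t2, t3⟩, -⟩ := id h₁
  obtain ⟨⟨t4, t5, t6⟩, -⟩ := id h₂
  obtain ⟨⟨t7, t8, t9⟩, -⟩ := id h₃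
  obtain ⟨⟨s1, s2, s3⟩, -⟩ := id h₄
  have f₃ := h₃.qfact_ne_zero hq ha₁
  have f₄ := h₄.qfact_ne_zero hq (s := a₂) (by omega)
  rw [Lbar_add_two_mul_tet hq hj]
  by_cases hj2 : j + 2 ∈ jSet q a b c d
  · obtain ⟨h₃', h₄'⟩ := mem_jSet.1 hj2
    have f₃' := h₃'.qfact_ne_zero hq (s := a₁ + 1) (by omega)
    obtain ⟨⟨r1, r2, r3⟩, -⟩ := id h₃'
    obtain ⟨⟨r4, r5, r6⟩, -⟩ := id h₄'
    rw [tet_eq h₁ h₂ h₃' h₄' (a₁ := a₁ + 1) (a₂ := a₂ + 1) (a₃ := a₃) (a₄ := a₄) (b₁ := b₁ + 1)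
      (b₂ := b₂ + 1) (b₃ := b₃) (K := b₃ + 1) (by omega) (by omega) (by omega) (by omega)
      (by omega) (by omega) (by omega) (by omega), tetCoeff]
    obtain ⟨v₁, hv₁⟩ : ∃ v, b₃ = a₁ + (v + 1) := ⟨b₃ - a₁ - 1, by omega⟩
    obtain ⟨v₂, hv₂⟩ : ∃ v, b₃ = a₂ + (v + 1) := ⟨b₃ - a₂ - 1, by omega⟩
    obtain ⟨u₁, hu₁⟩ : ∃ u, b₁ = a₃ + u := ⟨b₁ - a₃, by omega⟩
    obtain ⟨u₂, hu₂⟩ : ∃ u, b₁ = a₄ + u := ⟨b₁ - a₄, by omega⟩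
    obtain ⟨u₃, hu₃⟩ : ∃ u, b₂ = a₃ + u := ⟨b₂ - a₃, by omega⟩
    obtain ⟨u₄, hu₄⟩ : ∃ u, b₂ = a₄ + u := ⟨b₂ - a₄, by omega⟩
    rw [show ((a : ℤ) + d - j) / 2 = v₂ + 1 by omega, show ((b : ℤ) + c - j) / 2 = v₁ + 1 by omega,
      show b₁ + 1 - (a₁ + 1) = b₁ - a₁ by omega, show b₂ + 1 - (a₁ + 1) = b₂ - a₁ by omega,
      show b₁ + 1 - (a₂ + 1) = b₁ - a₂ by omega, show b₂ + 1 - (a₂ + 1) = b₂ - a₂ by omega,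
      show b₃ - (a₁ + 1) = v₁ by omega, show b₃ - (a₂ + 1) = v₂ by omega,
      show b₃ - a₁ = v₁ + 1 by omega, show b₃ - a₂ = v₂ + 1 by omega,
      show b₁ + 1 - a₃ = u₁ + 1 by omega, show b₁ - a₃ = u₁ by omega,
      show b₁ + 1 - a₄ = u₂ + 1 by omega, show b₁ - a₄ = u₂ by omega,
      show b₂ + 1 - a₃ = u₃ + 1 by omega, show b₂ - a₃ = u₃ by omega,
      show b₂ + 1 - a₄ = u₄ + 1 by omega, show b₂ - a₄ = u₄ by omega,
      show (b₁ : ℤ) - a₃ = u₁ by omega, show (b₁ : ℤ) - a₄ = u₂ by omega,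
      show (b₂ : ℤ) - a₃ = u₃ by omega, show (b₂ : ℤ) - a₄ = u₄ by omega]
    simp only [qfact_succ q u₁, qfact_succ q u₂, qfact_succ q u₃, qfact_succ q u₄,
      qfact_succ q v₁, qfact_succ q v₂, qfact_succ q (j + 1), qfact_succ q j]
    push_cast
    rw [show (j : ℤ) + 1 + 1 = j + 2 by ring]
    have n1 := qint_ne_zero_of_qfact f₃' (k := (j : ℤ) + 1) (by omega) (by omega)
    have n2 := qint_ne_zero_of_qfact f₃' (k := (j : ℤ) + 2) (by omega) (by omega)
    exact div_mul_mul_eq n1 n2 (by ring)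
  · have hU : racahSum q (b₃ + 1) (a₁ + 1) (a₂ + 1) a₃ a₄ (b₁ + 1) (b₂ + 1) b₃ = 0 := by
      refine Finset.sum_eq_zero fun S _ => ?_
      by_cases hS : (S : ℤ) < a₁ + 1 ∨ (S : ℤ) < a₂ + 1 ∨ (b₃ : ℤ) < S
      · exact racahTerm_eq_zero q (by omega)
      · have hz : qfact q (S + 1) = 0 := by
          by_contra hne
          refine hj2 (mem_jSet.2 ⟨?_, ?_⟩)
          · exact admissible_of_half_sum hq (s := a₁ + 1) (by omega) (by omega) (by omega)
              (by omega) (qfact_ne_zero_of_le hne (by omega))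
          · exact admissible_of_half_sum hq (s := a₂ + 1) (by omega) (by omega) (by omega)
              (by omega) (qfact_ne_zero_of_le hne (by omega))
        rw [racahTerm, hz]
        ring
    rw [hU, tet_eq_zero fun h => hj2 (mem_jSet.2 ⟨h.2.2.1, h.2.2.2⟩)]
    ring

set_option maxHeartbeats 2000000 in
/-- The term of the recurrence with index `j - 2`.  If `j - 2` is not admissible, then the
alternating sum on the right is empty. -/
theorem recurrence_term_down {q : ℂ} (hq : q ≠ 0) {a b c d j l : ℕ} (h₁ : Admissible q a b l)
    (h₂ : Admissible q c d l) (h₃ : Admissible q a d j) (h₄ : Admissible q c b j) (hj0 : j ≠ 0)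
    {a₁ a₂ a₃ a₄ b₁ b₂ b₃ : ℕ}
    (ha₁ : 2 * a₁ = a + d + j) (ha₂ : 2 * a₂ = b + c + j) (ha₃ : 2 * a₃ = a + b + l)
    (ha₄ : 2 * a₄ = c + d + l) (hb₁ : 2 * b₁ = b + d + j + l) (hb₂ : 2 * b₂ = a + c + j + l)
    (hb₃ : 2 * b₃ = a + b + c + d) :
    (if 2 ≤ j then Lbar q a b c d j (j - 2) / normH q a b c d (j - 2) * tet q a b c d (j - 2) l
        else 0) * (qint q j * qint q (j + 1)) =
      tetCoeff q a b c d j l a₁ a₂ a₃ a₄ b₁ b₂ b₃ *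
        (qint q (a₁ + 1) * qint q (a₂ + 1) * qint q (b₃ - a₁ + 1) * qint q (b₃ - a₂ + 1) *
            racahSum q (b₃ + 1) (a₁ - 1) (a₂ - 1) a₃ a₄ (b₁ - 1) (b₂ - 1) b₃) := by
  obtain ⟨⟨t1, t2, t3⟩, -⟩ := id h₁
  obtain ⟨⟨t4, t5, t6⟩, -⟩ := id h₂
  obtain ⟨⟨t7, t8, t9⟩, -⟩ := id h₃
  obtain ⟨⟨s1, s2, s3⟩, -⟩ := id h₄
  have hj : j ∈ jSet q a b c d := mem_jSet.2 ⟨h₃, h₄⟩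
  have f₃ := h₃.qfact_ne_zero hq ha₁
  have f₄ := h₄.qfact_ne_zero hq (s := a₂) (by omega)
  by_cases hpos : a₃ < b₁ ∧ a₄ < b₁ ∧ a₃ < b₂ ∧ a₄ < b₂
  · obtain ⟨p1, p2, p3, p4⟩ := hpos
    obtain ⟨i, rfl⟩ : ∃ i, j = i + 2 := ⟨j - 2, by omega⟩
    have h₃' : Admissible q a d i := admissible_of_half_sum hq (s := a₁ - 1) (by omega) (by omega)
      (by omega) (by omega) (qfact_ne_zero_of_le f₃ (by omega))
    have h₄' : Admissible q c b i := admissible_of_half_sum hq (s := a₂ - 1) (by omega) (by omega)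
      (by omega) (by omega) (qfact_ne_zero_of_le f₄ (by omega))
    have hi : i ∈ jSet q a b c d := mem_jSet.2 ⟨h₃', h₄'⟩
    obtain ⟨m₁, rfl⟩ : ∃ m, a₁ = m + 1 := ⟨a₁ - 1, by omega⟩
    obtain ⟨m₂, rfl⟩ : ∃ m, a₂ = m + 1 := ⟨a₂ - 1, by omega⟩
    obtain ⟨k₁, rfl⟩ : ∃ m, b₁ = m + 1 := ⟨b₁ - 1, by omega⟩
    obtain ⟨k₂, rfl⟩ : ∃ m, b₂ = m + 1 := ⟨b₂ - 1, by omega⟩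
    rw [if_pos (by omega), Nat.add_sub_cancel, Lbar_comm, Lbar_add_two hq hi hj,
      tet_eq h₁ h₂ h₃' h₄' (a₁ := m₁) (a₂ := m₂) (a₃ := a₃) (a₄ := a₄) (b₁ := k₁)
      (b₂ := k₂) (b₃ := b₃) (K := b₃ + 1) (by omega) (by omega) (by omega) (by omega)
      (by omega) (by omega) (by omega) (by omega), tetCoeff, normH, normH,
      theta_eq h₃ (s := m₁ + 1) (by omega), theta_eq h₃' (s := m₁) (by omega),
      theta_eq h₄.swap (s := m₂ + 1) (by omega), theta_eq h₄'.swap (s := m₂) (by omega),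
      bubble_of_ne hq (j := i + 2) (qfact_ne_zero_of_le f₃ (by omega)),
      bubble_of_ne hq (j := i) (qfact_ne_zero_of_le f₃ (by omega))]
    obtain ⟨v₁, hv₁⟩ : ∃ v, b₃ = m₁ + (v + 1) := ⟨b₃ - m₁ - 1, by omega⟩
    obtain ⟨v₂, hv₂⟩ : ∃ v, b₃ = m₂ + (v + 1) := ⟨b₃ - m₂ - 1, by omega⟩
    obtain ⟨u₁, hu₁⟩ : ∃ u, k₁ = a₃ + u := ⟨k₁ - a₃, by omega⟩
    obtain ⟨u₂, hu₂⟩ : ∃ u, k₁ = a₄ + u := ⟨k₁ - a₄, by omega⟩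
    obtain ⟨u₃, hu₃⟩ : ∃ u, k₂ = a₃ + u := ⟨k₂ - a₃, by omega⟩
    obtain ⟨u₄, hu₄⟩ : ∃ u, k₂ = a₄ + u := ⟨k₂ - a₄, by omega⟩
    rw [show ((a : ℤ) + d - i) / 2 = v₂ + 1 by omega, show ((b : ℤ) + c - i) / 2 = v₁ + 1 by omega,
      show k₁ + 1 - (m₁ + 1) = k₁ - m₁ by omega, show k₂ + 1 - (m₁ + 1) = k₂ - m₁ by omega,
      show k₁ + 1 - (m₂ + 1) = k₁ - m₂ by omega, show k₂ + 1 - (m₂ + 1) = k₂ - m₂ by omega,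
      show b₃ - (m₁ + 1) = v₁ by omega, show b₃ - (m₂ + 1) = v₂ by omega,
      show b₃ - m₁ = v₁ + 1 by omega, show b₃ - m₂ = v₂ + 1 by omega,
      show k₁ + 1 - a₃ = u₁ + 1 by omega, show k₁ - a₃ = u₁ by omega,
      show k₁ + 1 - a₄ = u₂ + 1 by omega, show k₁ - a₄ = u₂ by omega,
      show k₂ + 1 - a₃ = u₃ + 1 by omega, show k₂ - a₃ = u₃ by omega,
      show k₂ + 1 - a₄ = u₄ + 1 by omega, show k₂ - a₄ = u₄ by omega,
      show m₁ + 1 - a = u₁ + 1 by omega, show m₁ - a = u₁ by omega,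
      show m₁ + 1 - d = u₄ + 1 by omega, show m₁ - d = u₄ by omega,
      show m₁ + 1 - (i + 2) = v₂ by omega, show m₁ - i = v₂ + 1 by omega,
      show m₂ + 1 - b = u₃ + 1 by omega, show m₂ - b = u₃ by omega,
      show m₂ + 1 - c = u₂ + 1 by omega, show m₂ - c = u₂ by omega,
      show m₂ + 1 - (i + 2) = v₁ by omega, show m₂ - i = v₁ + 1 by omega,
      show (b₃ : ℤ) - (m₁ + 1 : ℕ) + 1 = v₁ + 1 by omega,
      show (b₃ : ℤ) - (m₂ + 1 : ℕ) + 1 = v₂ + 1 by omega,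
      show ((m₁ + 1 : ℕ) : ℤ) - 1 = m₁ by omega, show ((m₂ + 1 : ℕ) : ℤ) - 1 = m₂ by omega,
      show ((k₁ + 1 : ℕ) : ℤ) - 1 = k₁ by omega, show ((k₂ + 1 : ℕ) : ℤ) - 1 = k₂ by omega]
    have g : ∀ n ≤ m₁ + 2, qfact q n ≠ 0 := fun n hn => qfact_ne_zero_of_le f₃ (by omega)
    have g' : ∀ n ≤ m₂ + 2, qfact q n ≠ 0 := fun n hn => qfact_ne_zero_of_le f₄ (by omega)
    have e1 := g (u₁ + 1) (by omega)
    have e2 := g' (u₂ + 1) (by omega)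
    have e3 := g' (u₃ + 1) (by omega)
    have e4 := g (u₄ + 1) (by omega)
    have e5 := g' (v₁ + 1) (by omega)
    have e6 := g (v₂ + 1) (by omega)
    have e7 := g (i + 2) (by omega)
    have e8 := g (m₁ + 2) (by omega)
    have e9 := g' (m₂ + 2) (by omega)
    have e10 := g a (by omega)
    have e11 := g d (by omega)
    have e12 := g' b (by omega)
    have e13 := g' c (by omega)
    have e14 := qint_ne_zero_of_qfact f₃ (k := (i : ℤ) + 1) (by omega) (by omega)
    have e15 := qint_ne_zero_of_qfact f₃ (k := (i : ℤ) + 3) (by omega) (by omega)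
    simp only [qfact_succ q u₁, qfact_succ q u₂, qfact_succ q u₃, qfact_succ q u₄,
      qfact_succ q v₁, qfact_succ q v₂, qfact_succ q (i + 1), qfact_succ q i,
      qfact_succ q (m₁ + 1), qfact_succ q (m₂ + 1), pow_succ, mul_ne_zero_iff, Ne]
      at e1 e2 e3 e4 e5 e6 e7 e8 e9 ⊢
    push_cast at e1 e2 e3 e4 e5 e6 e7 e8 e9 ⊢
    rw [show (i : ℤ) + 2 + 1 = i + 3 by ring]
    rw [show (i : ℤ) + 1 + 1 = i + 2 by ring] at e7 ⊢
    obtain ⟨x1, y1⟩ := e1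
    obtain ⟨x2, y2⟩ := e2
    obtain ⟨x3, y3⟩ := e3
    obtain ⟨x4, y4⟩ := e4
    obtain ⟨x5, y5⟩ := e5
    obtain ⟨x6, y6⟩ := e6
    obtain ⟨⟨x7, y7⟩, z7⟩ := e7
    obtain ⟨x8, y8⟩ := e8
    obtain ⟨x9, y9⟩ := e9
    field_simp
  · have hU : racahSum q (b₃ + 1) (a₁ - 1) (a₂ - 1) a₃ a₄ (b₁ - 1) (b₂ - 1) b₃ = 0 :=
      Finset.sum_eq_zero fun S _ => racahTerm_eq_zero q (by omega)
    rw [hU]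
    split_ifs with h2
    · rw [tet_eq_zero]
      · ring
      · rintro ⟨-, -, ⟨⟨r1, r2, r3⟩, -⟩, ⟨⟨r4, r5, r6⟩, -⟩⟩
        omega
    · ring

/-- For `j = 0` the tetrahedron reduces to a `θ`-network. -/
theorem tet_zero {q : ℂ} (hq : q ≠ 0) {a b l : ℕ} (h : Admissible q a b l) :
    tet q a b b a 0 l = theta q a b l := by
  obtain ⟨s, hs, h1, h2, h3⟩ := h.exists_half_sum
  have hf := h.qfact_ne_zero hq hs
  have f : ∀ n ≤ s + 1, qfact q n ≠ 0 := fun n hn => qfact_ne_zero_of_le hf hn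
  have ha : Admissible q a a 0 := admissible_of_half_sum hq (s := a) (by omega) (by omega)
    (by omega) (by omega) (f _ (by omega))
  have hb : Admissible q b b 0 := admissible_of_half_sum hq (s := b) (by omega) (by omega)
    (by omega) (by omega) (f _ (by omega))
  rw [tet_eq h h.swap ha hb (a₁ := a) (a₂ := b) (a₃ := s) (a₄ := s) (b₁ := s) (b₂ := s)
    (b₃ := a + b) (K := a + b + 1) (by omega) (by omega) (by omega) (by omega) (by omega)
    (by omega) (by omega) (by omega), theta_eq h hs]
  have hU : racahSum q (a + b + 1) a b s s s s (a + b : ℕ) = (-1) ^ s * qfact q (s + 1)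
      * (qfact q (s - a))⁻¹ * (qfact q (s - b))⁻¹ * (qfact q (a + b - s))⁻¹ := by
    rw [racahSum, Finset.sum_eq_single s (fun S _ hS => racahTerm_eq_zero q (by omega))
      (fun hS => absurd (Finset.mem_range.2 (by omega)) hS)]
    unfold racahTerm
    rw [← Nat.cast_sub h1, ← Nat.cast_sub h2, sub_self,
      ← Nat.cast_sub (by omega : s ≤ a + b), qfactInv_zero, qfactInv_natCast, qfactInv_natCast,
      qfactInv_natCast]
    ring
  rw [hU, show a + b - a = b by omega, show a + b - b = a by omega,
    show a + b - s = s - l by omega, Nat.sub_self, qfact_zero]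
  have n1 := f (s - a) (by omega)
  have n2 := f (s - b) (by omega)
  have n3 := f (s - l) (by omega)
  have n4 := f a (by omega)
  have n5 := f b (by omega)
  have n6 := f l (by omega)
  field_simp

/-- The case `j = 0` of the three-term recurrence. -/
theorem threeTerm_zero {q : ℂ} (hq : q ≠ 0) {a b l : ℕ} (h : Admissible q a b l) :
    Lbar q a b b a 0 (0 + 2) / normH q a b b a (0 + 2) * tet q a b b a (0 + 2) l
      = lam q a b l * tet q a b b a 0 l := by
  obtain ⟨s, hs, h1, h2, h3⟩ := h.exists_half_sum
  have hf := h.qfact_ne_zero hq hs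
  have hj : 0 ∈ jSet q a b b a := by
    rw [mem_jSet]
    exact ⟨admissible_of_half_sum hq (s := a) (by omega) (by omega) (by omega) (by omega)
      (qfact_ne_zero_of_le hf (by omega)), admissible_of_half_sum hq (s := b) (by omega)
      (by omega) (by omega) (by omega) (qfact_ne_zero_of_le hf (by omega))⟩
  rw [Lbar_add_two_mul_tet hq hj, show ((a : ℤ) + a - (0 : ℕ)) / 2 = a by omega,
    show ((b : ℤ) + b - (0 : ℕ)) / 2 = b by omega]
  rcases Nat.eq_zero_or_pos a with ha | ha
  · rw [lam_eq_zero_of_zero_left h ha, ha, Nat.cast_zero, qint_zero]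
    ring
  rcases Nat.eq_zero_or_pos b with hb | hb
  · rw [lam_eq_zero_of_zero_right h hb, hb, Nat.cast_zero, qint_zero]
    ring
  have na : qint q a ≠ 0 := qint_ne_zero_of_qfact hf (by omega) (by omega)
  have nb : qint q b ≠ 0 := qint_ne_zero_of_qfact hf (by omega) (by omega)
  rw [zero_add, tet_dual, tet_vertical_two hq ha hb h, tet_zero hq h]
  field_simp

/-- The tetrahedra with fixed `l` satisfy the three-term recurrence in `j`. -/
theorem threeTerm_tet {q : ℂ} (hq : q ≠ 0) {a b c d l : ℕ} (hl : l ∈ lSet q a b c d) :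
    ThreeTerm q a b c d l fun j => tet q a b c d j l := by
  intro j hj
  beta_reduce
  obtain ⟨h₁, h₂⟩ := mem_lSet.1 hl
  obtain ⟨h₃, h₄⟩ := mem_jSet.1 hj
  have nN := normH_ne_zero hq hj
  by_cases hj0 : j = 0
  · subst hj0
    obtain rfl : a = d := by
      have := h₃.1
      omega
    obtain rfl : b = c := by
      have := h₄.1
      omega
    rw [Lbar_self_eq_zero hq (Or.inl rfl), threeTerm_zero hq h₁, if_neg (by omega)]
    ring
  obtain ⟨a₁, a₂, a₃, a₄, b₁, b₂, b₃, e₁, e₂, e₃, e₄, e₅, e₆, e₇⟩ := exists_half_sums h₁ h₂ h₃ h₄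
  have up := recurrence_term_up hq h₁ h₂ h₃ h₄ e₁ e₂ e₃ e₄ e₅ e₆ e₇
  have down := recurrence_term_down hq h₁ h₂ h₃ h₄ hj0 e₁ e₂ e₃ e₄ e₅ e₆ e₇
  have mid := tet_eq h₁ h₂ h₃ h₄ e₁ e₂ e₃ e₄ e₅ e₆ e₇ (Nat.lt_succ_self b₃)
  rw [← tetCoeff] at mid
  obtain ⟨⟨t1, t2, t3⟩, -⟩ := id h₁
  obtain ⟨⟨t4, t5, t6⟩, -⟩ := id h₂
  obtain ⟨⟨t7, t8, t9⟩, -⟩ := id h₃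
  obtain ⟨⟨s1, s2, s3⟩, -⟩ := id h₄
  have f₁ := h₁.qfact_ne_zero hq e₃
  have f₂ := h₂.qfact_ne_zero hq e₄
  have f₃ := h₃.qfact_ne_zero hq e₁
  have f₄ := h₄.qfact_ne_zero hq (s := a₂) (by omega)
  -- all denominators are bounded by the largest half-sum
  obtain ⟨N, hN, g₁, g₂, g₃, g₄⟩ : ∃ N, qfact q N ≠ 0 ∧ a₁ + 1 ≤ N ∧ a₂ + 1 ≤ N ∧ a₃ + 1 ≤ N ∧
      a₄ + 1 ≤ N := by
    have hm : ∀ x y : ℕ, qfact q x ≠ 0 → qfact q y ≠ 0 → qfact q (max x y) ≠ 0 := fun x y hx hy => by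
      rcases max_choice x y with h | h <;> rw [h] <;> assumption
    exact ⟨_, hm _ _ (hm _ _ f₁ f₂) (hm _ _ f₃ f₄), by omega, by omega, by omega, by omega⟩
  have nj : qint q j ≠ 0 := qint_ne_zero_of_qfact hN (by omega) (by omega)
  have nj1 : qint q (j + 1) ≠ 0 := qint_ne_zero_of_qfact hN (by omega) (by omega)
  have n2 : qint q 2 ≠ 0 := qint_ne_zero_of_qfact hN (by omega) (by omega)
  by_cases hj2 : qint q ((j : ℤ) + 2) = 0
  · -- here `j = r - 2`, so both vertices are flat
    have ej : a₁ = j := by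
      by_contra hne
      exact qint_ne_zero_of_qfact f₃ (by omega) (by omega) hj2
    have ej' : a₂ = j := by
      by_contra hne
      exact qint_ne_zero_of_qfact f₄ (by omega) (by omega) hj2
    have eb : b₃ = j := by omega
    have hout : j + 2 ∉ jSet q a b c d := fun h => by
      have := (mem_jSet.1 h).1.1
      omega
    have top := racahSum_recurrence_top hq (K := b₃ + 1) (j := j) hN (a₃ := a₃) (a₄ := a₄)
      (b₁ := b₁) (b₂ := b₂) (by omega) (by omega) (by omega) (by omega) (by omega) (by omega)
      (by omega) (by omega)
    rw [Lbar_self_eq_zero hq (Or.inr hj2), Lbar_eq_zero fun h => hout h.2.1, lam_eq q e₃]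
    rw [hj2] at top
    rw [ej, ej', eb, sub_self, zero_add, qint_one hq] at down
    rw [ej, ej', eb] at mid
    rw [eb] at top
    have el : lamNum q a₃ (a₃ - a) (a₃ - b) (a₃ - l) = lamNum q a₃ (b₁ - j) (b₂ - j) (j - a₄) := by
      congr 1 <;> omega
    rw [el, mid]
    apply mul_right_cancel₀ (mul_ne_zero nj nj1)
    have key : qint q 2 * (qint q (j + 1) * racahSum q (j + 1) (j - 1) (j - 1) a₃ a₄ (b₁ - 1)
        (b₂ - 1) j - qint q j * (lamNum q a₃ (b₁ - j) (b₂ - j) (j - a₄) / qint q 2)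
        * racahSum q (j + 1) j j a₃ a₄ b₁ b₂ j) = 0 := by
      field_simp
      linear_combination top
    have key' := (mul_eq_zero.1 key).resolve_left n2
    linear_combination down + tetCoeff q a b c d j l j j a₃ a₄ b₁ b₂ j * qint q (j + 1) * key'
  · have main := racahSum_recurrence hq (K := b₃ + 1) hN (a₁ := a₁) (a₂ := a₂) (a₃ := a₃)
      (a₄ := a₄) (b₁ := b₁) (b₂ := b₂) (b₃ := b₃) (j := j) (by omega) (by omega) (by omega)
      (by omega) (by omega) (by omega) (by omega) (by omega) (by omega)
    rw [Lbar_self hq hj hj0 hj2, lam_eq q e₃, lam_eq q (show 2 * a₁ = a + j + d by omega),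
      lam_eq q (show 2 * a₂ = b + j + c by omega), mid]
    have l1 : lamNum q a₃ (a₃ - a) (a₃ - b) (a₃ - l) = lamNum q a₃ (b₁ - a₁) (b₂ - a₂) (b₃ - a₄) := by
      congr 1 <;> omega
    have l2 : lamNum q a₁ (a₁ - a) (a₁ - j) (a₁ - d) = lamNum q a₁ (b₁ - a₃) (b₃ - a₂) (b₂ - a₄) := by
      congr 1 <;> omega
    have l3 : lamNum q a₂ (a₂ - b) (a₂ - j) (a₂ - c) = lamNum q a₂ (b₂ - a₃) (b₃ - a₁) (b₁ - a₄) := by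
      congr 1 <;> omega
    rw [l1, l2, l3]
    generalize (if 2 ≤ j then _ else _ : ℂ) = D at *
    generalize Lbar q a b c d j (j + 2) / normH q a b c d (j + 2) * tet q a b c d (j + 2) l = E at *
    generalize tetCoeff q a b c d j l a₁ a₂ a₃ a₄ b₁ b₂ b₃ = C at *
    generalize racahSum q (b₃ + 1) a₁ a₂ a₃ a₄ b₁ b₂ b₃ = U at *
    generalize lamNum q a₃ (b₁ - a₁) (b₂ - a₂) (b₃ - a₄) = L3 at *
    generalize lamNum q a₁ (b₁ - a₃) (b₃ - a₂) (b₂ - a₄) = L1 at *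
    generalize lamNum q a₂ (b₂ - a₃) (b₃ - a₁) (b₁ - a₄) = L2 at *
    have hmid : (-(normH q a b c d j * (qint q 2 * (L1 / qint q 2) * (L2 / qint q 2)) /
        (qint q j * qint q (j + 2))) / normH q a b c d j - L3 / qint q 2) *
        (qint q 2 * (qint q j * qint q (j + 1) * qint q (j + 2))) =
        -(qint q (j + 1) * (L1 * L2 + qint q j * qint q (j + 2) * L3)) := by
      field_simp
      ring
    apply mul_right_cancel₀ (mul_ne_zero n2 (mul_ne_zero (mul_ne_zero nj nj1) hj2))
    linear_combination C * U * hmid + qint q 2 * qint q j * up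
      + qint q 2 * qint q (j + 2) * down + C * main

/-! ### Orthogonality -/

/-- The difference of two eigenvalues factors: passing from `l` to `l + 2m` adds `m` to `s`, `s - a`
and `s - b` and subtracts it from `s - l`. -/
theorem lamNum_sub_lamNum {q : ℂ} (hq : q ≠ 0) (u v w m : ℤ) :
    lamNum q (u + v + w + m) (u + m) (v + m) (w - m) - lamNum q (u + v + w) u v w
      = qint q 2 * (qint q (u + v + m + 1) * qint q m) := by
  have c := continuousAt_qint hq
  have cl := continuousAt_lamNum hq
  refine eq_of_notRootOfUnity ((cl _ _ _ _).sub (cl _ _ _ _)) ((c _).mul ((c _).mul (c _)))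
    fun q h => ?_
  have hq := h.1
  have hw := sub_inv_ne_zero_of_sq_ne_one hq h.sq_ne_one
  simp only [Pi.mul_apply, Pi.sub_apply]
  rw [h.qint_two]
  unfold lamNum
  simp only [h.qint_eq, zpow_add₀ hq, zpow_sub₀ hq, zpow_ofNat]
  have hu := zpow_ne_zero u hq
  have hv := zpow_ne_zero v hq
  have hw' := zpow_ne_zero w hq
  have hm := zpow_ne_zero m hq
  generalize q - q⁻¹ = x at *
  generalize q ^ u = U at *
  generalize q ^ v = V at *
  generalize q ^ w = W at *
  generalize q ^ m = M at *
  field_simp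
  ring

/-- The identity behind `λ(a,b,c+d) - ⟨j̄|L|j̄⟩/⟨j̄|j̄⟩` for `j = a - d`, without denominators, with
`α = (c + j - b)/2`, `β = (b + j - c)/2` and `γ = (b + c - j)/2`. -/
theorem lamNum_sub_lamNum_first {q : ℂ} (hq : q ≠ 0) (α β γ d : ℤ) :
    qint q (α + β + 2) * lamNum q (α + β + γ + d) γ (α + d) β
        - qint q (α + β + d + 2) * lamNum q (α + β + γ) α γ β
      = qint q 2 * (qint q d * qint q γ * qint q (β + 1)) := by
  have c := continuousAt_qint hq
  have cl := continuousAt_lamNum hq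
  refine eq_of_notRootOfUnity (((c _).mul (cl _ _ _ _)).sub ((c _).mul (cl _ _ _ _)))
    ((c _).mul (((c _).mul (c _)).mul (c _))) fun q h => ?_
  have hq := h.1
  have hw := sub_inv_ne_zero_of_sq_ne_one hq h.sq_ne_one
  simp only [Pi.mul_apply, Pi.sub_apply]
  rw [h.qint_two]
  unfold lamNum
  simp only [h.qint_eq, zpow_add₀ hq, zpow_ofNat]
  have hu := zpow_ne_zero α hq
  have hv := zpow_ne_zero β hq
  have hw' := zpow_ne_zero γ hq
  have hm := zpow_ne_zero d hq
  generalize q - q⁻¹ = x at *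
  generalize q ^ α = U at *
  generalize q ^ β = V at *
  generalize q ^ γ = W at *
  generalize q ^ d = M at *
  field_simp
  ring

theorem lam_add_sub_lam {q : ℂ} (hq : q ≠ 0) (h2 : qint q 2 ≠ 0) {a b l m : ℕ}
    (h : (a + b + l) % 2 = 0) :
    lam q a b (l + 2 * m) - lam q a b l = qint q (l + m + 1) * qint q m := by
  obtain ⟨s, hs⟩ : ∃ s, 2 * s = a + b + l := ⟨(a + b + l) / 2, by omega⟩
  have key := lamNum_sub_lamNum hq (s - a) (s - b) (s - l) m
  rw [lam_eq q hs, lam_eq q (s := s + m) (by omega), ← sub_div, div_eq_iff h2]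
  rw [show ((s : ℤ) - a) + (s - b) + (s - l) + m = (s + m : ℕ) by push_cast; omega,
    show ((s : ℤ) - a) + (s - b) + (s - l) = s by omega,
    show (s : ℤ) - a + m = (s + m : ℕ) - a by push_cast; ring,
    show (s : ℤ) - b + m = (s + m : ℕ) - b by push_cast; ring,
    show (s : ℤ) - l - m = (s + m : ℕ) - (l + 2 * m : ℕ) by push_cast; ring,
    show (s : ℤ) - a + (s - b) + m + 1 = l + m + 1 by omega] at key
  rw [key]
  ring

/-- The eigenvalues attached to different admissible labels are different. -/
theorem lam_injOn {q : ℂ} (hq : q ≠ 0) {a b l l' : ℕ} (h : Admissible q a b l)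
    (h' : Admissible q a b l') (hll : lam q a b l = lam q a b l') : l = l' := by
  wlog hle : l < l' generalizing l l'
  · rcases (not_lt.1 hle).eq_or_lt with he | hlt
    · exact he.symm
    · exact (this h' h hll.symm hlt).symm
  exfalso
  obtain ⟨s, hs, h1, h2, h3⟩ := h.exists_half_sum
  obtain ⟨s', hs', h1', h2', h3'⟩ := h'.exists_half_sum
  have hf := h'.qfact_ne_zero hq hs'
  obtain ⟨m, rfl⟩ : ∃ m, l' = l + 2 * m := ⟨s' - s, by omega⟩
  have n2 : qint q 2 ≠ 0 := qint_ne_zero_of_qfact hf (by omega) (by omega)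
  have key := lam_add_sub_lam hq n2 (a := a) (b := b) (l := l) (m := m) (by omega)
  rw [hll, sub_self] at key
  exact mul_ne_zero (qint_ne_zero_of_qfact hf (by omega) (by omega))
    (qint_ne_zero_of_qfact hf (by omega) (by omega)) key.symm

/-- The three-term recurrence as an eigenvalue equation. -/
theorem threeTerm_iff {q : ℂ} {a b c d l : ℕ} {x : ℕ → ℂ} :
    ThreeTerm q a b c d l x ↔ ∀ j ∈ jSet q a b c d,
      ∑ j' ∈ jSet q a b c d, Lbar q a b c d j j' / normH q a b c d j' * x j'
        = lam q a b l * x j := by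
  refine forall₂_congr fun j hj => ?_
  have hsum : ∑ j' ∈ jSet q a b c d, Lbar q a b c d j j' / normH q a b c d j' * x j' =
      (if 2 ≤ j then Lbar q a b c d j (j - 2) / normH q a b c d (j - 2) * x (j - 2) else 0)
      + Lbar q a b c d j j / normH q a b c d j * x j
      + Lbar q a b c d j (j + 2) / normH q a b c d (j + 2) * x (j + 2) := by
    set f : ℕ → ℂ := fun j' => Lbar q a b c d j j' / normH q a b c d j' * x j' with hf
    have h0 : ∀ j', Lbar q a b c d j j' = 0 → f j' = 0 := fun j' h => by
      simp only [hf, h, zero_div, zero_mul]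
    have hout : ∀ j', j' ∉ jSet q a b c d → f j' = 0 := fun j' h =>
      h0 j' (Lbar_eq_zero fun h' => h h'.2.1)
    have htri : ∀ j', ¬(j' = j ∨ j' = j + 2 ∨ j = j' + 2) → f j' = 0 := fun j' h =>
      h0 j' (by_contra fun h' => h (Lbar_tridiagonal h'))
    have hS : ∀ S : Finset ℕ, (∀ j', (j' = j ∨ j' = j + 2 ∨ j = j' + 2) → j' ∈ S) →
        ∑ j' ∈ jSet q a b c d, f j' = ∑ j' ∈ S, f j' := fun S hS => by
      rw [Finset.sum_subset (Finset.subset_union_left (s₂ := S)) fun j' _ h => hout j' h,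
        Finset.sum_subset (Finset.subset_union_right (s₁ := jSet q a b c d) (s₂ := S))
          fun j' _ h => htri j' fun h' => h (hS j' h')]
    by_cases h2 : 2 ≤ j
    · rw [if_pos h2, hS {j - 2, j, j + 2} (by simp; omega), Finset.sum_insert (by simp; omega),
        Finset.sum_insert (by simp), Finset.sum_singleton]
      ring
    · rw [if_neg h2, hS {j, j + 2} (by simp; omega), Finset.sum_insert (by simp),
        Finset.sum_singleton]
      ring
  rw [hsum, ← sub_eq_zero (b := lam q a b l * x j)]
  constructor <;> intro h <;> linear_combination h

theorem sum_Lbar_mul_tet {q : ℂ} (hq : q ≠ 0) {a b c d j l : ℕ} (hj : j ∈ jSet q a b c d)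
    (hl : l ∈ lSet q a b c d) :
    ∑ j' ∈ jSet q a b c d, Lbar q a b c d j j' / normH q a b c d j' * tet q a b c d j' l
      = lam q a b l * tet q a b c d j l :=
  threeTerm_iff.1 (threeTerm_tet hq hl) j hj

/-- Since `L` is symmetric, its eigenvectors with different eigenvalues are orthogonal. -/
theorem sum_mul_eq_zero_of_threeTerm {q : ℂ} {a b c d l l' : ℕ} {x y : ℕ → ℂ}
    (hx : ThreeTerm q a b c d l x) (hy : ThreeTerm q a b c d l' y)
    (hne : lam q a b l ≠ lam q a b l') :
    ∑ j ∈ jSet q a b c d, x j * y j / normH q a b c d j = 0 := by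
  refine (mul_eq_zero.1 ?_).resolve_left (sub_ne_zero.2 hne)
  have h1 : lam q a b l * ∑ j ∈ jSet q a b c d, x j * y j / normH q a b c d j =
      ∑ j ∈ jSet q a b c d, ∑ j' ∈ jSet q a b c d, Lbar q a b c d j j' / normH q a b c d j'
        * x j' * (y j / normH q a b c d j) := by
    rw [Finset.mul_sum]
    refine Finset.sum_congr rfl fun j hj => ?_
    rw [← Finset.sum_mul, threeTerm_iff.1 hx j hj]
    ring
  have h2 : lam q a b l' * ∑ j ∈ jSet q a b c d, x j * y j / normH q a b c d j =
      ∑ j ∈ jSet q a b c d, ∑ j' ∈ jSet q a b c d, Lbar q a b c d j j' / normH q a b c d j'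
        * y j' * (x j / normH q a b c d j) := by
    rw [Finset.mul_sum]
    refine Finset.sum_congr rfl fun j hj => ?_
    rw [← Finset.sum_mul, threeTerm_iff.1 hy j hj]
    ring
  rw [sub_mul, h1, h2, Finset.sum_comm, ← Finset.sum_sub_distrib]
  refine Finset.sum_eq_zero fun j _ => ?_
  rw [← Finset.sum_sub_distrib]
  refine Finset.sum_eq_zero fun j' _ => ?_
  rw [Lbar_comm q a b c d j' j]
  ring

theorem sum_tet_mul_tet_of_ne {q : ℂ} (hq : q ≠ 0) {a b c d l l' : ℕ} (hl : l ∈ lSet q a b c d)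
    (hl' : l' ∈ lSet q a b c d) (hne : l ≠ l') :
    ∑ j ∈ jSet q a b c d, tet q a b c d j l * tet q a b c d j l' / normH q a b c d j = 0 :=
  sum_mul_eq_zero_of_threeTerm (threeTerm_tet hq hl) (threeTerm_tet hq hl') fun h =>
    hne (lam_injOn hq (mem_lSet.1 hl).1 (mem_lSet.1 hl').1 h)

/-- The orthogonality of the rows is that of the columns for the dual tetrahedra. -/
theorem sum_tet_mul_tet_vertical_of_ne {q : ℂ} (hq : q ≠ 0) {a b c d j j' : ℕ}
    (hj : j ∈ jSet q a b c d) (hj' : j' ∈ jSet q a b c d) (hne : j ≠ j') :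
    ∑ l ∈ lSet q a b c d, tet q a b c d j l * tet q a b c d j' l / normV q a b c d l = 0 := by
  have := sum_tet_mul_tet_of_ne hq (a := a) (b := d) (c := c) (d := b) (l := j) (l' := j')
    (by rwa [lSet_eq_jSet]) (by rwa [lSet_eq_jSet]) hne
  rw [← lSet_eq_jSet] at this
  simpa only [← tet_dual, ← normV_eq_normH] using this

/-! ### The norm of the first row -/

/-- For `j = a - d` the alternating sum of the tetrahedron has a single term. -/
theorem tet_first {q : ℂ} (hq : q ≠ 0) {a b c d j l s a₃ a₄ : ℕ} (h₁ : Admissible q a b l)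
    (h₂ : Admissible q c d l) (h₃ : Admissible q a d j) (h₄ : Admissible q c b j)
    (haj : a = j + d) (hs : 2 * s = b + c + j) (ha₃ : 2 * a₃ = a + b + l)
    (ha₄ : 2 * a₄ = c + d + l) :
    tet q a b c d j l = (-1) ^ a₃ * qfact q (a₃ + 1) * qfact q (a₄ - d) * qfact q (a₃ - b)
      * qfact q (a₃ - l) * qfact q (s - j) / (qfact q a * qfact q b * qfact q c * qfact q l) := by
  obtain ⟨⟨t1, t2, t3⟩, -⟩ := id h₁
  obtain ⟨⟨t4, t5, t6⟩, -⟩ := id h₂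
  obtain ⟨⟨s1, s2, s3⟩, -⟩ := id h₄
  have hf := h₁.qfact_ne_zero hq ha₃
  have f : ∀ n ≤ a₃ + 1, qfact q n ≠ 0 := fun n hn => qfact_ne_zero_of_le hf hn
  obtain ⟨b₂, hb₂⟩ : ∃ b₂, 2 * b₂ = a + c + j + l := ⟨(a + c + j + l) / 2, by omega⟩
  obtain ⟨b₃, hb₃⟩ : ∃ b₃, 2 * b₃ = a + b + c + d := ⟨(a + b + c + d) / 2, by omega⟩
  have g1 : a ≤ a₃ := by omega
  have g2 : s ≤ a₃ := by omega
  have g3 : a₄ ≤ a₃ := by omega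
  have g4 : a₃ ≤ b₂ := by omega
  have g5 : a₃ ≤ b₃ := by omega
  rw [tet_eq h₁ h₂ h₃ h₄ (a₁ := a) (a₂ := s) (a₃ := a₃) (a₄ := a₄) (b₁ := a₃) (b₂ := b₂)
    (b₃ := b₃) (K := b₃ + 1) (by omega) (by omega) (by omega) (by omega) (by omega)
    (by omega) (by omega) (by omega)]
  have hU : racahSum q (b₃ + 1) a s a₃ a₄ a₃ b₂ b₃ = (-1) ^ a₃ * qfact q (a₃ + 1)
      * ((qfact q (a₃ - a))⁻¹ * (qfact q (a₃ - s))⁻¹ * (qfact q (a₃ - a₄))⁻¹)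
      * ((qfact q (b₂ - a₃))⁻¹ * (qfact q (b₃ - a₃))⁻¹) := by
    rw [racahSum, Finset.sum_eq_single a₃ (fun S _ hS => racahTerm_eq_zero q (by omega))
      (fun hS => absurd (Finset.mem_range.2 (by omega)) hS)]
    unfold racahTerm
    rw [← Nat.cast_sub g1, ← Nat.cast_sub g2, ← Nat.cast_sub g3, ← Nat.cast_sub g4,
      ← Nat.cast_sub g5, sub_self, qfactInv_zero]
    simp only [qfactInv_natCast]
    ring
  rw [hU, show b₂ - a = a₄ - d by omega, show b₃ - a = s - j by omega,
    show b₂ - s = a₃ - b by omega, show b₃ - s = d by omega, show b₂ - a₄ = j by omega,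
    show b₃ - a₄ = a₃ - l by omega, Nat.sub_self, qfact_zero]
  have n1 := f (a₃ - a) (by omega)
  have n2 := f (a₃ - s) (by omega)
  have n3 := f (a₃ - a₄) (by omega)
  have n4 := f (b₂ - a₃) (by omega)
  have n5 := f (b₃ - a₃) (by omega)
  have n6 := f d (by omega)
  have n7 := f j (by omega)
  field_simp

/-- The row `j = a - d` has no zero entry. -/
theorem tet_first_ne_zero {q : ℂ} (hq : q ≠ 0) {a b c d j l : ℕ} (h₁ : Admissible q a b l)
    (h₂ : Admissible q c d l) (h₃ : Admissible q a d j) (h₄ : Admissible q c b j)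
    (haj : a = j + d) : tet q a b c d j l ≠ 0 := by
  obtain ⟨s, hs, k1, k2, k3⟩ := h₄.exists_half_sum
  obtain ⟨a₃, ha₃, m1, m2, m3⟩ := h₁.exists_half_sum
  obtain ⟨a₄, ha₄, m4, m5, m6⟩ := h₂.exists_half_sum
  rw [tet_first hq h₁ h₂ h₃ h₄ haj (s := s) (by omega) ha₃ ha₄]
  have f : ∀ n ≤ a₃ + 1, qfact q n ≠ 0 := fun n hn =>
    qfact_ne_zero_of_le (h₁.qfact_ne_zero hq ha₃) hn
  have g : ∀ n ≤ a₄ + 1, qfact q n ≠ 0 := fun n hn =>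
    qfact_ne_zero_of_le (h₂.qfact_ne_zero hq ha₄) hn
  have g' : ∀ n ≤ s + 1, qfact q n ≠ 0 := fun n hn =>
    qfact_ne_zero_of_le (h₄.qfact_ne_zero hq hs) hn
  simp [f (a₃ + 1) le_rfl, g (a₄ - d) (by omega), f (a₃ - b) (by omega), f (a₃ - l) (by omega),
    g' (s - j) (by omega), f a (by omega), f b (by omega), g c (by omega), f l (by omega)]

/-- For `d = 0` or `j = b + c` the first row has `l = c + d` as its only entry. -/
theorem sum_tet_first_of_degenerate {q : ℂ} (hq : q ≠ 0) {a b c d j : ℕ}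
    (hj : j ∈ jSet q a b c d) (haj : a = j + d) (hd : d = 0 ∨ b + c = j) :
    ∑ l ∈ lSet q a b c d, tet q a b c d j l * tet q a b c d j l / normV q a b c d l
      = normH q a b c d j := by
  obtain ⟨h₃, h₄⟩ := mem_jSet.1 hj
  obtain ⟨s, hs, k1, k2, k3⟩ := h₄.exists_half_sum
  have hf3 := h₃.qfact_ne_zero hq (s := a) (by omega)
  have hf4 := h₄.qfact_ne_zero hq hs
  have h₁ : Admissible q a b (c + d) := by
    refine admissible_of_half_sum hq (s := s + d) (by omega) (by omega) (by omega) (by omega) ?_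
    rcases hd with rfl | hd
    · exact hf4
    · rwa [show s + d = a by omega]
  have h₂ : Admissible q c d (c + d) := by
    refine admissible_of_half_sum hq (s := c + d) (by omega) (by omega) (by omega) (by omega) ?_
    exact qfact_ne_zero_of_le (h₁.qfact_ne_zero hq (s := s + d) (by omega)) (by omega)
  have hL : lSet q a b c d = {c + d} := by
    ext l
    rw [mem_lSet, Finset.mem_singleton]
    constructor
    · rintro ⟨⟨⟨t1, t2, t3⟩, -⟩, ⟨⟨t4, t5, t6⟩, -⟩⟩
      omega
    · rintro rfl
      exact ⟨h₁, h₂⟩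
  rw [hL, Finset.sum_singleton, div_eq_iff (normV_ne_zero hq (mem_lSet.2 ⟨h₁, h₂⟩)),
    tet_first hq h₁ h₂ h₃ h₄ haj (s := s) (a₃ := s + d) (a₄ := c + d) (by omega) (by omega)
      (by omega), normH, normV, theta_eq h₁ (s := s + d) (by omega),
    theta_eq h₂ (s := c + d) (by omega), theta_eq h₃ (s := a) (by omega),
    theta_eq h₄.swap (s := s) (by omega), bubble_of_ne hq (qfact_ne_zero_of_le hf4 (by omega)),
    bubble_of_ne hq (h₂.qfact_ne_zero hq (s := c + d) (by omega))]
  have f : ∀ n ≤ s + 1, qfact q n ≠ 0 := fun n hn => qfact_ne_zero_of_le hf4 hn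
  have g : ∀ n ≤ a + 1, qfact q n ≠ 0 := fun n hn => qfact_ne_zero_of_le hf3 hn
  have sgn : ∀ n : ℕ, ((-1 : ℂ) ^ n) ^ 2 = 1 := fun n => by
    rw [← pow_mul, mul_comm, pow_mul, neg_one_sq, one_pow]
  rcases hd with rfl | hd
  · obtain rfl : a = j := by omega
    have n1 := f (s - a) (by omega)
    have n2 := f (s - b) (by omega)
    have n3 := f (s - c) (by omega)
    have n4 := f a (by omega)
    have n5 := f b (by omega)
    have n6 := f c (by omega)
    have n7 := qint_ne_zero_of_qfact hf4 (k := (a : ℤ) + 1) (by omega) (by omega)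
    have n8 := qint_ne_zero_of_qfact hf4 (k := (c : ℤ) + 1) (by omega) (by omega)
    simp only [add_zero, Nat.sub_zero, Nat.sub_self, qfact_zero, qfact_succ q a, qfact_succ q c]
    field_simp
  · obtain rfl : s = j := by omega
    have e1 : s + d - b = c + d := by omega
    have n2 := f b (by omega)
    have n3 := f c (by omega)
    have n4 := g a (by omega)
    have n5 := g (c + d) (by omega)
    have n6 := f s (by omega)
    have n7 := g d (by omega)
    have n8 := qint_ne_zero_of_qfact hf4 (k := (s : ℤ) + 1) (by omega) (by omega)
    have n9 := qint_ne_zero_of_qfact hf3 (k := ((c + d : ℕ) : ℤ) + 1) (by omega) (by omega)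
    rw [e1, show s + d - (c + d) = b by omega, show c + d - d = c by omega,
      show c + d - c = d by omega, show s + d - a = 0 by omega, show a - a = 0 by omega,
      show a - d = s by omega, show a - s = d by omega, show s - b = c by omega,
      show s - c = b by omega, Nat.sub_self, Nat.sub_self, show s + d = a by omega, qfact_zero,
      qfact_succ q a, qfact_succ q s, qfact_succ q (c + d)]
    field_simp

/-- The change of the weights of the first row under `(c, d, j) ↦ (c - 1, d - 1, j + 1)`. -/
theorem weight_succ {q : ℂ} (hq : q ≠ 0) {a b c d j l s t : ℕ} (h₁ : Admissible q a b l)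
    (h₂ : Admissible q (c + 1) (d + 1) l) (h₂' : Admissible q c d l)
    (h₃ : Admissible q a (d + 1) j) (h₄ : Admissible q (c + 1) b j)
    (h₃' : Admissible q a d (j + 1)) (h₄' : Admissible q c b (j + 1))
    (haj : a = j + (d + 1)) (hs : 2 * s = b + (c + 1) + j) (ht : 2 * t = c + 1 + (d + 1) + l) :
    tet q a b (c + 1) (d + 1) j l * tet q a b (c + 1) (d + 1) j l /
        normV q a b (c + 1) (d + 1) l * (qint q (t + 1) * qint q (t - l))
      = -(qint q (s - j) ^ 2 * qint q (d + 1) / qint q (c + 1)) *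
        (tet q a b c d (j + 1) l * tet q a b c d (j + 1) l / normV q a b c d l) := by
  obtain ⟨a₃, ha₃, m1, m2, m3⟩ := h₁.exists_half_sum
  obtain ⟨⟨t4, t5, t6⟩, -⟩ := id h₂
  obtain ⟨⟨r4, r5, r6⟩, -⟩ := id h₂'
  obtain ⟨⟨s1, s2, s3⟩, -⟩ := id h₄'
  obtain ⟨γ, hγ⟩ : ∃ γ, s = j + (γ + 1) := ⟨s - j - 1, by omega⟩
  obtain ⟨u, hu⟩ : ∃ u, t = l + (u + 1) := ⟨t - l - 1, by omega⟩
  obtain ⟨v, hv⟩ : ∃ v, t = v + 1 := ⟨t - 1, by omega⟩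
  rw [tet_first hq h₁ h₂ h₃ h₄ haj hs ha₃ ht,
    tet_first hq h₁ h₂' h₃' h₄' (s := s) (a₃ := a₃) (a₄ := v) (by omega) (by omega) (by omega)
      (by omega), normV, normV, theta_eq h₂ ht, theta_eq h₂' (s := v) (by omega), hv,
    show v + 1 - (d + 1) = v - d by omega, show v + 1 - (c + 1) = v - c by omega,
    show v + 1 - l = u + 1 by omega, show v - l = u by omega, show s - j = γ + 1 by omega,
    show s - (j + 1) = γ by omega, show (s : ℤ) - j = γ + 1 by omega,
    show ((v + 1 : ℕ) : ℤ) - l = u + 1 by omega, qfact_succ q γ, qfact_succ q u,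
    qfact_succ q (v + 1), qfact_succ q c, qfact_succ q d, pow_succ (-1 : ℂ) v]
  have hf1 := h₁.qfact_ne_zero hq ha₃
  have hf2 := h₂.qfact_ne_zero hq ht
  have hf4 := h₄.qfact_ne_zero hq (s := s) (by omega)
  have θ0 := theta_ne_zero hq h₁
  have b0 := bubble_ne_zero_of_admissible hq h₁
  have f : ∀ n ≤ t + 1, qfact q n ≠ 0 := fun n hn => qfact_ne_zero_of_le hf2 hn
  have x1 := f (v + 1) (by omega)
  have x2 := f (v - d) (by omega)
  have x3 := f (v - c) (by omega)
  have x4 := f u (by omega)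
  have x5 := f c (by omega)
  have x6 := f d (by omega)
  have x7 := f l (by omega)
  have x8 := qfact_ne_zero_of_le hf1 (m := a) (by omega)
  have x9 := qfact_ne_zero_of_le hf1 (m := b) (by omega)
  have y1 := qint_ne_zero_of_qfact hf2 (k := (c : ℤ) + 1) (by omega) (by omega)
  have y2 := qint_ne_zero_of_qfact hf2 (k := (d : ℤ) + 1) (by omega) (by omega)
  have y3 := qint_ne_zero_of_qfact hf2 (k := (u : ℤ) + 1) (by omega) (by omega)
  have y4 := qint_ne_zero_of_qfact hf2 (k := ((v + 1 : ℕ) : ℤ) + 1) (by omega) (by omega)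
  have y5 := qint_ne_zero_of_qfact hf4 (k := (γ : ℤ) + 1) (by omega) (by omega)
  generalize theta q a b l = Θ at *
  generalize bubble q l = Δ at *
  generalize (-1 : ℂ) ^ a₃ * qfact q (a₃ + 1) * qfact q (v - d) = A at *
  field_simp

/-- The change of the norm `⟨j̄|j̄⟩` for `j = a - d` under `(c, d, j) ↦ (c - 1, d - 1, j + 1)`. -/
theorem normH_succ {q : ℂ} (hq : q ≠ 0) {a b c d j s : ℕ}
    (h₃ : Admissible q a (d + 1) j) (h₄ : Admissible q (c + 1) b j)
    (h₃' : Admissible q a d (j + 1)) (h₄' : Admissible q c b (j + 1))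
    (haj : a = j + (d + 1)) (hs : 2 * s = b + (c + 1) + j) :
    normH q a b c d (j + 1) = -(qint q (s - c) * qint q (c + 1) /
      (qint q (s - j) * qint q (j + 2))) * normH q a b (c + 1) (d + 1) j := by
  obtain ⟨⟨s1, s2, s3⟩, -⟩ := id h₄'
  obtain ⟨⟨t1, t2, t3⟩, -⟩ := id h₄
  obtain ⟨γ, hγ⟩ : ∃ γ, s = j + (γ + 1) := ⟨s - j - 1, by omega⟩
  obtain ⟨β, hβ⟩ : ∃ β, s = c + 1 + β := ⟨s - c - 1, by omega⟩
  have hf3 := h₃.qfact_ne_zero hq (s := a) (by omega)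
  have hf4 := h₄.qfact_ne_zero hq (s := s) (by omega)
  rw [normH, normH, theta_eq h₃ (s := a) (by omega), theta_eq h₃' (s := a) (by omega),
    theta_eq h₄.swap (s := s) (by omega), theta_eq h₄'.swap (s := s) (by omega),
    bubble_of_ne hq (j := j + 1) (qfact_ne_zero_of_le hf3 (by omega)),
    bubble_of_ne hq (j := j) (qfact_ne_zero_of_le hf3 (by omega)),
    show s - (c + 1) = β by omega, show s - c = β + 1 by omega, show s - (j + 1) = γ by omega,
    show s - j = γ + 1 by omega, show (s : ℤ) - c = β + 1 by omega,
    show (s : ℤ) - j = γ + 1 by omega, show a - a = 0 by omega, show a - (d + 1) = j by omega,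
    show a - j = d + 1 by omega, show a - d = j + 1 by omega, show a - (j + 1) = d by omega,
    qfact_succ q β, qfact_succ q γ, qfact_succ q c, qfact_succ q d, qfact_succ q j,
    show ((j + 1 : ℕ) : ℤ) + 1 = j + 2 by push_cast; ring, pow_succ (-1 : ℂ) j]
  have f : ∀ n ≤ a + 1, qfact q n ≠ 0 := fun n hn => qfact_ne_zero_of_le hf3 hn
  have g : ∀ n ≤ s + 1, qfact q n ≠ 0 := fun n hn => qfact_ne_zero_of_le hf4 hn
  have x1 := f a (by omega)
  have x2 := f d (by omega)
  have x3 := f j (by omega)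
  have x4 := g b (by omega)
  have x5 := g c (by omega)
  have x6 := g β (by omega)
  have x7 := g γ (by omega)
  have y1 := qint_ne_zero_of_qfact hf4 (k := (c : ℤ) + 1) (by omega) (by omega)
  have y2 := qint_ne_zero_of_qfact hf3 (k := (d : ℤ) + 1) (by omega) (by omega)
  have y3 := qint_ne_zero_of_qfact hf3 (k := (j : ℤ) + 1) (by omega) (by omega)
  have y4 := qint_ne_zero_of_qfact hf3 (k := (j : ℤ) + 2) (by omega) (by omega)
  have y5 := qint_ne_zero_of_qfact hf4 (k := (γ : ℤ) + 1) (by omega) (by omega)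
  generalize (-1 : ℂ) ^ s * qfact q (s + 1) * qfact q (s - b) = A at *
  field_simp

/-- The value of `λ(a,b,c+d) - ⟨j̄|L|j̄⟩/⟨j̄|j̄⟩` for `j = a - d`. -/
theorem lam_sub_Lbar_first {q : ℂ} (hq : q ≠ 0) {a b c d j s : ℕ} (hj : j ∈ jSet q a b c d)
    (haj : a = j + d) (hs : 2 * s = b + c + j) (hd : 0 < d) :
    lam q a b (c + d) - Lbar q a b c d j j / normH q a b c d j
      = qint q d * qint q (s - j) * qint q (s - c + 1) / qint q (j + 2) := by
  obtain ⟨h₃, h₄⟩ := mem_jSet.1 hj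
  have hf := h₃.qfact_ne_zero hq (s := a) (by omega)
  have n2 : qint q 2 ≠ 0 := qint_ne_zero_of_qfact hf (by omega) (by omega)
  have nj2 : qint q (j + 2) ≠ 0 := qint_ne_zero_of_qfact hf (by omega) (by omega)
  have nN := normH_ne_zero hq hj
  have key := lamNum_sub_lamNum_first hq (s - b) (s - c) (s - j) d
  rw [show (s : ℤ) - b + (s - c) + 2 = j + 2 by omega,
    show (s : ℤ) - b + (s - c) + (s - j) + d = (s + d : ℕ) by push_cast; omega,
    show (s : ℤ) - b + (s - c) + d + 2 = a + 2 by omega,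
    show (s : ℤ) - b + (s - c) + (s - j) = s by omega] at key
  rw [lam_eq q (s := s + d) (by omega : 2 * (s + d) = a + b + (c + d)),
    show ((s + d : ℕ) : ℤ) - a = s - j by omega, show ((s + d : ℕ) : ℤ) - b = s - b + d by omega,
    show ((s + d : ℕ) : ℤ) - (c + d : ℕ) = s - c by omega]
  by_cases hj0 : j = 0
  · obtain ⟨⟨t1, t2, t3⟩, -⟩ := id h₄
    rw [Lbar_self_eq_zero hq (Or.inl hj0), zero_div, sub_zero, div_eq_div_iff n2 nj2]
    have hz : lamNum q s (s - b) (s - j) (s - c) = 0 := by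
      rw [lamNum, show (s : ℤ) - b = 0 by omega, show (s : ℤ) - c = 0 by omega, qint_zero]
      ring
    rw [hz] at key
    linear_combination key
  · have nj : qint q j ≠ 0 := qint_ne_zero_of_qfact hf (by omega) (by omega)
    have l1 : lam q a j d = -(qint q j * qint q (a + 2)) / qint q 2 := by
      rw [lam_eq q (s := a) (by omega), lamNum, sub_self, qint_zero,
        show (a : ℤ) - d = j by omega]
      ring
    rw [Lbar_self hq hj hj0 nj2, l1, lam_eq q (s := s) (by omega : 2 * s = b + j + c)]
    field_simp
    linear_combination key

/-- The normalization of the first row, `j = a - d`.  Let `w(l) = Tet² / ⟨l|l⟩` be its weights.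
The recurrence and the orthogonality of the first two rows give `∑ w(l) λ(a,b,l) = μ ∑ w(l)`, where
`μ = ⟨j̄|L|j̄⟩/⟨j̄|j̄⟩`.  Up to a constant, `λ(a,b,c+d) - λ(a,b,l)` is the factor by which the weights
change under `(c, d, j) ↦ (c - 1, d - 1, j + 1)`, so the claim follows from the one for the smaller
labels. -/
theorem sum_tet_first {q : ℂ} (hq : q ≠ 0) (d : ℕ) : ∀ {a b c j : ℕ},
    j ∈ jSet q a b c d → a = j + d →
    ∑ l ∈ lSet q a b c d, tet q a b c d j l * tet q a b c d j l / normV q a b c d l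
      = normH q a b c d j := by
  induction d with
  | zero => exact fun hj haj => sum_tet_first_of_degenerate hq hj haj (Or.inl rfl)
  | succ d ih =>
    intro a b c j hj haj
    by_cases hbc : b + c = j
    · exact sum_tet_first_of_degenerate hq hj haj (Or.inr hbc)
    obtain ⟨h₃, h₄⟩ := mem_jSet.1 hj
    obtain ⟨s, hs, k1, k2, k3⟩ := h₄.exists_half_sum
    obtain ⟨c, rfl⟩ : ∃ c', c = c' + 1 := ⟨c - 1, by omega⟩
    have hf3 := h₃.qfact_ne_zero hq (s := a) (by omega)
    have hf4 := h₄.qfact_ne_zero hq hs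
    have h₃' : Admissible q a d (j + 1) :=
      admissible_of_half_sum hq (s := a) (by omega) (by omega) (by omega) (by omega) hf3
    have h₄' : Admissible q c b (j + 1) :=
      admissible_of_half_sum hq (s := s) (by omega) (by omega) (by omega) (by omega) hf4
    have ih' := ih (mem_jSet.2 ⟨h₃', h₄'⟩) (by omega)
    set w : ℕ → ℂ := fun l => tet q a b (c + 1) (d + 1) j l * tet q a b (c + 1) (d + 1) j l /
      normV q a b (c + 1) (d + 1) l with hw
    have n2 : qint q 2 ≠ 0 := qint_ne_zero_of_qfact hf3 (by omega) (by omega)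
    have nj2 : qint q (j + 2) ≠ 0 := qint_ne_zero_of_qfact hf3 (by omega) (by omega)
    have nc : qint q (c + 1) ≠ 0 := qint_ne_zero_of_qfact hf4 (by omega) (by omega)
    have nd : qint q (d + 1) ≠ 0 := qint_ne_zero_of_qfact hf3 (by omega) (by omega)
    have nγ : qint q (s - j) ≠ 0 := qint_ne_zero_of_qfact hf4 (by omega) (by omega)
    have nβ : qint q (s - c) ≠ 0 := qint_ne_zero_of_qfact hf4 (by omega) (by omega)
    -- the weighted sum of the factors `λ(a,b,c+d) - λ(a,b,l)`
    have e1 : ∑ l ∈ lSet q a b (c + 1) (d + 1), w l * (lam q a b (c + 1 + (d + 1)) - lam q a b l)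
        = -(qint q (s - j) ^ 2 * qint q (d + 1) / qint q (c + 1)) * normH q a b c d (j + 1) := by
      rw [← ih', Finset.mul_sum]
      have hsub : lSet q a b c d ⊆ lSet q a b (c + 1) (d + 1) := by
        intro l hl
        obtain ⟨h₁, h₂⟩ := mem_lSet.1 hl
        obtain ⟨a₃, ha₃, m1, m2, m3⟩ := h₁.exists_half_sum
        obtain ⟨t, ht, m4, m5, m6⟩ := h₂.exists_half_sum
        refine mem_lSet.2 ⟨h₁, admissible_of_half_sum hq (s := t + 1) (by omega) (by omega)
          (by omega) (by omega) ?_⟩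
        exact qfact_ne_zero_of_le (h₁.qfact_ne_zero hq ha₃) (by omega)
      rw [← Finset.sum_subset hsub]
      · refine Finset.sum_congr rfl fun l hl => ?_
        obtain ⟨h₁, h₂⟩ := mem_lSet.1 hl
        obtain ⟨t, ht, m4, m5, m6⟩ := (mem_lSet.1 (hsub hl)).2.exists_half_sum
        obtain ⟨m, hm⟩ : ∃ m, t = l + m := ⟨t - l, by omega⟩
        have hpar := h₁.2.1
        rw [Nat.even_iff] at hpar
        rw [← weight_succ hq h₁ (mem_lSet.1 (hsub hl)).2 h₂ h₃ h₄ h₃' h₄' haj (s := s) (t := t)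
          (by omega) (by omega), show c + 1 + (d + 1) = l + 2 * m by omega,
          lam_add_sub_lam hq n2 hpar, hm]
        push_cast
        rw [add_sub_cancel_left]
      -- only the label `l = c + d` is lost, and there the factor vanishes
      · intro l hl hl'
        obtain ⟨h₁, h₂⟩ := mem_lSet.1 hl
        obtain ⟨t, ht, m4, m5, m6⟩ := h₂.exists_half_sum
        obtain rfl : l = c + 1 + (d + 1) := by
          by_contra hne
          refine hl' (mem_lSet.2 ⟨h₁, admissible_of_half_sum hq (s := t - 1) (by omega) ?_ ?_ ?_
            (qfact_ne_zero_of_le (h₂.qfact_ne_zero hq ht) (by omega))⟩)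
          · obtain ⟨⟨r1, r2, r3⟩, -⟩ := h₁
            omega
          · obtain ⟨⟨r1, r2, r3⟩, -⟩ := h₁
            omega
          · omega
        rw [sub_self, mul_zero]
    have e2 : ∑ l ∈ lSet q a b (c + 1) (d + 1), w l * lam q a b l
        = Lbar q a b (c + 1) (d + 1) j j / normH q a b (c + 1) (d + 1) j *
          ∑ l ∈ lSet q a b (c + 1) (d + 1), w l := by
      have : ∀ l ∈ lSet q a b (c + 1) (d + 1), w l * lam q a b l =
          ∑ j' ∈ jSet q a b (c + 1) (d + 1), Lbar q a b (c + 1) (d + 1) j j' /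
            normH q a b (c + 1) (d + 1) j' * (tet q a b (c + 1) (d + 1) j' l *
              tet q a b (c + 1) (d + 1) j l / normV q a b (c + 1) (d + 1) l) := fun l hl => by
        have := sum_Lbar_mul_tet hq hj hl
        simp only [hw]
        rw [show ∀ T M x : ℂ, T * T / M * x = x * T * (T / M) from fun T M x => by ring, ← this,
          Finset.sum_mul]
        exact Finset.sum_congr rfl fun j' _ => by ring
      rw [Finset.sum_congr rfl this, Finset.sum_comm, Finset.sum_eq_single j]
      · rw [← Finset.mul_sum]
      · intro j' hj' hne
        rw [← Finset.mul_sum, sum_tet_mul_tet_vertical_of_ne hq hj' hj hne, mul_zero]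
      · exact fun h => absurd hj h
    have e3 := lam_sub_Lbar_first hq hj haj (s := s) (by omega) (Nat.succ_pos d)
    simp only [mul_sub] at e1
    rw [Finset.sum_sub_distrib, e2, ← Finset.sum_mul, mul_comm (∑ l ∈ _, w l), ← sub_mul, e3,
      normH_succ hq h₃ h₄ h₃' h₄' haj (s := s) (by omega)] at e1
    push_cast at e1
    rw [show (s : ℤ) - (c + 1) + 1 = s - c by ring] at e1
    have nρ : qint q (d + 1) * qint q (s - j) * qint q (s - c) / qint q (j + 2) ≠ 0 :=
      div_ne_zero (mul_ne_zero (mul_ne_zero nd nγ) nβ) nj2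
    apply mul_left_cancel₀ nρ
    rw [e1]
    field_simp

/-- Some row of the recoupling matrix has no zero entry and the right norm. -/
theorem exists_normalized_row {q : ℂ} (hq : q ≠ 0) {a b c d : ℕ}
    (hL : (lSet q a b c d).Nonempty) :
    ∃ j ∈ jSet q a b c d, (∀ l ∈ lSet q a b c d, tet q a b c d j l ≠ 0) ∧
      ∑ l ∈ lSet q a b c d, tet q a b c d j l * tet q a b c d j l / normV q a b c d l
        = normH q a b c d j := by
  have hJ₁ : ∀ a b c d : ℕ, jSet q b a d c = jSet q a b c d := fun a b c d => by
    ext j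
    rw [mem_jSet, mem_jSet, admissible_swap (a := b), admissible_swap (a := d), and_comm]
  have hL₁ : ∀ a b c d : ℕ, lSet q b a d c = lSet q a b c d := fun a b c d => by
    ext j
    rw [mem_lSet, mem_lSet, admissible_swap (a := b), admissible_swap (a := d)]
  have hH₁ : ∀ a b c d j : ℕ, normH q b a d c j = normH q a b c d j := fun a b c d j => by
    rw [normH, normH, mul_comm]
  have hV₁ : ∀ a b c d j : ℕ, normV q b a d c j = normV q a b c d j := fun a b c d j => by
    rw [normV, normV, theta_swap q b a, theta_swap q d c]
  have hJ₂ : ∀ a b c d : ℕ, jSet q d c b a = jSet q a b c d := fun a b c d => by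
    ext j
    rw [mem_jSet, mem_jSet, admissible_swap (a := d), admissible_swap (a := b)]
  have hL₂ : ∀ a b c d : ℕ, lSet q d c b a = lSet q a b c d := fun a b c d => by
    ext j
    rw [mem_lSet, mem_lSet, admissible_swap (a := d), admissible_swap (a := b), and_comm]
  have hH₂ : ∀ a b c d j : ℕ, normH q d c b a j = normH q a b c d j := fun a b c d j => by
    rw [normH, normH, theta_swap q d a, theta_swap q c b]
  have hV₂ : ∀ a b c d j : ℕ, normV q d c b a j = normV q a b c d j := fun a b c d j => by
    rw [normV, normV, theta_swap q d c, theta_swap q b a, mul_comm]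
  -- By the symmetries of the tetrahedron, `a - d` may be taken to be the smallest label `j`.
  wlog h₁ : (a : ℤ) - d ≥ |(b : ℤ) - c| generalizing a b c d
  · by_cases h₂ : (d : ℤ) - a ≥ |(b : ℤ) - c|
    · have := this (a := d) (b := c) (c := b) (d := a) (by rwa [hL₂]) (by rwa [abs_sub_comm])
      simpa only [hJ₂, hL₂, hH₂, hV₂, ← tet_symm₂] using this
    by_cases h₃ : (b : ℤ) - c ≥ |(a : ℤ) - d|
    · have := this (a := b) (b := a) (c := d) (d := c) (by rwa [hL₁]) h₃
      simpa only [hJ₁, hL₁, hH₁, hV₁, ← tet_symm₁] using this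
    · have := this (a := c) (b := d) (c := a) (d := b) (by rwa [hL₁, hL₂]) (by
        rcases abs_cases ((b : ℤ) - c) with h | h <;> rcases abs_cases ((a : ℤ) - d) with h' | h' <;>
        rcases abs_cases ((d : ℤ) - a) with h'' | h'' <;> omega)
      have ht : ∀ j l, tet q c d a b j l = tet q a b c d j l := fun j l => by
        rw [tet_symm₁, tet_symm₂]
      have hJ : jSet q c d a b = jSet q a b c d := by rw [hJ₁, hJ₂]
      have hL' : lSet q c d a b = lSet q a b c d := by rw [hL₁, hL₂]
      have hH : ∀ j, normH q c d a b j = normH q a b c d j := fun j => by rw [hH₁, hH₂]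
      have hV : ∀ j, normV q c d a b j = normV q a b c d j := fun j => by rw [hV₁, hV₂]
      simpa only [ht, hJ, hL', hH, hV] using this
  obtain ⟨l, hl⟩ := hL
  obtain ⟨g₁, g₂⟩ := mem_lSet.1 hl
  obtain ⟨a₃, ha₃, m1, m2, m3⟩ := g₁.exists_half_sum
  obtain ⟨a₄, ha₄, m4, m5, m6⟩ := g₂.exists_half_sum
  have hf := g₁.qfact_ne_zero hq ha₃
  obtain ⟨h1, h2⟩ := abs_le.1 h₁
  obtain ⟨j, haj⟩ : ∃ j, a = j + d := ⟨a - d, by omega⟩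
  obtain ⟨s, hs⟩ : ∃ s, 2 * s = c + b + j := ⟨(c + b + j) / 2, by omega⟩
  have hj : j ∈ jSet q a b c d := mem_jSet.2
    ⟨admissible_of_half_sum hq (s := a) (by omega) (by omega) (by omega) (by omega)
      (qfact_ne_zero_of_le hf (by omega)),
    admissible_of_half_sum hq (s := s) (by omega) (by omega) (by omega) (by omega)
      (qfact_ne_zero_of_le hf (by omega))⟩
  refine ⟨j, hj, fun l hl => ?_, sum_tet_first hq d hj haj⟩
  obtain ⟨h₁, h₂⟩ := mem_lSet.1 hl
  obtain ⟨h₃, h₄⟩ := mem_jSet.1 hj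
  exact tet_first_ne_zero hq h₁ h₂ h₃ h₄ haj

/-- The orthogonality of the `6j`-symbols.  Both families of orthogonality relations give
`Eⱼ/Nⱼ · Tⱼₗ = Dₗ/Mₗ · Tⱼₗ`, where `Dₗ` and `Eⱼ` are the norms of the columns and rows of the matrix
`T` of tetrahedra, `Mₗ` and `Nⱼ` their expected values.  A single normalized row without zeros then
settles all columns. -/
theorem sum_tet_mul_tet {q : ℂ} (hq : q ≠ 0) {a b c d l l' : ℕ} (hl : l ∈ lSet q a b c d)
    (hl' : l' ∈ lSet q a b c d) :
    ∑ j ∈ jSet q a b c d, tet q a b c d j l * tet q a b c d j l' / normH q a b c d j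
      = if l = l' then normV q a b c d l else 0 := by
  split_ifs with h
  swap
  · exact sum_tet_mul_tet_of_ne hq hl hl' h
  subst h
  obtain ⟨j, hj, hne, hrow⟩ := exists_normalized_row hq ⟨l, hl⟩
  have nN := normH_ne_zero hq hj
  have nM := normV_ne_zero hq hl
  -- the triple product `T M⁻¹ Tᵗ N⁻¹ T`, summed in both orders
  have e1 : ∑ m ∈ lSet q a b c d, ∑ i ∈ jSet q a b c d, tet q a b c d j m / normV q a b c d m *
      (tet q a b c d i m * tet q a b c d i l / normH q a b c d i) =
      tet q a b c d j l / normV q a b c d l * ∑ i ∈ jSet q a b c d,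
        tet q a b c d i l * tet q a b c d i l / normH q a b c d i := by
    simp only [← Finset.mul_sum]
    refine Finset.sum_eq_single l (fun m hm hml => ?_) fun h => absurd hl h
    rw [sum_tet_mul_tet_of_ne hq hm hl hml, mul_zero]
  have e2 : ∑ m ∈ lSet q a b c d, ∑ i ∈ jSet q a b c d, tet q a b c d j m / normV q a b c d m *
      (tet q a b c d i m * tet q a b c d i l / normH q a b c d i) = tet q a b c d j l := by
    rw [Finset.sum_comm]
    have : ∀ i ∈ jSet q a b c d, ∑ m ∈ lSet q a b c d, tet q a b c d j m / normV q a b c d m *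
        (tet q a b c d i m * tet q a b c d i l / normH q a b c d i) =
        tet q a b c d i l / normH q a b c d i * ∑ m ∈ lSet q a b c d,
          tet q a b c d j m * tet q a b c d i m / normV q a b c d m := fun i _ => by
      rw [Finset.mul_sum]
      exact Finset.sum_congr rfl fun m _ => by ring
    rw [Finset.sum_congr rfl this, Finset.sum_eq_single j]
    · rw [hrow]
      field_simp
    · intro i hi hij
      rw [sum_tet_mul_tet_vertical_of_ne hq hj hi (Ne.symm hij), mul_zero]
    · exact fun h => absurd hj h
  rw [e1, div_mul_eq_mul_div, div_eq_iff nM] at e2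
  exact mul_left_cancel₀ (hne l hl) e2

theorem sum_tet_mul_tet_vertical {q : ℂ} (hq : q ≠ 0) {a b c d j j' : ℕ}
    (hj : j ∈ jSet q a b c d) (hj' : j' ∈ jSet q a b c d) :
    ∑ l ∈ lSet q a b c d, tet q a b c d j l * tet q a b c d j' l / normV q a b c d l
      = if j = j' then normH q a b c d j else 0 := by
  have := sum_tet_mul_tet hq (a := a) (b := d) (c := c) (d := b) (l := j) (l' := j')
    (by rwa [lSet_eq_jSet]) (by rwa [lSet_eq_jSet])
  rw [← lSet_eq_jSet, normV_eq_normH] at this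
  simpa only [← tet_dual, ← normV_eq_normH] using this

/-! ### The space of four-valent networks -/

theorem braket_apply (q : ℂ) (a b c d : ℕ) (x y : Net q a b c d) :
    braket q a b c d x y = ∑ j : jSet q a b c d, normH q a b c d j * (x j * y j) := by
  rw [braket, Matrix.toBilin'_apply']
  simp only [dotProduct, Matrix.mulVec_diagonal]
  exact Finset.sum_congr rfl fun j _ => by ring

theorem opL_apply (q : ℂ) (a b c d : ℕ) (x : Net q a b c d) (j : jSet q a b c d) :
    opL q a b c d x j =
      ∑ j' : jSet q a b c d, Lbar q a b c d j j' / normH q a b c d j * x j' := by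
  rw [opL, Matrix.toLin'_apply]
  rfl

theorem ketV_apply (q : ℂ) (a b c d l : ℕ) (j : jSet q a b c d) :
    ketV q a b c d l j = tet q a b c d j l / normH q a b c d j := by
  rw [ketV, Finset.sum_apply, Finset.sum_eq_single j]
  · rw [ketH, Pi.smul_apply, Pi.single_eq_same, smul_eq_mul, mul_one, sixj, normH,
      div_div_eq_mul_div, mul_comm (theta q b c j), div_mul_eq_mul_div]
  · intro i _ hij
    rw [ketH, Pi.smul_apply, Pi.single_eq_of_ne (Ne.symm hij), smul_zero]
  · exact fun h => absurd (Finset.mem_univ j) h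

theorem braket_comm (q : ℂ) (a b c d : ℕ) (x y : Net q a b c d) :
    braket q a b c d x y = braket q a b c d y x := by
  simp only [braket_apply, mul_comm (x _)]

theorem braket_ketH_left (q : ℂ) (a b c d : ℕ) (j : jSet q a b c d) (y : Net q a b c d) :
    braket q a b c d (ketH q a b c d j) y = normH q a b c d j * y j := by
  rw [braket_apply, Finset.sum_eq_single j]
  · rw [ketH, Pi.single_eq_same, one_mul]
  · intro i _ hij
    rw [ketH, Pi.single_eq_of_ne hij, zero_mul, mul_zero]
  · exact fun h => absurd (Finset.mem_univ j) h

theorem braket_ketV_ketV {q : ℂ} (hq : q ≠ 0) {a b c d l l' : ℕ} (hl : l ∈ lSet q a b c d)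
    (hl' : l' ∈ lSet q a b c d) :
    braket q a b c d (ketV q a b c d l) (ketV q a b c d l')
      = if l = l' then normV q a b c d l else 0 := by
  rw [← sum_tet_mul_tet hq hl hl', braket_apply, ← Finset.sum_coe_sort (jSet q a b c d)]
  refine Finset.sum_congr rfl fun j _ => ?_
  have := normH_ne_zero hq j.2
  rw [ketV_apply, ketV_apply]
  field_simp

theorem ketV_ne_zero {q : ℂ} (hq : q ≠ 0) {a b c d l : ℕ} (hl : l ∈ lSet q a b c d) :
    ketV q a b c d l ≠ 0 := by
  intro h
  have := braket_ketV_ketV hq hl hl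
  rw [if_pos rfl, h, map_zero] at this
  exact normV_ne_zero hq hl this.symm

theorem opL_ketV {q : ℂ} (hq : q ≠ 0) {a b c d l : ℕ} (hl : l ∈ lSet q a b c d) :
    opL q a b c d (ketV q a b c d l) = lam q a b l • ketV q a b c d l := by
  funext j
  rw [opL_apply, Pi.smul_apply, smul_eq_mul, ketV_apply, ← mul_div_assoc,
    ← sum_Lbar_mul_tet hq j.2 hl, ← Finset.sum_coe_sort (jSet q a b c d), Finset.sum_div]
  refine Finset.sum_congr rfl fun j' _ => ?_
  rw [ketV_apply]
  ring

theorem braket_ketV_opL_ketV {q : ℂ} (hq : q ≠ 0) {a b c d l l' : ℕ} (hl : l ∈ lSet q a b c d)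
    (hl' : l' ∈ lSet q a b c d) :
    braket q a b c d (ketV q a b c d l) (opL q a b c d (ketV q a b c d l'))
      = lam q a b l * braket q a b c d (ketV q a b c d l) (ketV q a b c d l') := by
  rw [opL_ketV hq hl', map_smul, smul_eq_mul, braket_ketV_ketV hq hl hl']
  split_ifs with h
  · rw [h]
  · rw [mul_zero, mul_zero]

theorem lam_mul_normV {q : ℂ} (hq : q ≠ 0) {a b c d l : ℕ} (hl : l ∈ lSet q a b c d) :
    lam q a b l * normV q a b c d l
      = qint q a * qint q b / bubble q l * theta q c d l * tet q a a b b l 2 := by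
  obtain ⟨h₁, h₂⟩ := mem_lSet.1 hl
  rcases Nat.eq_zero_or_pos a with ha | ha
  · rw [lam_eq_zero_of_zero_left h₁ ha, ha, Nat.cast_zero, qint_zero]
    ring
  rcases Nat.eq_zero_or_pos b with hb | hb
  · rw [lam_eq_zero_of_zero_right h₁ hb, hb, Nat.cast_zero, qint_zero]
    ring
  obtain ⟨s, hs, h1, h2, h3⟩ := h₁.exists_half_sum
  have hf := h₁.qfact_ne_zero hq hs
  have na : qint q a ≠ 0 := qint_ne_zero_of_qfact hf (by omega) (by omega)
  have nb : qint q b ≠ 0 := qint_ne_zero_of_qfact hf (by omega) (by omega)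
  rw [tet_vertical_two hq ha hb h₁, normV]
  field_simp

theorem ketH_eq_sum_ketV {q : ℂ} (hq : q ≠ 0) {a b c d : ℕ} (j : jSet q a b c d) :
    ketH q a b c d j = ∑ l ∈ lSet q a b c d,
      (tet q a b c d j l / normV q a b c d l) • ketV q a b c d l := by
  funext i
  have nN := normH_ne_zero hq i.2
  have key := sum_tet_mul_tet_vertical hq j.2 i.2
  have h : ∑ l ∈ lSet q a b c d, tet q a b c d j l / normV q a b c d l *
      (tet q a b c d i l / normH q a b c d i) =
      (∑ l ∈ lSet q a b c d, tet q a b c d j l * tet q a b c d i l / normV q a b c d l)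
        / normH q a b c d i := by
    rw [Finset.sum_div]
    exact Finset.sum_congr rfl fun l _ => by ring
  simp only [Finset.sum_apply, Pi.smul_apply, ketV_apply, smul_eq_mul]
  rw [h, key, ketH]
  by_cases hij : j = i
  · subst hij
    rw [Pi.single_eq_same, if_pos rfl, div_self nN]
  · rw [Pi.single_eq_of_ne (Ne.symm hij), if_neg fun h => hij (Subtype.ext h), zero_div]

/-- The solutions of the three-term recurrence are the multiples of a column of tetrahedra. -/
theorem ThreeTerm.eq_mul_tet {q : ℂ} (hq : q ≠ 0) {a b c d l : ℕ} (hl : l ∈ lSet q a b c d)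
    {x : ℕ → ℂ} (hx : ThreeTerm q a b c d l x) :
    ∃ k : ℂ, ∀ j ∈ jSet q a b c d, x j = k * tet q a b c d j l := by
  refine ⟨(∑ j ∈ jSet q a b c d, x j * tet q a b c d j l / normH q a b c d j)
    / normV q a b c d l, fun j hj => ?_⟩
  have nN := normH_ne_zero hq hj
  have e1 : ∑ i ∈ jSet q a b c d, x i / normH q a b c d i * ∑ m ∈ lSet q a b c d,
      tet q a b c d i m * tet q a b c d j m / normV q a b c d m = x j := by
    rw [Finset.sum_eq_single j]
    · rw [sum_tet_mul_tet_vertical hq hj hj, if_pos rfl, div_mul_cancel₀ _ nN]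
    · intro i hi hij
      rw [sum_tet_mul_tet_vertical hq hi hj, if_neg hij, mul_zero]
    · exact fun h => absurd hj h
  have e2 : ∑ i ∈ jSet q a b c d, x i / normH q a b c d i * ∑ m ∈ lSet q a b c d,
      tet q a b c d i m * tet q a b c d j m / normV q a b c d m =
      ∑ m ∈ lSet q a b c d, tet q a b c d j m / normV q a b c d m *
        ∑ i ∈ jSet q a b c d, x i * tet q a b c d i m / normH q a b c d i := by
    simp only [Finset.mul_sum]
    rw [Finset.sum_comm]
    exact Finset.sum_congr rfl fun m _ => Finset.sum_congr rfl fun i _ => by ring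
  rw [← e1, e2, Finset.sum_eq_single l]
  · ring
  · intro m hm hml
    rw [sum_mul_eq_zero_of_threeTerm hx (threeTerm_tet hq hm) fun h =>
      hml (lam_injOn hq (mem_lSet.1 hm).1 (mem_lSet.1 hl).1 h.symm), mul_zero]
  · exact fun h => absurd hl h

theorem braket_opL_left (q : ℂ) (hq : q ≠ 0) (a b c d : ℕ) (x y : Net q a b c d) :
    braket q a b c d (opL q a b c d x) y = ∑ j : jSet q a b c d, ∑ j' : jSet q a b c d,
      Lbar q a b c d j j' * x j' * y j := by
  rw [braket_apply]
  refine Finset.sum_congr rfl fun j _ => ?_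
  have := normH_ne_zero hq j.2
  rw [opL_apply, Finset.sum_mul, Finset.mul_sum]
  refine Finset.sum_congr rfl fun j' _ => ?_
  field_simp

theorem braket_opL_comm {q : ℂ} (hq : q ≠ 0) (a b c d : ℕ) (x y : Net q a b c d) :
    braket q a b c d (opL q a b c d x) y = braket q a b c d x (opL q a b c d y) := by
  rw [braket_comm q a b c d x, braket_opL_left q hq, braket_opL_left q hq, Finset.sum_comm]
  refine Finset.sum_congr rfl fun j _ => Finset.sum_congr rfl fun j' _ => ?_
  rw [Lbar_comm]
  ring

theorem braket_nondegenerate {q : ℂ} (hq : q ≠ 0) (a b c d : ℕ) :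
    (braket q a b c d).Nondegenerate := by
  have h : (braket q a b c d).SeparatingRight := fun y hy => by
    funext j
    have := hy (ketH q a b c d j)
    rw [braket_ketH_left] at this
    exact (mul_eq_zero.1 this).resolve_left (normH_ne_zero hq j.2)
  refine ⟨fun x hx => h x fun y => ?_, h⟩
  rw [braket_comm]
  exact hx y

theorem linearIndependent_ketV {q : ℂ} (hq : q ≠ 0) (a b c d : ℕ) :
    LinearIndependent ℂ (fun l : lSet q a b c d => ketV q a b c d l) := by
  refine LinearMap.linearIndependent_of_isOrthoᵢ (B := braket q a b c d) ?_ ?_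
  · intro l l' hll
    have := braket_ketV_ketV hq l.2 l'.2
    rwa [if_neg fun h => hll (Subtype.ext h)] at this
  · intro l h
    have := braket_ketV_ketV hq l.2 l.2
    rw [if_pos rfl] at this
    exact normV_ne_zero hq l.2 (this.symm.trans h)

theorem span_ketV {q : ℂ} (hq : q ≠ 0) (a b c d : ℕ) :
    Submodule.span ℂ (Set.range fun l : lSet q a b c d => ketV q a b c d l) = ⊤ := by
  rw [eq_top_iff]
  intro x _
  have hx : x = ∑ j : jSet q a b c d, x j • ketH q a b c d j := by
    funext i
    simp [ketH, Finset.sum_apply, Pi.single_apply]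
  rw [hx]
  refine Submodule.sum_mem _ fun j _ => Submodule.smul_mem _ _ ?_
  rw [ketH_eq_sum_ketV hq j]
  exact Submodule.sum_mem _ fun l hl => Submodule.smul_mem _ _
    (Submodule.subset_span ⟨⟨l, hl⟩, rfl⟩)

end TetNet

theorem mainTheorem1 (q : ℂ) (hq : q ≠ 0) (a b c d : ℕ) :
    -- the form, the horizontal basis and the vertical basis
    ((braket q a b c d).IsSymm ∧ (braket q a b c d).Nondegenerate ∧
      (∀ j j' : jSet q a b c d, braket q a b c d (ketH q a b c d j) (ketH q a b c d j') =
        if j = j' then normH q a b c d j else 0) ∧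
      (∀ l ∈ lSet q a b c d, ∀ l' ∈ lSet q a b c d,
        braket q a b c d (ketV q a b c d l) (ketV q a b c d l') =
          if l = l' then normV q a b c d l else 0) ∧
      (∀ l ∈ lSet q a b c d, normV q a b c d l ≠ 0) ∧
      LinearIndependent ℂ (fun l : lSet q a b c d => ketV q a b c d l) ∧
      Submodule.span ℂ (Set.range fun l : lSet q a b c d => ketV q a b c d l) = ⊤ ∧
      (∀ j : jSet q a b c d, ∀ l ∈ lSet q a b c d,
        braket q a b c d (ketH q a b c d j) (ketV q a b c d l) = tet q a b c d j l)) ∧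
    -- `L` is symmetric, and diagonal in the vertical basis
    ((∀ x y : Net q a b c d,
        braket q a b c d (opL q a b c d x) y = braket q a b c d x (opL q a b c d y)) ∧
      (∀ l ∈ lSet q a b c d, ∀ l' ∈ lSet q a b c d,
        braket q a b c d (ketV q a b c d l) (opL q a b c d (ketV q a b c d l')) =
          (if l = l' then qint q a * qint q b / bubble q l * theta q c d l * tet q a a b b l 2
            else 0) ∧
        braket q a b c d (ketV q a b c d l) (opL q a b c d (ketV q a b c d l')) =
          lam q a b l * braket q a b c d (ketV q a b c d l) (ketV q a b c d l')) ∧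
      (∀ l ∈ lSet q a b c d,
        Module.End.HasEigenvector (opL q a b c d) (lam q a b l) (ketV q a b c d l))) ∧
    -- the matrix elements of `L` in the horizontal basis: symmetric, tridiagonal, explicit
    ((∀ j j' : jSet q a b c d,
        braket q a b c d (ketH q a b c d j) (opL q a b c d (ketH q a b c d j')) =
          Lbar q a b c d j j') ∧
      (∀ j j' : ℕ, Lbar q a b c d j j' = Lbar q a b c d j' j) ∧
      (∀ j j' : ℕ, Lbar q a b c d j j' ≠ 0 → j' = j ∨ j' = j + 2 ∨ j = j' + 2) ∧
      (∀ j ∈ jSet q a b c d, j ≠ 0 → qint q ((j : ℤ) + 2) ≠ 0 →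
        Lbar q a b c d j j =
          -(normH q a b c d j * (qint q 2 * lam q a j d * lam q b j c) /
            (qint q j * qint q ((j : ℤ) + 2)))) ∧
      (∀ j ∈ jSet q a b c d, j = 0 ∨ qint q ((j : ℤ) + 2) = 0 → Lbar q a b c d j j = 0) ∧
      (∀ j ∈ jSet q a b c d, j + 2 ∈ jSet q a b c d →
        Lbar q a b c d j (j + 2) =
          normH q a b c d (j + 2) * qint q (((a : ℤ) + d - j) / 2)
            * qint q (((b : ℤ) + c - j) / 2))) ∧
    -- the network evaluations (for arbitrary labels)
    ((∀ x y l : ℕ, 0 < x → 0 < y → Admissible q x y l →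
        tet q x x y y l 2 = theta q x y l / (qint q x * qint q y) * lam q x y l) ∧
      (∀ x y j : ℕ, 0 < x → Admissible q x y j →
        tet q x x j (j + 2) y 2 =
          1 / qint q x * qint q (((x : ℤ) + y - j) / 2) * theta q x y (j + 2) ∧
        tet q x x (j + 2) j y 2 =
          1 / qint q x * qint q (((x : ℤ) + y - j) / 2) * theta q x y (j + 2)) ∧
      (∀ j : ℕ, 0 < j → qint q 2 * qint q j ≠ 0 →
        theta q j j 2 = -(qint q ((j : ℤ) + 2) / (qint q 2 * qint q j)) * bubble q j) ∧
      (∀ j : ℕ, theta q j (j + 2) 2 = bubble q (j + 2))) ∧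
    -- the eigenvalue problem, the three-term recurrence and the normalization
    (∀ l ∈ lSet q a b c d,
      (∀ j ∈ jSet q a b c d,
        ∑ j' ∈ jSet q a b c d,
          (Lbar q a b c d j j' - lam q a b l * (if j = j' then normH q a b c d j' else 0))
            * (tet q a b c d j' l / normH q a b c d j') = 0) ∧
      ThreeTerm q a b c d l (fun j => tet q a b c d j l) ∧
      ∑ j ∈ jSet q a b c d, tet q a b c d j l * tet q a b c d j l / normH q a b c d j
        = normV q a b c d l ∧
      ∀ x : ℕ → ℂ, ThreeTerm q a b c d l x →
        ∑ j ∈ jSet q a b c d, x j * x j / normH q a b c d j = normV q a b c d l →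
        (∀ j ∈ jSet q a b c d, x j = tet q a b c d j l) ∨
        (∀ j ∈ jSet q a b c d, x j = -tet q a b c d j l)) := by
  refine ⟨⟨⟨fun x y => braket_comm q a b c d x y⟩, braket_nondegenerate hq a b c d, ?_,
    fun l hl l' hl' => braket_ketV_ketV hq hl hl', fun l hl => normV_ne_zero hq hl,
    linearIndependent_ketV hq a b c d, span_ketV hq a b c d, ?_⟩,
    ⟨braket_opL_comm hq a b c d, ?_, ?_⟩,
    ⟨?_, Lbar_comm q a b c d, fun j j' h => Lbar_tridiagonal h, fun j hj => Lbar_self hq hj,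
      fun j _ => Lbar_self_eq_zero hq, fun j hj hj2 => Lbar_add_two hq hj hj2⟩,
    ⟨fun x y l hx hy h => tet_vertical_two hq hx hy h,
      fun x y j hx h => ⟨tet_horizontal_two hq hx h, tet_horizontal_two' hq hx h⟩,
      fun j hj h => theta_self_two hq hj h, theta_add_two_two hq⟩, ?_⟩
  · intro j j'
    rw [braket_ketH_left, ketH]
    by_cases h : j = j'
    · rw [if_pos h, h, Pi.single_eq_same, mul_one]
    · rw [if_neg h, Pi.single_eq_of_ne h, mul_zero]
  · intro j l _
    rw [braket_ketH_left, ketV_apply, mul_div_cancel₀ _ (normH_ne_zero hq j.2)]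
  · intro l hl l' hl'
    refine ⟨?_, braket_ketV_opL_ketV hq hl hl'⟩
    rw [braket_ketV_opL_ketV hq hl hl', braket_ketV_ketV hq hl hl', ← lam_mul_normV hq hl]
    split_ifs <;> simp
  · intro l hl
    exact ⟨Module.End.mem_eigenspace_iff.2 (opL_ketV hq hl), ketV_ne_zero hq hl⟩
  · intro j j'
    rw [braket_ketH_left, opL_apply, Finset.sum_eq_single j']
    · rw [ketH, Pi.single_eq_same, mul_one, mul_div_cancel₀ _ (normH_ne_zero hq j.2)]
    · intro i _ hij
      rw [ketH, Pi.single_eq_of_ne hij, mul_zero]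
    · exact fun h => absurd (Finset.mem_univ j') h
  · intro l hl
    have hnorm : ∑ j ∈ jSet q a b c d, tet q a b c d j l * tet q a b c d j l / normH q a b c d j
        = normV q a b c d l := by
      rw [sum_tet_mul_tet hq hl hl, if_pos rfl]
    refine ⟨fun j hj => ?_, threeTerm_tet hq hl, hnorm, fun x hx hxn => ?_⟩
    · simp only [sub_mul, Finset.sum_sub_distrib, mul_ite, mul_zero, ite_mul, zero_mul]
      rw [Finset.sum_ite_eq, if_pos hj, mul_assoc, mul_div_cancel₀ _ (normH_ne_zero hq hj),
        ← sum_Lbar_mul_tet hq hj hl, sub_eq_zero]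
      exact Finset.sum_congr rfl fun j' _ => by ring
    · obtain ⟨k, hk⟩ := hx.eq_mul_tet hq hl
      have hk2 : k ^ 2 = 1 := by
        apply mul_right_cancel₀ (normV_ne_zero hq hl)
        rw [one_mul]
        nth_rewrite 1 [← hnorm]
        rw [← hxn, Finset.mul_sum]
        refine Finset.sum_congr rfl fun j hj => ?_
        rw [hk j hj]
        ring
      rcases mul_self_eq_one_iff.1 ((sq k).symm.trans hk2) with h | h
      · exact Or.inl fun j hj => by rw [hk j hj, h, one_mul]
      · exact Or.inr fun j hj => by rw [hk j hj, h, neg_one_mul]
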